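/- A categorical data set consists of $n$ data points $r_1,\dots,r_n\in\mathbb R$ (repetitions allowed), each labelled with one of $k$ categories $0,\dots,k-1$, every category occurring at least once. For a category $c$ let $Y_c$ be the multiset of the data points labelled $c$ and $f_c(x)=\sum_{y\in Y_c}|y-x|$. The median split problem asks for $a,b\in\mathbb R$ that minimize $$g(a,b)=\sum_{c}\min\{f_c(a),f_c(b)\}.$$ For a set $\mathcal S$ of categories let $\mathrm{MAE}(\mathcal S)=\min_{a\in\mathbb R}\sum_{c\in\mathcal S}f_c(a)$ and $\lambda(\mathcal S)=\mathrm{MAE}(\mathcal S)+\mathrm{MAE}(\mathcal S^c)$, where $\mathcal S^c$ is the complementary set of categories. The exact MAE split problem asks for a set $\mathcal S$ with $\mathcal S\neq\emptyset$ and $\mathcal S^c\neq\emptyset$ that minimizes $\lambda(\mathcal S)$. The model of computation is the real RAM with unit cost: integer and real registers and indirectly addressed integer and real arrays; addition, truncated subtraction, halving (rounded down) and comparison of natural numbers; the four field operations, comparison and rational constants on reals; conversion of natural numbers to reals, but no conversion of reals to integers. **Theorem.** There are a single real RAM program and a constant $C$ such that for all $n$, $k$ and every categorical data set with $n$ data points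 and $k$ categories, given as $n$, $k$ and the list of the pairs (value, category), the program halts and outputs $a,b\in\mathbb R$ that minimize $g$, together with the optimal value $g(a,b)$ and, if $k\ge 2$, a set $\mathcal S$ of categories that is an optimal solution of the exact MAE split problem, with $\lambda(\mathcal S)=g(a,b)$. If $n\ge 2$, it does so within $C\,(n+k\log k)\log n$ steps. -/

import Mathlib

/-! ## The real RAM

A random access machine with integer and real registers and with integer and real memory,
programmed in a structured language.  Registers and memory segments (arrays) are named by
numerals that occur literally in the program text, so a program uses finitely many of them; cells of
a segment are addressed by integers computed at run time.  Every primitive operation (arithmetic,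
comparison, fetch, assignment, branching) costs one step. -/

namespace RealRAM

/-- Contents of the machine: registers, and arrays (first argument: the array, second: the cell). -/
structure Store where
  natReg : ℕ → ℕ
  realReg : ℕ → ℝ
  natArr : ℕ → ℕ → ℕ
  realArr : ℕ → ℕ → ℝ

/-- Integer expressions: no multiplication, so that integers cannot grow by squaring. -/
inductive NatExpr where
  | const (m : ℕ)
  | reg (x : ℕ)
  | fetch (A : ℕ) (i : NatExpr)
  | add (e f : NatExpr)
  | sub (e f : NatExpr)
  | half (e : NatExpr)

/-- Real expressions: field operations, rational constants, and conversion of integers to reals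
(there is no conversion from reals to integers). -/
inductive RealExpr where
  | const (q : ℚ)
  | reg (x : ℕ)
  | fetch (A : ℕ) (i : NatExpr)
  | cast (e : NatExpr)
  | add (e f : RealExpr)
  | sub (e f : RealExpr)
  | mul (e f : RealExpr)
  | div (e f : RealExpr)

/-- Tests. -/
inductive Test where
  | natLe (e f : NatExpr)
  | realLe (e f : RealExpr)
  | not (b : Test)
  | and (b c : Test)
  | or (b c : Test)

/-- Programs. -/
inductive Program where
  | skip
  | setNat (x : ℕ) (e : NatExpr)
  | setReal (x : ℕ) (e : RealExpr)
  | storeNat (A : ℕ) (i e : NatExpr)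
  | storeReal (A : ℕ) (i : NatExpr) (e : RealExpr)
  | seq (p q : Program)
  | ite (b : Test) (p q : Program)
  | loop (b : Test) (p : Program)

/-- Value of an integer expression; subtraction is truncated at `0`, halving rounds down. -/
def NatExpr.eval (s : Store) : NatExpr → ℕ
  | const m => m
  | reg x => s.natReg x
  | fetch A i => s.natArr A (i.eval s)
  | add e f => e.eval s + f.eval s
  | sub e f => e.eval s - f.eval s
  | half e => e.eval s / 2

/-- Number of steps for the evaluation of an integer expression. -/
def NatExpr.cost : NatExpr → ℕ
  | const _ => 1
  | reg _ => 1
  | fetch _ i => i.cost + 1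
  | add e f => e.cost + f.cost + 1
  | sub e f => e.cost + f.cost + 1
  | half e => e.cost + 1

/-- Value of a real expression; a division by zero returns `0`. -/
noncomputable def RealExpr.eval (s : Store) : RealExpr → ℝ
  | const q => (q : ℝ)
  | reg x => s.realReg x
  | fetch A i => s.realArr A (i.eval s)
  | cast e => (e.eval s : ℝ)
  | add e f => e.eval s + f.eval s
  | sub e f => e.eval s - f.eval s
  | mul e f => e.eval s * f.eval s
  | div e f => e.eval s / f.eval s

/-- Number of steps for the evaluation of a real expression. -/
def RealExpr.cost : RealExpr → ℕ
  | const _ => 1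
  | reg _ => 1
  | fetch _ i => i.cost + 1
  | cast e => e.cost + 1
  | add e f => e.cost + f.cost + 1
  | sub e f => e.cost + f.cost + 1
  | mul e f => e.cost + f.cost + 1
  | div e f => e.cost + f.cost + 1

/-- The test holds in the given store. -/
def Test.Holds (s : Store) : Test → Prop
  | natLe e f => e.eval s ≤ f.eval s
  | realLe e f => e.eval s ≤ f.eval s
  | not b => ¬ b.Holds s
  | and b c => b.Holds s ∧ c.Holds s
  | or b c => b.Holds s ∨ c.Holds s

/-- Number of steps for a test (both parts of a conjunction or disjunction are evaluated). -/
def Test.cost : Test → ℕ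
  | natLe e f => e.cost + f.cost + 1
  | realLe e f => e.cost + f.cost + 1
  | not b => b.cost + 1
  | and b c => b.cost + c.cost + 1
  | or b c => b.cost + c.cost + 1

/-- The store after writing to an integer register. -/
def Store.setNat (s : Store) (x v : ℕ) : Store :=
  { s with natReg := Function.update s.natReg x v }

/-- The store after writing to a real register. -/
def Store.setReal (s : Store) (x : ℕ) (v : ℝ) : Store :=
  { s with realReg := Function.update s.realReg x v }

/-- The store after writing to a cell of an integer array. -/
def Store.storeNat (s : Store) (A i v : ℕ) : Store :=
  { s with natArr := Function.update s.natArr A (Function.update (s.natArr A) i v) }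

/-- The store after writing to a cell of a real array. -/
def Store.storeReal (s : Store) (A i : ℕ) (v : ℝ) : Store :=
  { s with realArr := Function.update s.realArr A (Function.update (s.realArr A) i v) }

/-- `Runs p s t s'`: started in the store `s`, the program `p` halts after exactly `t` steps in the
store `s'`. -/
inductive Runs : Program → Store → ℕ → Store → Prop
  | skip (s : Store) : Runs .skip s 1 s
  | setNat (s : Store) (x : ℕ) (e : NatExpr) :
      Runs (.setNat x e) s (e.cost + 1) (s.setNat x (e.eval s))
  | setReal (s : Store) (x : ℕ) (e : RealExpr) :
      Runs (.setReal x e) s (e.cost + 1) (s.setReal x (e.eval s))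
  | storeNat (s : Store) (A : ℕ) (i e : NatExpr) :
      Runs (.storeNat A i e) s (i.cost + e.cost + 1) (s.storeNat A (i.eval s) (e.eval s))
  | storeReal (s : Store) (A : ℕ) (i : NatExpr) (e : RealExpr) :
      Runs (.storeReal A i e) s (i.cost + e.cost + 1) (s.storeReal A (i.eval s) (e.eval s))
  | seq {p q : Program} {s s' s'' : Store} {t t' : ℕ} :
      Runs p s t s' → Runs q s' t' s'' → Runs (.seq p q) s (t + t') s''
  | iteTrue {b : Test} {p q : Program} {s s' : Store} {t : ℕ} :
      b.Holds s → Runs p s t s' → Runs (.ite b p q) s (b.cost + 1 + t) s'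
  | iteFalse {b : Test} {p q : Program} {s s' : Store} {t : ℕ} :
      ¬ b.Holds s → Runs q s t s' → Runs (.ite b p q) s (b.cost + 1 + t) s'
  | loopDone {b : Test} {p : Program} {s : Store} :
      ¬ b.Holds s → Runs (.loop b p) s (b.cost + 1) s
  | loopStep {b : Test} {p : Program} {s s' s'' : Store} {t t' : ℕ} :
      b.Holds s → Runs p s t s' → Runs (.loop b p) s' t' s'' →
        Runs (.loop b p) s (b.cost + 1 + t + t') s''

end RealRAM

/-! ## Median splits -/

/-- `n` data points on the real line (repetitions allowed), each with one of `k` categories; every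
category occurs. -/
structure CategoricalData (n k : ℕ) where
  value : Fin n → ℝ
  category : Fin n → Fin k
  category_surjective : Function.Surjective category

namespace CategoricalData

variable {n k : ℕ}

/-- The sum of the distances from `x` to the data points of the category `c`. -/
noncomputable def cost (D : CategoricalData n k) (c : Fin k) (x : ℝ) : ℝ :=
  ∑ i with D.category i = c, |D.value i - x|

/-- The objective function of the median split problem. -/
noncomputable def medianCost (D : CategoricalData n k) (a b : ℝ) : ℝ :=
  ∑ c, min (D.cost c a) (D.cost c b)

/-- `(a, b)` solves the median split problem. -/
def IsMedianSplit (D : CategoricalData n k) (a b : ℝ) : Prop :=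
  ∀ a' b' : ℝ, D.medianCost a b ≤ D.medianCost a' b'

/-- The absolute error `min_a ∑ |x - a|`, over the data points `x` whose category lies in `S`. -/
noncomputable def mae (D : CategoricalData n k) (S : Finset (Fin k)) : ℝ :=
  ⨅ a : ℝ, ∑ i with D.category i ∈ S, |D.value i - a|

/-- The error of the split of the categories into `S` and its complement. -/
noncomputable def splitError (D : CategoricalData n k) (S : Finset (Fin k)) : ℝ :=
  D.mae S + D.mae Sᶜ

/-- `S` and its complement are nonempty and form a split of least error. -/
def IsOptimalSplit (D : CategoricalData n k) (S : Finset (Fin k)) : Prop :=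
  S.Nonempty ∧ Sᶜ.Nonempty ∧
    ∀ T : Finset (Fin k), T.Nonempty → Tᶜ.Nonempty → D.splitError S ≤ D.splitError T

/-- Input convention: integer registers `0` and `1` hold `n` and `k`; cell `i < n` of the real array
`0` and of the integer array `0` hold the value and the category of the `i`-th data point;
everything else is `0`. -/
def inputStore (D : CategoricalData n k) : RealRAM.Store where
  natReg x := if x = 0 then n else if x = 1 then k else 0
  realReg _ := 0
  natArr A i := if h : i < n then (if A = 0 then (D.category ⟨i, h⟩ : ℕ) else 0) else 0
  realArr A i := if h : i < n then (if A = 0 then D.value ⟨i, h⟩ else 0) else 0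

/-- Output convention: the set of the categories `c` such that cell `c` of the integer array `1`
holds a `1`. -/
def outputSplit (k : ℕ) (s : RealRAM.Store) : Finset (Fin k) :=
  Finset.univ.filter fun c => s.natArr 1 c = 1

end CategoricalData

/-!
The program finds the least value of the objective function among pairs of data points, by a search
for the row minima of a matrix with the Monge property that evaluates a whole level of the search
in time `O(n + k log n)`.

Let `x 0 ≤ … ≤ x (n - 1)` be the sorted data points and `M = n / 2`.  An optimal solution assigns
each category to one of the two candidates, so the candidates may be taken to be medians of the
points assigned to them.  The median of all the points lies between these two medians, so it
suffices to consider the pairs `(x i, x j)` with `i ≤ M ≤ j` (`exists_splitCost_le`).  The distance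
sums of a category are quasiconvex along the sorted points; therefore the matrix of the values of
the objective function at these pairs has the Monge property (`isMonge_splitCost`), and the minimum
of a row can be found between the columns of the minima of two rows around it
(`IsMonge.isRowMin`).  Once the minima of the rows that are multiples of `2 * w` are known, those of
the remaining multiples of `w` are thus found on one monotone path through the matrix, which leaves
each row in the column of the minimum of the nearest known row (`RowsKnown.refine`).  There are
`O(log n)` levels, and a path has `n` cells.

It remains to evaluate the objective function along a path in time `O(n + k log n)`
(`exec_level`).  On the path `i` and `j` grow, and each category changes sides at most once, from
the right candidate to the left one (`Switched.mono`).  The distance sums of a category at `x i` and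
`x j` are affine functions of `x i` and `x j` that change only when the path reaches a point of the
category.  Following the path, one updates these functions, at constant cost for each cell, and
learns between which two such events the category changes sides (`exec_bracketSwitches`); inside
this interval its affine functions are fixed and can be evaluated in constant time, so a binary
search finds the moment of the change in `O(log n)` steps (`exec_findSwitches`).  From then on it is
known at which times the distance of each point is counted to which candidate and with which sign:
each point changes its contribution to the objective function, as an affine function of `x i` and
`x j`, at most four times.  The changes are collected in difference arrays, whose partial sums give
the objective function at all the cells of the path (`sum_contribution`, `exec_evalPath`).

Together with merge sort this takes `O((n + k log n) log n)` steps, and `k log n` is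
`O(n + k log k)` (`mul_log_le`).  Finally, the categories that prefer the left candidate form a
split whose error is at most the value found, while no split has a smaller error than that
(`le_splitError`).  If one side is empty, one candidate serves all the categories equally well or
better, and moving a category to the empty side with the same candidate costs nothing
(`exec_writeSplit`).
-/

namespace RealRAM

/-! ### Notation for programs -/

infixr:60 " ;; " => Program.seq
infix:61 " ≔ₙ " => Program.setNat
infix:61 " ≔ᵣ " => Program.setReal
infix:63 " ≤ₙ " => Test.natLe
infix:63 " ≤ᵣ " => Test.realLe

section Arithmetic

instance : Add NatExpr := ⟨.add⟩
instance : Sub NatExpr := ⟨.sub⟩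
instance (m : ℕ) : OfNat NatExpr m := ⟨.const m⟩
instance : Add RealExpr := ⟨.add⟩
instance : Sub RealExpr := ⟨.sub⟩
instance : Mul RealExpr := ⟨.mul⟩
instance (m : ℕ) : OfNat RealExpr m := ⟨.const m⟩

variable (s : Store)

@[simp] theorem NatExpr.eval_add (e f : NatExpr) : (e + f).eval s = e.eval s + f.eval s := rfl
@[simp] theorem NatExpr.eval_sub (e f : NatExpr) : (e - f).eval s = e.eval s - f.eval s := rfl
@[simp] theorem NatExpr.eval_ofNat (m : ℕ) : (ofNat(m) : NatExpr).eval s = m := rfl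
@[simp] theorem RealExpr.eval_add (e f : RealExpr) : (e + f).eval s = e.eval s + f.eval s := rfl
@[simp] theorem RealExpr.eval_sub (e f : RealExpr) : (e - f).eval s = e.eval s - f.eval s := rfl
@[simp] theorem RealExpr.eval_mul (e f : RealExpr) : (e * f).eval s = e.eval s * f.eval s := rfl
@[simp] theorem RealExpr.eval_ofNat (m : ℕ) : (ofNat(m) : RealExpr).eval s = m := by
  change ((m : ℚ) : ℝ) = m
  norm_cast

end Arithmetic

/-! ### Reading a store after a write -/

section Projections
variable (s : Store) (x y v A B i : ℕ) (r : ℝ)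

@[simp] theorem Store.natReg_setNat :
    (s.setNat x v).natReg y = if y = x then v else s.natReg y := by
  simp [Store.setNat, Function.update_apply]
@[simp] theorem Store.realReg_setNat : (s.setNat x v).realReg = s.realReg := rfl
@[simp] theorem Store.natArr_setNat : (s.setNat x v).natArr = s.natArr := rfl
@[simp] theorem Store.realArr_setNat : (s.setNat x v).realArr = s.realArr := rfl

@[simp] theorem Store.realReg_setReal :
    (s.setReal x r).realReg y = if y = x then r else s.realReg y := by
  simp [Store.setReal, Function.update_apply]
@[simp] theorem Store.natReg_setReal : (s.setReal x r).natReg = s.natReg := rfl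
@[simp] theorem Store.natArr_setReal : (s.setReal x r).natArr = s.natArr := rfl
@[simp] theorem Store.realArr_setReal : (s.setReal x r).realArr = s.realArr := rfl

@[simp] theorem Store.natArr_storeNat :
    (s.storeNat A i v).natArr B =
      if B = A then Function.update (s.natArr A) i v else s.natArr B := by
  simp only [Store.storeNat, Function.update_apply]
@[simp] theorem Store.natReg_storeNat : (s.storeNat A i v).natReg = s.natReg := rfl
@[simp] theorem Store.realReg_storeNat : (s.storeNat A i v).realReg = s.realReg := rfl
@[simp] theorem Store.realArr_storeNat : (s.storeNat A i v).realArr = s.realArr := rfl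

@[simp] theorem Store.realArr_storeReal :
    (s.storeReal A i r).realArr B =
      if B = A then Function.update (s.realArr A) i r else s.realArr B := by
  simp only [Store.storeReal, Function.update_apply]
@[simp] theorem Store.natReg_storeReal : (s.storeReal A i r).natReg = s.natReg := rfl
@[simp] theorem Store.realReg_storeReal : (s.storeReal A i r).realReg = s.realReg := rfl
@[simp] theorem Store.natArr_storeReal : (s.storeReal A i r).natArr = s.natArr := rfl

end Projections

/-! ### What a program leaves unchanged -/

/-- The integer registers that occur as targets of assignments. -/
def Program.natRegs : Program → List ℕ
  | .setNat x _ => [x]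
  | .seq p q => p.natRegs ++ q.natRegs
  | .ite _ p q => p.natRegs ++ q.natRegs
  | .loop _ p => p.natRegs
  | _ => []

/-- The real registers that occur as targets of assignments. -/
def Program.realRegs : Program → List ℕ
  | .setReal x _ => [x]
  | .seq p q => p.realRegs ++ q.realRegs
  | .ite _ p q => p.realRegs ++ q.realRegs
  | .loop _ p => p.realRegs
  | _ => []

/-- The integer arrays that occur as targets of assignments. -/
def Program.natArrs : Program → List ℕ
  | .storeNat A _ _ => [A]
  | .seq p q => p.natArrs ++ q.natArrs
  | .ite _ p q => p.natArrs ++ q.natArrs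
  | .loop _ p => p.natArrs
  | _ => []

/-- The real arrays that occur as targets of assignments. -/
def Program.realArrs : Program → List ℕ
  | .storeReal A _ _ => [A]
  | .seq p q => p.realArrs ++ q.realArrs
  | .ite _ p q => p.realArrs ++ q.realArrs
  | .loop _ p => p.realArrs
  | _ => []

/-- The stores `s` and `s'` agree on everything that `p` does not assign to. -/
structure Frame (p : Program) (s s' : Store) : Prop where
  natReg : ∀ x, x ∉ p.natRegs → s'.natReg x = s.natReg x
  realReg : ∀ x, x ∉ p.realRegs → s'.realReg x = s.realReg x
  natArr : ∀ A, A ∉ p.natArrs → s'.natArr A = s.natArr A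
  realArr : ∀ A, A ∉ p.realArrs → s'.realArr A = s.realArr A

theorem Frame.refl (p : Program) (s : Store) : Frame p s s :=
  ⟨fun _ _ => rfl, fun _ _ => rfl, fun _ _ => rfl, fun _ _ => rfl⟩

theorem Frame.trans {p : Program} {s s' s'' : Store} (h : Frame p s s') (h' : Frame p s' s'') :
    Frame p s s'' :=
  ⟨fun x hx => (h'.natReg x hx).trans (h.natReg x hx),
    fun x hx => (h'.realReg x hx).trans (h.realReg x hx),
    fun x hx => (h'.natArr x hx).trans (h.natArr x hx),
    fun x hx => (h'.realArr x hx).trans (h.realArr x hx)⟩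

theorem Frame.weaken {p q : Program} {s s' : Store} (h : Frame p s s')
    (h₁ : p.natRegs ⊆ q.natRegs) (h₂ : p.realRegs ⊆ q.realRegs)
    (h₃ : p.natArrs ⊆ q.natArrs) (h₄ : p.realArrs ⊆ q.realArrs) : Frame q s s' :=
  ⟨fun x hx => h.natReg x fun h' => hx (h₁ h'), fun x hx => h.realReg x fun h' => hx (h₂ h'),
    fun x hx => h.natArr x fun h' => hx (h₃ h'), fun x hx => h.realArr x fun h' => hx (h₄ h')⟩

theorem Frame.seqLeft {p q : Program} {s s' : Store} (h : Frame p s s') : Frame (p ;; q) s s' :=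
  h.weaken (List.subset_append_left _ _) (List.subset_append_left _ _)
    (List.subset_append_left _ _) (List.subset_append_left _ _)

theorem Frame.seqRight {p q : Program} {s s' : Store} (h : Frame q s s') : Frame (p ;; q) s s' :=
  h.weaken (List.subset_append_right _ _) (List.subset_append_right _ _)
    (List.subset_append_right _ _) (List.subset_append_right _ _)

/-- The frame rule.  Since the names of registers and arrays occur literally in the program, which
of them are left alone is decidable, and is settled by `decide` in the proofs below. -/
theorem Runs.frame {p : Program} {s s' : Store} {t : ℕ} (h : Runs p s t s') : Frame p s s' := by
  induction h with
  | skip s => exact Frame.refl _ _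
  | setNat s x e =>
    refine ⟨fun y hy => ?_, fun _ _ => rfl, fun _ _ => rfl, fun _ _ => rfl⟩
    simp only [Program.natRegs, List.mem_singleton] at hy
    simp [hy]
  | setReal s x e =>
    refine ⟨fun _ _ => rfl, fun y hy => ?_, fun _ _ => rfl, fun _ _ => rfl⟩
    simp only [Program.realRegs, List.mem_singleton] at hy
    simp [hy]
  | storeNat s A i e =>
    refine ⟨fun _ _ => rfl, fun _ _ => rfl, fun y hy => ?_, fun _ _ => rfl⟩
    simp only [Program.natArrs, List.mem_singleton] at hy
    simp [hy]
  | storeReal s A i e =>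
    refine ⟨fun _ _ => rfl, fun _ _ => rfl, fun _ _ => rfl, fun y hy => ?_⟩
    simp only [Program.realArrs, List.mem_singleton] at hy
    simp [hy]
  | seq _ _ ih₁ ih₂ => exact ih₁.seqLeft.trans ih₂.seqRight
  | iteTrue _ _ ih =>
    exact ih.weaken (List.subset_append_left _ _) (List.subset_append_left _ _)
      (List.subset_append_left _ _) (List.subset_append_left _ _)
  | iteFalse _ _ ih =>
    exact ih.weaken (List.subset_append_right _ _) (List.subset_append_right _ _)
      (List.subset_append_right _ _) (List.subset_append_right _ _)
  | loopDone _ => exact Frame.refl _ _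
  | loopStep _ _ _ ih₁ ih₂ => exact Frame.trans (p := .loop _ _) ⟨ih₁.1, ih₁.2, ih₁.3, ih₁.4⟩ ih₂

/-! ### Total correctness with a time bound -/

/-- Started in `s`, the program halts within `T` steps in a store that satisfies `Q`. -/
def Exec (p : Program) (s : Store) (T : ℕ) (Q : Store → Prop) : Prop :=
  ∃ t s', Runs p s t s' ∧ t ≤ T ∧ Q s'

theorem Exec.mono {p : Program} {s : Store} {T T' : ℕ} {Q Q' : Store → Prop}
    (h : Exec p s T Q) (hT : T ≤ T') (hQ : ∀ s', Q s' → Q' s') : Exec p s T' Q' :=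
  let ⟨t, s', hr, ht, hq⟩ := h
  ⟨t, s', hr, ht.trans hT, hQ s' hq⟩

theorem Exec.framed {p : Program} {s : Store} {T : ℕ} {Q : Store → Prop} (h : Exec p s T Q) :
    Exec p s T fun s' => Q s' ∧ Frame p s s' :=
  let ⟨t, s', hr, ht, hq⟩ := h
  ⟨t, s', hr, ht, hq, hr.frame⟩

theorem Exec.seq {p q : Program} {s : Store} {T T' : ℕ} {R Q : Store → Prop}
    (hp : Exec p s T R) (hq : ∀ s', R s' → Frame p s s' → Exec q s' T' Q) :
    Exec (p ;; q) s (T + T') Q := by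
  obtain ⟨t, s', hr, ht, h⟩ := hp
  obtain ⟨t', s'', hr', ht', h'⟩ := hq s' h hr.frame
  exact ⟨t + t', s'', .seq hr hr', by omega, h'⟩

theorem Exec.ite {b : Test} {p q : Program} {s : Store} {T : ℕ} {Q : Store → Prop}
    (hp : b.Holds s → Exec p s T Q) (hq : ¬ b.Holds s → Exec q s T Q) :
    Exec (.ite b p q) s (b.cost + 1 + T) Q := by
  by_cases hb : b.Holds s
  · obtain ⟨t, s', hr, ht, h⟩ := hp hb
    exact ⟨_, s', .iteTrue hb hr, by omega, h⟩
  · obtain ⟨t, s', hr, ht, h⟩ := hq hb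
    exact ⟨_, s', .iteFalse hb hr, by omega, h⟩

/-- The rule for a loop with an invariant whose index `d` bounds the number of iterations
that are still to come. -/
theorem Exec.loop {b : Test} {p : Program} {c : ℕ} {Inv : ℕ → Store → Prop}
    (step : ∀ d s, Inv d s → b.Holds s → ∃ d', d = d' + 1 ∧ Exec p s c (Inv d')) :
    ∀ (d : ℕ) (s : Store), Inv d s → Exec (.loop b p) s (d * (b.cost + 1 + c) + (b.cost + 1))
      fun s' => (∃ d', Inv d' s') ∧ ¬ b.Holds s' := by
  intro d
  induction d with
  | zero =>
    intro s hs
    refine ⟨_, s, .loopDone fun hb => ?_, by omega, ⟨0, hs⟩, fun hb => ?_⟩ <;>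
    · obtain ⟨d', hd, -⟩ := step 0 s hs hb
      omega
  | succ d ih =>
    intro s hs
    by_cases hb : b.Holds s
    · obtain ⟨d', hd, t, s', hr, ht, h⟩ := step _ s hs hb
      obtain rfl : d = d' := by omega
      obtain ⟨t', s'', hr', ht', h'⟩ := ih s' h
      refine ⟨_, s'', .loopStep hb hr hr', ?_, h'⟩
      rw [Nat.succ_mul]
      omega
    · refine ⟨_, s, .loopDone hb, by omega, ⟨_, hs⟩, hb⟩

/-- The counting loop: `p` is executed with register `x` equal to `0, 1, …` below the value of
register `y`. -/
def forLoop (x y : ℕ) (p : Program) : Program :=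
  .setNat x (.const 0) ;;
  .loop (.natLe (.add (.reg x) (.const 1)) (.reg y)) (p ;; .setNat x (.add (.reg x) (.const 1)))

/-- The rule for counting loops.  The invariant is stated with the counter already in place, so that
`Inv i` may speak of the register `x`; each of the `N` rounds costs at most `c + 10` steps. -/
theorem Exec.forLoop {x y : ℕ} {p : Program} {s : Store} {N c : ℕ} (Inv : ℕ → Store → Prop)
    (hN : s.natReg y = N) (hxy : y ≠ x) (hx : x ∉ p.natRegs) (hy : y ∉ p.natRegs)
    (init : Inv 0 (s.setNat x 0))
    (step : ∀ i s', i < N → s'.natReg x = i → Frame (forLoop x y p) s s' → Inv i s' →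
      Exec p s' c fun s'' => Inv (i + 1) (s''.setNat x (i + 1))) :
    Exec (forLoop x y p) s (N * (c + 10) + 8) (Inv N) := by
  have hsub : ∀ {s₁ s₂ : Store}, Frame (RealRAM.forLoop x y p) s₁ s₂ →
      s₂.natReg y = s₁.natReg y := by
    intro s₁ s₂ h
    apply h.natReg
    simp [RealRAM.forLoop, Program.natRegs, hxy, hy]
  set J : ℕ → Store → Prop := fun d s' => ∃ i, i + d = N ∧ s'.natReg x = i ∧
    Frame (RealRAM.forLoop x y p) s s' ∧ Inv i s' with hJ
  have hr0 : Runs (.setNat x (.const 0)) s 2 (s.setNat x 0) := .setNat s x (.const 0)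
  have key := Exec.loop (b := .natLe (.add (.reg x) (.const 1)) (.reg y))
    (p := p ;; .setNat x (.add (.reg x) (.const 1))) (c := c + 4) (Inv := J) ?_ N (s.setNat x 0)
    ⟨0, by omega, by simp, hr0.frame.seqLeft, init⟩
  · refine (Exec.seq (T := 2) ⟨2, _, hr0, le_rfl, rfl⟩
      (R := fun s' => s' = s.setNat x 0) fun s' hs' _ => hs' ▸ key).mono ?_ ?_
    · simp only [Test.cost, NatExpr.cost]
      ring_nf
      omega
    · rintro s' ⟨⟨d, i, hi, hxi, hf, h⟩, hb⟩
      simp only [Test.Holds, NatExpr.eval, hsub hf, hxi, hN] at hb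
      obtain rfl : i = N := by omega
      exact h
  · rintro d s' ⟨i, hi, hxi, hf, h⟩ hb
    simp only [Test.Holds, NatExpr.eval, hsub hf, hxi, hN] at hb
    refine ⟨d - 1, by omega, ?_⟩
    obtain ⟨t, s'', hr, ht, h'⟩ := step i s' (by omega) hxi hf h
    have hxi' : s''.natReg x = i := (hr.frame.natReg x hx).trans hxi
    have hr' := Runs.setNat s'' x (.add (.reg x) (.const 1))
    simp only [NatExpr.eval, NatExpr.cost, hxi'] at hr'
    have hrr := Runs.seq hr hr'
    refine ⟨_, _, hrr, by omega, i + 1, by omega, by simp, hf.trans ?_, h'⟩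
    have := hrr.frame
    exact Frame.seqRight ⟨this.1, this.2, this.3, this.4⟩

/-! ### Weakest preconditions of programs without loops -/

/-- An upper bound for the number of steps of a program without loops; the value at a loop is never
used. -/
def Program.bound : Program → ℕ
  | .skip => 1
  | .setNat _ e => e.cost + 1
  | .setReal _ e => e.cost + 1
  | .storeNat _ i e => i.cost + e.cost + 1
  | .storeReal _ i e => i.cost + e.cost + 1
  | .seq p q => p.bound + q.bound
  | .ite b p q => b.cost + 1 + max p.bound q.bound
  | .loop _ _ => 0

/-- The weakest precondition of `Q` under a program without loops, by evaluation of the program on a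
symbolic store; it excludes loops. -/
def Program.wp : Program → (Store → Prop) → Store → Prop
  | .skip, Q, s => Q s
  | .setNat x e, Q, s => Q (s.setNat x (e.eval s))
  | .setReal x e, Q, s => Q (s.setReal x (e.eval s))
  | .storeNat A i e, Q, s => Q (s.storeNat A (i.eval s) (e.eval s))
  | .storeReal A i e, Q, s => Q (s.storeReal A (i.eval s) (e.eval s))
  | .seq p q, Q, s => p.wp (q.wp Q) s
  | .ite b p q, Q, s => (b.Holds s → p.wp Q s) ∧ (¬ b.Holds s → q.wp Q s)
  | .loop _ _, _, _ => False

theorem Exec.of_wp {p : Program} {s : Store} {Q : Store → Prop} (h : p.wp Q s) :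
    Exec p s p.bound Q := by
  induction p generalizing s Q with
  | skip => exact ⟨_, _, .skip s, le_rfl, h⟩
  | setNat x e => exact ⟨_, _, .setNat s x e, le_rfl, h⟩
  | setReal x e => exact ⟨_, _, .setReal s x e, le_rfl, h⟩
  | storeNat A i e => exact ⟨_, _, .storeNat s A i e, le_rfl, h⟩
  | storeReal A i e => exact ⟨_, _, .storeReal s A i e, le_rfl, h⟩
  | seq p q ihp ihq => exact Exec.seq (ihp h) fun s' h' _ => ihq h'
  | ite b p q ihp ihq =>
    exact Exec.ite (fun hb => (ihp (h.1 hb)).mono (le_max_left _ _) fun _ h => h)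
      fun hb => (ihq (h.2 hb)).mono (le_max_right _ _) fun _ h => h
  | loop b p _ => exact h.elim

/-! ### Merge sort -/

/- Names of registers and arrays begin with `r` (integer register), `y` (real register), `b`
(integer array) and `a` (real array).  Throughout the program `rN`, `rK` hold the numbers of points and of
categories, `rM` half the number of points, `rS` the length of the blocks or the distance of the
rows under consideration, and `rT` counts the rounds of a loop.  The input is in `aVal` and `bCat`,
the sorted points with their categories are in `aX` and `bKap`, and the split is written to
`bOut`. -/

notation "rN" => 0
notation "rK" => 1
notation "rM" => 2
notation "rS" => 3
notation "rI" => 4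
notation "rJ" => 5
notation "rMid" => 6
notation "rHi" => 7
notation "rT" => 8

notation "aVal" => 0
notation "aX" => 1
notation "aTmp" => 2
notation "bCat" => 0
notation "bOut" => 1
notation "bKap" => 2
notation "bTmp" => 3

/-- The first `n` entries of the pair of arrays `(Y, L)` are a rearrangement of those of `(X, K)`,
expressed by sums of test functions. -/
def SameData (n : ℕ) (X : ℕ → ℝ) (K : ℕ → ℕ) (Y : ℕ → ℝ) (L : ℕ → ℕ) : Prop :=
  ∀ F : ℝ → ℕ → ℝ, ∑ u ∈ Finset.range n, F (Y u) (L u) = ∑ u ∈ Finset.range n, F (X u) (K u)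

/-- Below `n`, the array is sorted within each block of `w` consecutive cells. -/
def BlockSorted (n w : ℕ) (X : ℕ → ℝ) : Prop :=
  ∀ b u v, b * w ≤ u → u ≤ v → v < b * w + w → v < n → X u ≤ X v

/-- The blocks before position `r`, which is the start of a block or `n`, have been merged in
pairs. -/
structure MergeBoundary (n w : ℕ) (X : ℕ → ℝ) (K : ℕ → ℕ) (Y : ℕ → ℝ) (L : ℕ → ℕ) (r : ℕ) :
    Prop where
  same : SameData r X K Y L
  start : ∃ b, (r = b * (2 * w) ∨ r = n ∧ n ≤ b * (2 * w)) ∧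
    ∀ b' < b, ∀ u v, b' * (2 * w) ≤ u → u ≤ v → v < b' * (2 * w) + 2 * w → v < n → Y u ≤ Y v

/-- The blocks from `lo` to `mid` and from `mid` to `hi` are being merged: the entries before `p`
and from `mid` to `q` have been moved, to the cells before `r`. -/
structure Merging (n w : ℕ) (X : ℕ → ℝ) (K : ℕ → ℕ) (Y : ℕ → ℝ) (L : ℕ → ℕ)
    (lo mid hi p q r : ℕ) : Prop where
  mid_eq : mid = min (lo + w) n
  hi_eq : hi = min (lo + 2 * w) n
  lo_le : lo ≤ p
  p_le : p ≤ mid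
  q_ge : mid ≤ q
  q_le : q ≤ hi
  r_eq : r + mid = p + q
  same : ∀ F : ℝ → ℕ → ℝ, ∑ u ∈ Finset.range r, F (Y u) (L u) =
    ∑ u ∈ Finset.range p, F (X u) (K u) + ∑ u ∈ Finset.Ico mid q, F (X u) (K u)
  sorted : ∀ u v, lo ≤ u → u ≤ v → v < r → Y u ≤ Y v
  left : ∀ u v, lo ≤ u → u < r → p ≤ v → v < mid → Y u ≤ X v
  right : ∀ u v, lo ≤ u → u < r → q ≤ v → v < hi → Y u ≤ X v
  /-- The pairs of blocks before `lo` have been merged. -/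
  start : ∃ b, lo = b * (2 * w) ∧
    ∀ b' < b, ∀ u v, b' * (2 * w) ≤ u → u ≤ v → v < b' * (2 * w) + 2 * w → v < n → Y u ≤ Y v

theorem MergeBoundary.merging {n w : ℕ} {X : ℕ → ℝ} {K : ℕ → ℕ} {Y : ℕ → ℝ} {L : ℕ → ℕ} {r : ℕ}
    (h : MergeBoundary n w X K Y L r) (hr : r < n) :
    Merging n w X K Y L r (min (r + w) n) (min (r + 2 * w) n) r (min (r + w) n) r := by
  obtain ⟨b, hb, hs⟩ := h.start
  refine ⟨rfl, rfl, le_rfl, by omega, le_rfl, by omega, by omega, ?_, by omega, by omega, by omega,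
    b, by omega, hs⟩
  intro F
  simpa using h.same F

theorem Merging.boundary {n w : ℕ} {X : ℕ → ℝ} {K : ℕ → ℕ} {Y : ℕ → ℝ} {L : ℕ → ℕ}
    {lo mid hi p q r : ℕ} (h : Merging n w X K Y L lo mid hi p q r) (hr : hi ≤ r) :
    MergeBoundary n w X K Y L r := by
  have h1 := h.p_le
  have h2 := h.q_le
  have h3 := h.r_eq
  have h4 := h.hi_eq
  obtain rfl : p = mid := by omega
  obtain rfl : q = hi := by omega
  obtain rfl : q = r := by omega
  obtain ⟨b, hb, hs⟩ := h.start
  refine ⟨fun F => ?_, b + 1, ?_, ?_⟩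
  · rw [h.same F, Finset.sum_range_add_sum_Ico _ h.q_ge]
  · rw [Nat.succ_mul]
    omega
  · intro b' hb' u v hu huv hv hvn
    rcases Nat.lt_succ_iff_lt_or_eq.1 hb' with hb' | rfl
    · exact hs b' hb' u v hu huv hv hvn
    · exact h.sorted u v (by omega) huv (by omega)

theorem Merging.takeLeft {n w : ℕ} {X : ℕ → ℝ} {K : ℕ → ℕ} {Y : ℕ → ℝ} {L : ℕ → ℕ}
    {lo mid hi p q r : ℕ} (h : Merging n w X K Y L lo mid hi p q r) (hX : BlockSorted n w X)
    (hp : p < mid) (hc : hi ≤ q ∨ X p ≤ X q) :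
    Merging n w X K (Function.update Y r (X p)) (Function.update L r (K p))
      lo mid hi (p + 1) q (r + 1) := by
  obtain ⟨mid_eq, hi_eq, lo_le, p_le, q_ge, q_le, r_eq, same, sorted, left, right, b, hb, hs⟩ := h
  have hr : lo ≤ r := by omega
  have hY : ∀ u, u < r → Function.update Y r (X p) u = Y u := fun u hu =>
    Function.update_of_ne (by omega) _ _
  have hl : ∀ u v, lo ≤ u → u ≤ v → v < lo + w → v < n → X u ≤ X v := by
    have e : 2 * b * w = lo := by rw [hb]; ring
    intro u v h1 h2 h3 h4
    exact hX (2 * b) u v (by omega) h2 (by omega) h4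
  have hrr : ∀ u v, lo + w ≤ u → u ≤ v → v < lo + w + w → v < n → X u ≤ X v := by
    have e : (2 * b + 1) * w = lo + w := by rw [hb]; ring
    intro u v h1 h2 h3 h4
    exact hX (2 * b + 1) u v (by omega) h2 (by omega) h4
  refine ⟨mid_eq, hi_eq, by omega, by omega, q_ge, q_le, by omega, ?_, ?_, ?_, ?_, b, hb, ?_⟩
  · intro F
    rw [Finset.sum_range_succ, Finset.sum_range_succ, Function.update_self, Function.update_self,
      Finset.sum_congr rfl (g := fun u => F (Y u) (L u)), same F]
    · ring
    · intro u hu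
      have hu := Finset.mem_range.1 hu
      rw [hY u hu, Function.update_of_ne (by omega)]
  · intro u v h1 h2 h3
    rcases Nat.lt_succ_iff_lt_or_eq.1 h3 with h3 | rfl
    · rw [hY u (by omega), hY v h3]
      exact sorted u v h1 h2 h3
    · rw [Function.update_self]
      rcases h2.lt_or_eq with h2 | rfl
      · rw [hY u h2]
        exact left u p h1 h2 le_rfl hp
      · rw [Function.update_self]
  · intro u v h1 h2 h3 h4
    rcases Nat.lt_succ_iff_lt_or_eq.1 h2 with h2 | rfl
    · rw [hY u h2]
      exact left u v h1 h2 (by omega) h4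
    · rw [Function.update_self]
      exact hl p v lo_le (by omega) (by omega) (by omega)
  · intro u v h1 h2 h3 h4
    rcases Nat.lt_succ_iff_lt_or_eq.1 h2 with h2 | rfl
    · rw [hY u h2]
      exact right u v h1 h2 (by omega) h4
    · rw [Function.update_self]
      exact (hc.resolve_left (by omega)).trans
        (hrr q v (by omega) (by omega) (by omega) (by omega))
  · intro b' hb' u v h1 h2 h3 h4
    have e : (b' + 1) * (2 * w) ≤ b * (2 * w) := Nat.mul_le_mul_right _ hb'
    rw [Nat.succ_mul] at e
    rw [hY u (by omega), hY v (by omega)]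
    exact hs b' hb' u v h1 h2 h3 h4

theorem Merging.takeRight {n w : ℕ} {X : ℕ → ℝ} {K : ℕ → ℕ} {Y : ℕ → ℝ} {L : ℕ → ℕ}
    {lo mid hi p q r : ℕ} (h : Merging n w X K Y L lo mid hi p q r) (hX : BlockSorted n w X)
    (hq : q < hi) (hc : mid ≤ p ∨ X q ≤ X p) :
    Merging n w X K (Function.update Y r (X q)) (Function.update L r (K q))
      lo mid hi p (q + 1) (r + 1) := by
  obtain ⟨mid_eq, hi_eq, lo_le, p_le, q_ge, q_le, r_eq, same, sorted, left, right, b, hb, hs⟩ := h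
  have hr : lo ≤ r := by omega
  have hY : ∀ u, u < r → Function.update Y r (X q) u = Y u := fun u hu =>
    Function.update_of_ne (by omega) _ _
  have hl : ∀ u v, lo ≤ u → u ≤ v → v < lo + w → v < n → X u ≤ X v := by
    have e : 2 * b * w = lo := by rw [hb]; ring
    intro u v h1 h2 h3 h4
    exact hX (2 * b) u v (by omega) h2 (by omega) h4
  have hrr : ∀ u v, lo + w ≤ u → u ≤ v → v < lo + w + w → v < n → X u ≤ X v := by
    have e : (2 * b + 1) * w = lo + w := by rw [hb]; ring
    intro u v h1 h2 h3 h4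
    exact hX (2 * b + 1) u v (by omega) h2 (by omega) h4
  refine ⟨mid_eq, hi_eq, by omega, by omega, by omega, by omega, by omega, ?_, ?_, ?_, ?_, b, hb,
    ?_⟩
  · intro F
    rw [Finset.sum_range_succ, Finset.sum_Ico_succ_top q_ge, Function.update_self,
      Function.update_self, Finset.sum_congr rfl (g := fun u => F (Y u) (L u)), same F]
    · ring
    · intro u hu
      have hu := Finset.mem_range.1 hu
      rw [hY u hu, Function.update_of_ne (by omega)]
  · intro u v h1 h2 h3
    rcases Nat.lt_succ_iff_lt_or_eq.1 h3 with h3 | rfl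
    · rw [hY u (by omega), hY v h3]
      exact sorted u v h1 h2 h3
    · rw [Function.update_self]
      rcases h2.lt_or_eq with h2 | rfl
      · rw [hY u h2]
        exact right u q h1 h2 le_rfl hq
      · rw [Function.update_self]
  · intro u v h1 h2 h3 h4
    rcases Nat.lt_succ_iff_lt_or_eq.1 h2 with h2 | rfl
    · rw [hY u h2]
      exact left u v h1 h2 (by omega) h4
    · rw [Function.update_self]
      exact (hc.resolve_left (by omega)).trans
        (hl p v (by omega) (by omega) (by omega) (by omega))
  · intro u v h1 h2 h3 h4
    rcases Nat.lt_succ_iff_lt_or_eq.1 h2 with h2 | rfl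
    · rw [hY u h2]
      exact right u v h1 h2 (by omega) h4
    · rw [Function.update_self]
      exact hrr q v (by omega) (by omega) (by omega) (by omega)
  · intro b' hb' u v h1 h2 h3 h4
    have e : (b' + 1) * (2 * w) ≤ b * (2 * w) := Nat.mul_le_mul_right _ hb'
    rw [Nat.succ_mul] at e
    rw [hY u (by omega), hY v (by omega)]
    exact hs b' hb' u v h1 h2 h3 h4

/-- At the end of a pair of blocks, go to the next pair.  The truncated subtraction
`u - (u - n)` is `min u n`. -/
def mergeReset : Program :=
  .ite (.reg rHi ≤ₙ .reg rT)
    (rI ≔ₙ .reg rT ;;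
      rMid ≔ₙ (.reg rT + .reg rS) - ((.reg rT + .reg rS) - .reg rN) ;;
      rJ ≔ₙ .reg rMid ;;
      rHi ≔ₙ (.reg rT + (.reg rS + .reg rS)) - ((.reg rT + (.reg rS + .reg rS)) - .reg rN))
    .skip

/-- Move the smaller one of the two front entries. -/
def mergeTake : Program :=
  .ite (.and (.reg rI + 1 ≤ₙ .reg rMid)
      (.or (.reg rHi ≤ₙ .reg rJ) (.fetch aX (.reg rI) ≤ᵣ .fetch aX (.reg rJ))))
    (.storeReal aTmp (.reg rT) (.fetch aX (.reg rI)) ;;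
      .storeNat bTmp (.reg rT) (.fetch bKap (.reg rI)) ;; rI ≔ₙ .reg rI + 1)
    (.storeReal aTmp (.reg rT) (.fetch aX (.reg rJ)) ;;
      .storeNat bTmp (.reg rT) (.fetch bKap (.reg rJ)) ;; rJ ≔ₙ .reg rJ + 1)

def copyBack : Program :=
  .storeReal aX (.reg rT) (.fetch aTmp (.reg rT)) ;;
  .storeNat bKap (.reg rT) (.fetch bTmp (.reg rT))

/-- Merge the blocks of `rS` cells in pairs.  One entry is moved in each round, so that a single
counting loop runs through all the pairs. -/
def mergePass : Program :=
  rHi ≔ₙ 0 ;; forLoop rT rN (mergeReset ;; mergeTake) ;; forLoop rT rN copyBack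

theorem exec_mergePass {n w : ℕ} {s : Store} (hn : s.natReg rN = n) (hw : s.natReg rS = w)
    (hw0 : 0 < w) (hX : BlockSorted n w (s.realArr aX)) :
    Exec mergePass s (200 * n + 30) fun s' => BlockSorted n (w + w) (s'.realArr aX) ∧
      SameData n (s.realArr aX) (s.natArr bKap) (s'.realArr aX) (s'.natArr bKap) := by
  set X := s.realArr aX with hXd
  set K := s.natArr bKap with hKd
  let Inv : ℕ → Store → Prop := fun r s' =>
    (s'.natReg rHi ≤ r ∧ MergeBoundary n w X K (s'.realArr aTmp) (s'.natArr bTmp) r) ∨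
    ∃ lo, Merging n w X K (s'.realArr aTmp) (s'.natArr bTmp) lo (s'.natReg rMid) (s'.natReg rHi)
      (s'.natReg rI) (s'.natReg rJ) r
  have h1 : Exec (rHi ≔ₙ 0) s 2 fun s' => s'.natReg rHi = 0 := by
    refine (Exec.of_wp ?_).mono (by decide) fun _ h => h
    simp [Program.wp, NatExpr.eval]
  refine (Exec.seq h1 fun s₁ hs₁ f₁ => Exec.seq (Exec.forLoop (x := rT) (y := rN)
    (p := mergeReset ;; mergeTake) Inv (N := n) (c := 80) ?_ (by decide) (by decide) (by decide)
      ?_ ?_) fun s₂ hs₂ f₂ =>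
      (Exec.forLoop (x := rT) (y := rN) (p := copyBack)
        (fun i s' => ∀ u < i, s'.realArr aX u = s₂.realArr aTmp u ∧
        s'.natArr bKap u = s₂.natArr bTmp u) (N := n) (c := 8) ?_ (by decide) (by decide)
          (by decide) ?_ ?_).mono le_rfl ?_).mono ?_ fun _ h => h
  · rw [f₁.natReg _ (by decide), hn]
  · left
    refine ⟨by simp [hs₁], fun F => by simp, 0, by simp, by simp⟩
  · intro r s' hr hrT hf inv
    have e1 : s'.natReg rN = n := by rw [hf.natReg _ (by decide), f₁.natReg _ (by decide), hn]
    have e2 : s'.natReg rS = w := by rw [hf.natReg _ (by decide), f₁.natReg _ (by decide), hw]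
    have e3 : s'.realArr aX = X := by rw [hf.realArr _ (by decide), f₁.realArr _ (by decide)]
    have e4 : s'.natArr bKap = K := by rw [hf.natArr _ (by decide), f₁.natArr _ (by decide)]
    have reset : Exec mergeReset s' 42 fun s'' => s''.natReg rT = r ∧
        ∃ lo, r < s''.natReg rHi ∧ Merging n w X K (s''.realArr aTmp) (s''.natArr bTmp) lo
          (s''.natReg rMid) (s''.natReg rHi) (s''.natReg rI) (s''.natReg rJ) r := by
      refine (Exec.of_wp ?_).mono (by decide) fun _ h => h
      simp only [mergeReset, Program.wp, Test.Holds, NatExpr.eval, NatExpr.eval_sub, hrT]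
      constructor
      · intro hb
        have hB : MergeBoundary n w X K (s'.realArr aTmp) (s'.natArr bTmp) r := by
          rcases inv with inv | ⟨lo, inv⟩
          · exact inv.2
          · exact inv.boundary hb
        have := hB.merging hr
        simp only [Store.natReg_setNat, Store.realArr_setNat, Store.natArr_setNat, hrT, e1, e2]
        refine ⟨by simp, r, by simp; omega, ?_⟩
        have m1 : r + w - (r + w - n) = min (r + w) n := by omega
        have m2 : r + (w + w) - (r + (w + w) - n) = min (r + 2 * w) n := by omega
        simpa [m1, m2] using this
      · intro hb
        rcases inv with inv | ⟨lo, inv⟩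
        · exact absurd inv.1 hb
        · exact ⟨trivial, lo, by omega, inv⟩
    refine (Exec.seq reset fun s'' hs'' f'' => (Exec.of_wp (p := mergeTake) ?_)).mono
      (by decide) fun _ h => h
    obtain ⟨hT, lo, hlt, hm⟩ := hs''
    have e3' : s''.realArr aX = X := by rw [f''.realArr _ (by decide), e3]
    have e4' : s''.natArr bKap = K := by rw [f''.natArr _ (by decide), e4]
    simp only [mergeTake, Program.wp, Test.Holds, NatExpr.eval, RealExpr.eval, hT, e3', Inv]
    have := hm.r_eq
    have := hm.p_le
    have := hm.q_le
    constructor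
    · rintro ⟨hb1, hb2⟩
      right
      refine ⟨lo, ?_⟩
      have := hm.takeLeft hX hb1 hb2
      simpa [e4', hT] using this
    · intro hb
      right
      refine ⟨lo, ?_⟩
      have hqh : s''.natReg rJ < s''.natReg rHi := by
        by_contra hc
        exact hb ⟨by omega, Or.inl (by omega)⟩
      have := hm.takeRight hX hqh (by
        by_contra hc
        push Not at hc
        exact hb ⟨by omega, Or.inr hc.2.le⟩)
      simpa [e4', hT] using this
  · rw [f₂.natReg _ (by decide), f₁.natReg _ (by decide), hn]
  · simp
  · intro i s' hi hiT hf inv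
    refine (Exec.of_wp (p := copyBack) ?_).mono (by decide) fun _ h => h
    have e3 : s'.realArr aTmp = s₂.realArr aTmp := hf.realArr _ (by decide)
    have e4 : s'.natArr bTmp = s₂.natArr bTmp := hf.natArr _ (by decide)
    simp only [copyBack, Program.wp, NatExpr.eval, RealExpr.eval, hiT]
    intro u hu
    rcases Nat.lt_succ_iff_lt_or_eq.1 hu with hu | rfl
    · have := inv u hu
      simp [Function.update_of_ne hu.ne, this, hiT]
    · simp [e3, e4, hiT]
  · intro s' hs'
    have hB : MergeBoundary n w X K (s₂.realArr aTmp) (s₂.natArr bTmp) n := by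
      rcases hs₂ with h | ⟨lo, h⟩
      · exact h.2
      · exact h.boundary (by rw [h.hi_eq]; omega)
    obtain ⟨b, hb, hs⟩ := hB.start
    constructor
    · intro b' u v h1 h2 h3 h4
      rw [(hs' u (by omega)).1, (hs' v h4).1]
      have hlt : b' < b := by
        by_contra hc
        have : b * (w + w) ≤ b' * (w + w) := Nat.mul_le_mul_right _ (by omega)
        rw [two_mul] at hb
        omega
      refine hs b' hlt u v ?_ h2 ?_ h4 <;> rw [two_mul] <;> omega
    · intro F
      rw [← hB.same F]
      refine Finset.sum_congr rfl fun u hu => ?_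
      rw [(hs' u (Finset.mem_range.1 hu)).1, (hs' u (Finset.mem_range.1 hu)).2]
  · omega

def copyIn : Program :=
  .storeReal aX (.reg rT) (.fetch aVal (.reg rT)) ;;
  .storeNat bKap (.reg rT) (.fetch bCat (.reg rT))

/-- Sort the data points, together with their categories, by value. -/
def sortData : Program :=
  forLoop rT rN copyIn ;;
  rS ≔ₙ 1 ;;
  .loop (.reg rS + 1 ≤ₙ .reg rN) (mergePass ;; rS ≔ₙ .reg rS + .reg rS)

theorem exec_sortData {n : ℕ} {s : Store} (hn : s.natReg rN = n) :
    Exec sortData s (300 * ((n + 1) * (Nat.log 2 n + 1))) fun s' =>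
      (∀ u v, u ≤ v → v < n → s'.realArr aX u ≤ s'.realArr aX v) ∧
      SameData n (s.realArr aVal) (s.natArr bCat) (s'.realArr aX) (s'.natArr bKap) := by
  let Inv : ℕ → Store → Prop := fun d s' => s'.natReg rN = n ∧ 0 < s'.natReg rS ∧
    n ≤ s'.natReg rS * 2 ^ d ∧ BlockSorted n (s'.natReg rS) (s'.realArr aX) ∧
    SameData n (s.realArr aVal) (s.natArr bCat) (s'.realArr aX) (s'.natArr bKap)
  refine (Exec.seq (Exec.forLoop (fun i s' => ∀ u < i, s'.realArr aX u = s.realArr aVal u ∧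
        s'.natArr bKap u = s.natArr bCat u) (N := n) (c := 8) hn (by decide) (by decide)
          (by decide) ?_ ?_) fun s₁ hs₁ f₁ => Exec.seq (T := 2)
      (R := fun s₂ => s₂ = s₁.setNat rS 1) ?_ fun s₂ hs₂ _ =>
      Exec.loop (Inv := Inv) (c := 200 * n + 40) ?_ (Nat.log 2 n + 1) s₂ ?_).mono ?_ ?_
  · simp
  · intro i s' hi hiT hf inv
    refine (Exec.of_wp (p := copyIn) ?_).mono (by decide) fun _ h => h
    have e3 : s'.realArr aVal = s.realArr aVal := hf.realArr _ (by decide)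
    have e4 : s'.natArr bCat = s.natArr bCat := hf.natArr _ (by decide)
    simp only [copyIn, Program.wp, NatExpr.eval, RealExpr.eval, hiT]
    intro u hu
    rcases Nat.lt_succ_iff_lt_or_eq.1 hu with hu | rfl
    · have := inv u hu
      simp [Function.update_of_ne hu.ne, this, hiT]
    · simp [e3, e4, hiT]
  · exact (Exec.of_wp (p := rS ≔ₙ 1) (Q := fun s₂ => s₂ = s₁.setNat rS 1) rfl).mono
      (by decide) fun _ h => h
  · rintro d s' ⟨h1, h2, h3, h4, h5⟩ hb
    simp only [Test.Holds, NatExpr.eval, h1] at hb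
    obtain ⟨d, rfl⟩ : ∃ d', d = d' + 1 := by
      rcases d with _ | d
      · simp at h3
        omega
      · exact ⟨d, rfl⟩
    refine ⟨d, rfl, (Exec.seq (exec_mergePass h1 rfl h2 h4) fun s'' hs'' f'' =>
      Exec.of_wp (p := rS ≔ₙ .reg rS + .reg rS) ?_).mono ?_ fun _ h => h⟩
    · have e1 := f''.natReg rS (by decide)
      have e2 := f''.natReg rN (by decide)
      simp only [Program.wp, Inv, NatExpr.eval, e1]
      refine ⟨by simp [e2, h1], by simp; omega, ?_, by simpa using hs''.1, fun F => ?_⟩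
      · rw [pow_succ] at h3
        simp
        linarith
      · simpa using (hs''.2 F).trans (h5 F)
    · have : (rS ≔ₙ .reg rS + .reg rS).bound = 4 := rfl
      omega
  · subst hs₂
    refine ⟨?_, by simp, ?_, ?_, fun F => ?_⟩
    · simp [f₁.natReg rN (by decide), hn]
    · simpa using (Nat.lt_pow_succ_log_self one_lt_two n).le
    · intro b u v h1 h2 h3
      simp only [Store.natReg_setNat] at h1 h3
      simp at h1 h3
      rw [show u = v by omega]
      exact fun _ => le_rfl
    · refine Finset.sum_congr rfl fun u hu => ?_
      have := hs₁ u (Finset.mem_range.1 hu)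
      simp [this]
  · have : (.reg rS + 1 ≤ₙ .reg rN : Test).cost = 5 := rfl
    rw [this]
    have h1 : n ≤ n * (Nat.log 2 n + 1) := Nat.le_mul_of_pos_right n (Nat.succ_pos _)
    nlinarith
  · rintro s' ⟨⟨d, h1, h2, h3, h4, h5⟩, hb⟩
    simp only [Test.Holds, NatExpr.eval, h1] at hb
    refine ⟨fun u v huv hv => h4 0 u v (by simp) huv (by omega) hv, h5⟩

/-! ### Sums of distances to points on a line -/

/-- The sum of the distances from `y` to the points `x q`, for `q ∈ A`. -/
noncomputable def absSum (x : ℕ → ℝ) (A : Finset ℕ) (y : ℝ) : ℝ := ∑ q ∈ A, |x q - y|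

/-- The slope of `absSum x A` between the points `x (m - 1)` and `x m` of a sorted sequence. -/
noncomputable def slope (A : Finset ℕ) (m : ℕ) : ℝ := ∑ q ∈ A, if q < m then 1 else -1

/-- The constant term of the affine function that agrees with `absSum x A` between the points
`x (m - 1)` and `x m` of a sorted sequence. -/
noncomputable def offset (x : ℕ → ℝ) (A : Finset ℕ) (m : ℕ) : ℝ :=
  ∑ q ∈ A, if q < m then -x q else x q

theorem slope_mono (A : Finset ℕ) : Monotone (slope A) := by
  intro m m' h
  refine Finset.sum_le_sum fun q _ => ?_
  split_ifs <;> first | omega | norm_num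

theorem slope_disjUnion {A B : Finset ℕ} (h : Disjoint A B) (m : ℕ) :
    slope (A ∪ B) m = slope A m + slope B m := Finset.sum_union h

theorem slope_range {n m : ℕ} (h : m ≤ n) : slope (Finset.range n) m = 2 * m - n := by
  have h1 : (Finset.range n).filter (fun q => q < m) = Finset.range m := by
    ext q
    simp only [Finset.mem_filter, Finset.mem_range]
    omega
  have h2 : ∀ q, (if q < m then (1 : ℝ) else -1) = 2 * (if q < m then 1 else 0) - 1 := by
    intro q
    split_ifs <;> norm_num
  simp only [slope, h2, Finset.sum_sub_distrib, ← Finset.mul_sum, Finset.sum_boole, h1]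
  simp

theorem slope_mul_add_offset (x : ℕ → ℝ) (A : Finset ℕ) (m : ℕ) (y : ℝ) :
    slope A m * y + offset x A m = ∑ q ∈ A, if q < m then y - x q else x q - y := by
  rw [slope, offset, Finset.sum_mul, ← Finset.sum_add_distrib]
  refine Finset.sum_congr rfl fun q _ => ?_
  split_ifs <;> ring

/-- `absSum` is convex: the affine functions that agree with it between two neighbouring points are
below it everywhere. -/
theorem line_le_absSum (x : ℕ → ℝ) (A : Finset ℕ) (m : ℕ) (y : ℝ) :
    slope A m * y + offset x A m ≤ absSum x A y := by
  rw [slope_mul_add_offset]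
  refine Finset.sum_le_sum fun q _ => ?_
  split_ifs
  · rw [abs_sub_comm]
    exact le_abs_self _
  · exact le_abs_self _

/-- A median of the points in `A`: the first point with nonnegative slope to its right. -/
theorem exists_median {n : ℕ} {A : Finset ℕ} (hA : A ⊆ Finset.range n) (hn : 0 < n) :
    ∃ i < n, slope A i ≤ 0 ∧ 0 ≤ slope A (i + 1) ∧ ∀ m, 0 < m → m ≤ i → slope A m < 0 := by
  classical
  have hex : ∃ i, 0 ≤ slope A (i + 1) := by
    refine ⟨n, Finset.sum_nonneg fun q hq => ?_⟩
    have := Finset.mem_range.1 (hA hq)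
    rw [if_pos (by omega)]
    exact zero_le_one
  have hlt : ∀ m, 0 < m → m ≤ Nat.find hex → slope A m < 0 := by
    intro m h1 h2
    obtain ⟨m, rfl⟩ : ∃ m', m = m' + 1 := ⟨m - 1, by omega⟩
    exact lt_of_not_ge (Nat.find_min hex h2)
  refine ⟨Nat.find hex, ?_, ?_, Nat.find_spec hex, hlt⟩
  · refine lt_of_le_of_lt (Nat.find_min' hex (m := n - 1) ?_) (Nat.sub_lt hn one_pos)
    refine Finset.sum_nonneg fun q hq => ?_
    have := Finset.mem_range.1 (hA hq)
    rw [if_pos (by omega)]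
    exact zero_le_one
  · rcases Nat.eq_zero_or_pos (Nat.find hex) with h | h
    · rw [h]
      exact Finset.sum_nonpos fun q _ => by simp
    · exact (hlt _ h le_rfl).le

section Sorted

variable {n : ℕ} {x : ℕ → ℝ} (hx : ∀ u v, u ≤ v → v < n → x u ≤ x v)

include hx

/-- At a point of the sequence, the affine functions on both sides of it agree with `absSum`. -/
theorem absSum_eq_line {A : Finset ℕ} (hA : A ⊆ Finset.range n) {i m : ℕ} (hi : i < n)
    (h : m = i ∨ m = i + 1) :
    absSum x A (x i) = slope A m * x i + offset x A m := by
  rw [slope_mul_add_offset]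
  refine Finset.sum_congr rfl fun q hq => ?_
  have hqn := Finset.mem_range.1 (hA hq)
  split_ifs with hqm
  · rw [abs_sub_comm]
    exact abs_of_nonneg (sub_nonneg.2 (hx _ _ (by omega) hi))
  · exact abs_of_nonneg (sub_nonneg.2 (hx _ _ (by omega) hqn))

/-- The subgradient inequality for the slopes on both sides of a point. -/
theorem absSum_sub_le {A : Finset ℕ} (hA : A ⊆ Finset.range n) {i m : ℕ} (hi : i < n)
    (h : m = i ∨ m = i + 1) (y : ℝ) :
    slope A m * (y - x i) ≤ absSum x A y - absSum x A (x i) := by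
  have := line_le_absSum x A m y
  rw [absSum_eq_line hx hA hi h]
  linarith

/-- A point at which the slope changes its sign is a median. -/
theorem absSum_le_of_slope {A : Finset ℕ} (hA : A ⊆ Finset.range n) {i : ℕ} (hi : i < n)
    (h₀ : slope A i ≤ 0) (h₁ : 0 ≤ slope A (i + 1)) (y : ℝ) : absSum x A (x i) ≤ absSum x A y := by
  rcases le_total (x i) y with h | h
  · have := absSum_sub_le hx hA hi (Or.inr rfl) y
    nlinarith
  · have := absSum_sub_le hx hA hi (Or.inl rfl) y
    nlinarith

/-- `absSum` is quasiconvex along the sorted sequence. -/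
theorem absSum_le_max {A : Finset ℕ} (hA : A ⊆ Finset.range n) {i l j : ℕ} (hil : i ≤ l)
    (hlj : l ≤ j) (hj : j < n) :
    absSum x A (x l) ≤ max (absSum x A (x i)) (absSum x A (x j)) := by
  have h1 := hx i l hil (by omega)
  have h2 := hx l j hlj hj
  rcases le_total 0 (slope A (l + 1)) with h | h
  · have := absSum_sub_le hx hA (by omega) (Or.inr rfl) (x j) (i := l)
    exact le_max_of_le_right (by nlinarith)
  · have := absSum_sub_le hx hA (by omega) (Or.inr rfl) (x i) (i := l)
    exact le_max_of_le_left (by nlinarith)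

theorem absSum_mono_of_slope {A : Finset ℕ} (hA : A ⊆ Finset.range n) {j j' : ℕ}
    (h : 0 ≤ slope A (j + 1)) (hjj : j ≤ j') (hj : j' < n) :
    absSum x A (x j) ≤ absSum x A (x j') := by
  have h2 := hx j j' hjj hj
  have := absSum_sub_le hx hA (by omega) (Or.inr rfl) (x j') (i := j)
  nlinarith

end Sorted

/-! ### The matrix of the candidate splits -/

/-- The data points of category `c`. -/
def cls (n : ℕ) (κ : ℕ → ℕ) (c : ℕ) : Finset ℕ := {q ∈ Finset.range n | κ q = c}

theorem cls_subset (n : ℕ) (κ : ℕ → ℕ) (c : ℕ) : cls n κ c ⊆ Finset.range n :=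
  Finset.filter_subset _ _

/-- The objective function at a pair of reals. -/
noncomputable def objective (n k : ℕ) (x : ℕ → ℝ) (κ : ℕ → ℕ) (a b : ℝ) : ℝ :=
  ∑ c ∈ Finset.range k, min (absSum x (cls n κ c) a) (absSum x (cls n κ c) b)

/-- The objective function at a pair of data points. -/
noncomputable def splitCost (n k : ℕ) (x : ℕ → ℝ) (κ : ℕ → ℕ) (i j : ℕ) : ℝ :=
  objective n k x κ (x i) (x j)

/-- Category `c` is served by the left one of the points `x i` and `x j`, for `i ≤ j`.  The
condition on the slope breaks the ties in such a way that the predicate is monotone in `i` and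
`j`, also if the two points coincide. -/
def Switched (n : ℕ) (x : ℕ → ℝ) (κ : ℕ → ℕ) (c i j : ℕ) : Prop :=
  absSum x (cls n κ c) (x i) ≤ absSum x (cls n κ c) (x j) ∧ 0 ≤ slope (cls n κ c) (j + 1)

/-- The Monge property of a matrix with rows `0, …, M` and columns `M, …, n - 1`. -/
def IsMonge (M n : ℕ) (G : ℕ → ℕ → ℝ) : Prop :=
  ∀ i i' j j', i ≤ i' → i' ≤ M → M ≤ j → j ≤ j' → j' < n → G i j + G i' j' ≤ G i j' + G i' j

/-- Column `j` contains a least entry of row `i`. -/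
def IsRowMin (M n : ℕ) (G : ℕ → ℕ → ℝ) (i j : ℕ) : Prop :=
  ∀ j', M ≤ j' → j' < n → G i j ≤ G i j'

/-- In a Monge matrix the minimum of a row is found between the columns of the minima of the rows
around it. -/
theorem IsMonge.isRowMin {M n : ℕ} {G : ℕ → ℕ → ℝ} (h : IsMonge M n G) {i j lo hi : ℕ}
    (hiM : i ≤ M) (hlo : M ≤ lo) (hlh : lo ≤ hi) (hhi : hi < n)
    (hl : lo = M ∨ ∃ e ≤ i, IsRowMin M n G e lo)
    (hr : hi + 1 = n ∨ ∃ e, i ≤ e ∧ e ≤ M ∧ IsRowMin M n G e hi)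
    (hmin : ∀ j', lo ≤ j' → j' ≤ hi → G i j ≤ G i j') : IsRowMin M n G i j := by
  intro j' h1 h2
  rcases lt_or_ge j' lo with h3 | h3
  · obtain ⟨e, he, hm⟩ := hl.resolve_left (by omega)
    have := h e i j' lo he hiM h1 h3.le (by omega)
    have := hm j' h1 h2
    have := hmin lo le_rfl hlh
    linarith
  · rcases le_or_gt j' hi with h4 | h4
    · exact hmin j' h3 h4
    · obtain ⟨e, he, heM, hm⟩ := hr.resolve_left (by omega)
      have := h i e hi j' he heM (by omega) h4.le h2
      have := hm j' h1 h2
      have := hmin hi hlh le_rfl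
      linarith

section Sorted

variable {n : ℕ} {x : ℕ → ℝ} (hx : ∀ u v, u ≤ v → v < n → x u ≤ x v)

include hx

/-- Along a path with growing row and column a category changes sides at most once, from the right
to the left candidate. -/
theorem Switched.mono {κ : ℕ → ℕ} {c i i' j j' : ℕ} (h : Switched n x κ c i j) (hi : i ≤ i')
    (hij : i' ≤ j) (hj : j ≤ j') (hn : j' < n) : Switched n x κ c i' j' := by
  refine ⟨?_, h.2.trans (slope_mono _ (by omega))⟩
  refine (absSum_le_max hx (cls_subset n κ c) hi hij (by omega)).trans ?_
  rw [max_eq_right h.1]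
  exact absSum_mono_of_slope hx (cls_subset n κ c) h.2 hj hn

theorem le_of_not_switched {κ : ℕ → ℕ} {c i j : ℕ} (h : ¬ Switched n x κ c i j) (hij : i ≤ j)
    (hn : j < n) : absSum x (cls n κ c) (x j) ≤ absSum x (cls n κ c) (x i) := by
  by_contra hc
  push Not at hc
  refine h ⟨hc.le, ?_⟩
  by_contra hs
  have := absSum_sub_le hx (cls_subset n κ c) hn (Or.inr rfl) (x i)
  have := hx i j hij hn
  nlinarith

/-- The Monge property holds for each category separately, because the distance sums of a category
are quasiconvex along the sorted points: the sum at the middle one of three points is at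
most the larger one of the sums at the other two. -/
theorem isMonge_splitCost {M : ℕ} (k : ℕ) (κ : ℕ → ℕ) : IsMonge M n (splitCost n k x κ) := by
  intro i i' j j' h1 h2 h3 h4 h5
  simp only [splitCost, objective, ← Finset.sum_add_distrib]
  refine Finset.sum_le_sum fun c _ => ?_
  have hA := cls_subset n κ c
  have m1 := absSum_le_max hx hA h1 (by omega : i' ≤ j) (by omega)
  have m2 := absSum_le_max hx hA (by omega : i' ≤ j) h4 h5
  have m3 := absSum_le_max hx hA h1 (by omega : i' ≤ j') h5
  have m4 := absSum_le_max hx hA (by omega : i ≤ j) h4 h5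
  revert m1 m2 m3 m4
  generalize absSum x (cls n κ c) (x i) = p
  generalize absSum x (cls n κ c) (x i') = q
  generalize absSum x (cls n κ c) (x j) = r
  generalize absSum x (cls n κ c) (x j') = t
  intro m1 m2 m3 m4
  rcases le_max_iff.1 m1 with m1 | m1 <;> rcases le_max_iff.1 m2 with m2 | m2 <;>
  rcases le_max_iff.1 m3 with m3 | m3 <;> rcases le_max_iff.1 m4 with m4 | m4 <;>
  rcases min_cases p t with ⟨e1, _⟩ | ⟨e1, _⟩ <;>
  rcases min_cases q r with ⟨e2, _⟩ | ⟨e2, _⟩ <;> rw [e1, e2] <;>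
  linarith [min_le_left p r, min_le_right p r, min_le_left q t, min_le_right q t]

/-- The minimum of the objective function is attained at two data points with the median of all the
data points between them. -/
theorem exists_splitCost_le {k : ℕ} {κ : ℕ → ℕ} (hκ : ∀ p < n, κ p < k) (hn : 0 < n) (a b : ℝ) :
    ∃ i j, i ≤ n / 2 ∧ n / 2 ≤ j ∧ j < n ∧ splitCost n k x κ i j ≤ objective n k x κ a b := by
  classical
  -- `A` and `B` are the points whose categories prefer `a` and `b`; the medians of `A` and `B` are
  -- at least as good as `a` and `b`
  set f : ℕ → ℝ → ℝ := fun c => absSum x (cls n κ c)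
  set A : Finset ℕ := {q ∈ Finset.range n | f (κ q) a ≤ f (κ q) b} with hA
  set B : Finset ℕ := {q ∈ Finset.range n | ¬ f (κ q) a ≤ f (κ q) b} with hB
  have hAn : A ⊆ Finset.range n := Finset.filter_subset _ _
  have hBn : B ⊆ Finset.range n := Finset.filter_subset _ _
  have hdis : Disjoint A B := Finset.disjoint_filter_filter_not _ _ _
  have huni : A ∪ B = Finset.range n := Finset.filter_union_filter_not_eq _ _
  -- the sum over the points of `A` or `B` as a sum over the categories
  have hsum : ∀ y z, absSum x A y + absSum x B z =
      ∑ c ∈ Finset.range k, if f c a ≤ f c b then f c y else f c z := by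
    intro y z
    have h1 : absSum x A y + absSum x B z =
        ∑ q ∈ Finset.range n, if f (κ q) a ≤ f (κ q) b then |x q - y| else |x q - z| := by
      rw [Finset.sum_ite]
      rfl
    rw [h1, ← Finset.sum_fiberwise_of_maps_to (t := Finset.range k) (g := κ)
      (fun q hq => Finset.mem_range.2 (hκ q (Finset.mem_range.1 hq)))]
    refine Finset.sum_congr rfl fun c _ => ?_
    have h2 : ∀ q ∈ {q ∈ Finset.range n | κ q = c},
        (if f (κ q) a ≤ f (κ q) b then |x q - y| else |x q - z|) =
          if f c a ≤ f c b then |x q - y| else |x q - z| := by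
      intro q hq
      rw [(Finset.mem_filter.1 hq).2]
    rw [Finset.sum_congr rfl h2]
    split_ifs <;> rfl
  have hobj : objective n k x κ a b = absSum x A a + absSum x B b := by
    rw [hsum]
    refine Finset.sum_congr rfl fun c _ => ?_
    split_ifs with h
    · exact min_eq_left h
    · exact min_eq_right (le_of_not_ge h)
  have hle : ∀ i j, splitCost n k x κ i j ≤ absSum x A (x i) + absSum x B (x j) := by
    intro i j
    rw [hsum, splitCost, objective]
    refine Finset.sum_le_sum fun c _ => ?_
    split_ifs
    · exact min_le_left _ _
    · exact min_le_right _ _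
  have hcomm : ∀ i j, splitCost n k x κ i j = splitCost n k x κ j i := by
    intro i j
    simp only [splitCost, objective, min_comm]
  have hM : n / 2 < n := Nat.div_lt_self hn one_lt_two
  -- the median of the union lies between the medians of `A` and `B`
  have key : ∀ A B : Finset ℕ, A ⊆ Finset.range n → B ⊆ Finset.range n → Disjoint A B →
      A ∪ B = Finset.range n → ∀ i j, i ≤ j → i < n → j < n → slope A i ≤ 0 →
      0 ≤ slope A (i + 1) → (∀ m, 0 < m → m ≤ i → slope A m < 0) → slope B j ≤ 0 →
      0 ≤ slope B (j + 1) → (∀ m, 0 < m → m ≤ j → slope B m < 0) → ∀ y z,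
      ∃ i j, i ≤ n / 2 ∧ n / 2 ≤ j ∧ j < n ∧
        absSum x A (x i) + absSum x B (x j) ≤ absSum x A y + absSum x B z := by
    intro A B hA hB hdis huni i j hij hi hj a1 a2 a3 b1 b2 b3 y z
    have e0 := slope_disjUnion hdis (n / 2)
    have e1 := slope_disjUnion hdis (n / 2 + 1)
    rw [huni, slope_range hM.le] at e0
    rw [huni, slope_range hM] at e1
    have c0 : (2 * (n / 2 : ℕ) : ℝ) ≤ n := by exact_mod_cast (by omega : 2 * (n / 2) ≤ n)
    have c1 : (n : ℝ) ≤ 2 * (n / 2 + 1 : ℕ) := by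
      exact_mod_cast (by omega : n ≤ 2 * (n / 2 + 1))
    -- `j` is the first median of `B`; if it is too small, `n / 2` is a median of `B` as well
    refine ⟨i, max j (n / 2), ?_, le_max_right _ _, max_lt hj hM, ?_⟩
    · by_contra hc
      have := a3 (n / 2 + 1) (by omega) (by omega)
      have := b3 (n / 2 + 1) (by omega) (by omega)
      linarith
    · refine add_le_add (absSum_le_of_slope hx hA hi a1 a2 y)
        (absSum_le_of_slope hx hB (max_lt hj hM) ?_ ?_ z)
      · rcases le_total (n / 2) j with h | h
        · rwa [max_eq_left h]
        · rw [max_eq_right h]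
          rcases h.lt_or_eq with h | h
          · have := a2.trans (slope_mono A (by omega : i + 1 ≤ n / 2))
            linarith
          · rwa [← h]
      · exact b2.trans (slope_mono B (by simp))
  obtain ⟨i, hi, a1, a2, a3⟩ := exists_median hAn hn
  obtain ⟨j, hj, b1, b2, b3⟩ := exists_median hBn hn
  rcases le_total i j with hij | hij
  · obtain ⟨i', j', h1, h2, h3, h4⟩ := key A B hAn hBn hdis huni i j hij hi hj a1 a2 a3 b1 b2 b3 a b
    exact ⟨i', j', h1, h2, h3, (hle _ _).trans (h4.trans hobj.ge)⟩
  · obtain ⟨i', j', h1, h2, h3, h4⟩ := key B A hBn hAn hdis.symm (by rw [Finset.union_comm, huni])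
      j i hij hj hi b1 b2 b3 a1 a2 a3 b a
    refine ⟨i', j', h1, h2, h3, ?_⟩
    rw [hcomm]
    linarith [hle j' i']

end Sorted

/-! ### Monotone paths through the matrix -/

/-- The monotone path that starts in row `0` and column `M`, leaves row `i < M` at column `U i`, and
stays in row `M` forever. -/
def path (M : ℕ) (U : ℕ → ℕ) : ℕ → ℕ × ℕ
  | 0 => (0, M)
  | t + 1 =>
    if (path M U t).2 < U (path M U t).1 ∨ M ≤ (path M U t).1 then
      ((path M U t).1, (path M U t).2 + 1)
    else ((path M U t).1 + 1, (path M U t).2)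

/-- The row of the path at time `t`. -/
def pathRow (M : ℕ) (U : ℕ → ℕ) (t : ℕ) : ℕ := (path M U t).1

/-- The column of the path at time `t`. -/
def pathCol (M : ℕ) (U : ℕ → ℕ) (t : ℕ) : ℕ := (path M U t).2

/-- The column in which the path enters row `i`. -/
def entry (M : ℕ) (U : ℕ → ℕ) (i : ℕ) : ℕ := if i = 0 then M else U (i - 1)

section Path

variable {M : ℕ} {U : ℕ → ℕ}

theorem path_stay {t : ℕ} (h : pathCol M U t < U (pathRow M U t) ∨ M ≤ pathRow M U t) :
    pathRow M U (t + 1) = pathRow M U t ∧ pathCol M U (t + 1) = pathCol M U t + 1 := by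
  simp only [pathRow, pathCol, path] at h ⊢
  simp [h]

theorem path_leave {t : ℕ} (h : ¬ (pathCol M U t < U (pathRow M U t) ∨ M ≤ pathRow M U t)) :
    pathRow M U (t + 1) = pathRow M U t + 1 ∧ pathCol M U (t + 1) = pathCol M U t := by
  simp only [pathRow, pathCol, path] at h ⊢
  simp [h]

theorem path_step (M : ℕ) (U : ℕ → ℕ) (t : ℕ) :
    (pathRow M U (t + 1) = pathRow M U t ∧ pathCol M U (t + 1) = pathCol M U t + 1) ∨
    (pathRow M U (t + 1) = pathRow M U t + 1 ∧ pathCol M U (t + 1) = pathCol M U t ∧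
      pathRow M U t < M) := by
  by_cases h : pathCol M U t < U (pathRow M U t) ∨ M ≤ pathRow M U t
  · exact Or.inl (path_stay h)
  · exact Or.inr ⟨(path_leave h).1, (path_leave h).2, by omega⟩

theorem pathRow_add_pathCol (M : ℕ) (U : ℕ → ℕ) (t : ℕ) :
    pathRow M U t + pathCol M U t = t + M := by
  induction t with
  | zero => rfl
  | succ t ih => rcases path_step M U t with h | h <;> omega

theorem pathRow_le (M : ℕ) (U : ℕ → ℕ) (t : ℕ) : pathRow M U t ≤ M := by
  induction t with
  | zero => exact Nat.zero_le _
  | succ t ih => rcases path_step M U t with h | h <;> omega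

theorem pathRow_mono (M : ℕ) (U : ℕ → ℕ) : Monotone (pathRow M U) :=
  monotone_nat_of_le_succ fun t => by rcases path_step M U t with h | h <;> omega

theorem pathCol_mono (M : ℕ) (U : ℕ → ℕ) : Monotone (pathCol M U) :=
  monotone_nat_of_le_succ fun t => by rcases path_step M U t with h | h <;> omega

theorem le_pathCol (M : ℕ) (U : ℕ → ℕ) (t : ℕ) : M ≤ pathCol M U t :=
  pathCol_mono M U (Nat.zero_le t)

/-- Once the path has entered a row, it goes on until the column in which it leaves the row. -/
theorem path_visits_row {i j₀ : ℕ} (hi : i ≤ M) (hj₀ : M ≤ j₀) (h₀ : pathRow M U (i + j₀ - M) = i)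
    (j : ℕ) (hj : j₀ ≤ j) (hb : i < M → j ≤ U i) : pathRow M U (i + j - M) = i := by
  induction j, hj using Nat.le_induction with
  | base => exact h₀
  | succ j hj ih =>
    have h1 := ih (by omega)
    have h2 := pathRow_add_pathCol M U (i + j - M)
    rw [h1] at h2
    rw [show i + (j + 1) - M = i + j - M + 1 by omega, (path_stay ?_).1, h1]
    rw [h1]
    rcases hi.lt_or_eq with h3 | h3
    · left
      have := hb h3
      omega
    · right
      exact h3.ge

variable (hU : Monotone U) (hMU : M ≤ U 0)

include hU hMU

/-- In each row, the path stays between the columns in which it enters and leaves the row. -/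
theorem path_bounds (t : ℕ) : entry M U (pathRow M U t) ≤ pathCol M U t ∧
    (pathRow M U t < M → pathCol M U t ≤ U (pathRow M U t)) := by
  induction t with
  | zero => exact ⟨by simp [entry, pathRow, pathCol, path], fun _ => hMU⟩
  | succ t ih =>
    by_cases h : pathCol M U t < U (pathRow M U t) ∨ M ≤ pathRow M U t
    · obtain ⟨h1, h2⟩ := path_stay h
      rw [h1, h2]
      exact ⟨by omega, fun h3 => by omega⟩
    · obtain ⟨h1, h2⟩ := path_leave h
      rw [h1, h2]
      have h3 := hU (Nat.le_succ (pathRow M U t))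
      simp only [Nat.succ_eq_add_one] at h3
      refine ⟨?_, fun _ => ?_⟩
      · simp only [entry, Nat.add_eq_zero_iff, one_ne_zero, and_false, if_false,
          Nat.add_sub_cancel]
        omega
      · have := ih.2 (by omega)
        omega

theorem pathCol_lt {n : ℕ} (hUn : ∀ i, U i < n) {t : ℕ} (ht : t < n) : pathCol M U t < n := by
  have h1 := pathRow_add_pathCol M U t
  have h2 := pathRow_le M U t
  rcases h2.lt_or_eq with h | h
  · exact ((path_bounds hU hMU t).2 h).trans_lt (hUn _)
  · omega

/-- The path visits all the cells between its entry to a row and its exit; that of row `i` and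
column `j` is visited at time `i + j - M`. -/
theorem path_visits (i : ℕ) (hi : i ≤ M) (j : ℕ) (hj : entry M U i ≤ j) (hb : i < M → j ≤ U i) :
    pathRow M U (i + j - M) = i := by
  have hME : ∀ i, M ≤ entry M U i := by
    intro i
    rw [entry]
    split_ifs
    · exact le_rfl
    · exact hMU.trans (hU (Nat.zero_le _))
  induction i generalizing j with
  | zero => exact path_visits_row hi (hME 0) (by simp [entry, pathRow, path]) j hj hb
  | succ i ih =>
    refine path_visits_row hi (hME _) ?_ j hj hb
    have hEU : entry M U i ≤ U i := by
      rw [entry]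
      split_ifs with h
      · rw [h]
        exact hMU
      · exact hU (Nat.sub_le _ _)
    have h1 := ih (by omega) (U i) hEU fun _ => le_rfl
    have h2 := pathRow_add_pathCol M U (i + U i - M)
    have h3 := hME i
    rw [h1] at h2
    have e : entry M U (i + 1) = U i := by simp [entry]
    rw [e, show i + 1 + U i - M = i + U i - M + 1 by omega, (path_leave ?_).1, h1]
    rw [h1]
    omega

end Path

/-! ### Walking along a path -/

/-- The multiple of `2 * s` nearest to `i`, the larger one in case of a tie. -/
def nearest (s i : ℕ) : ℕ := (i + s) / (2 * s) * (2 * s)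

theorem nearest_eq {s i q : ℕ} (h₁ : q * (2 * s) ≤ i + s) (h₂ : i + s < q * (2 * s) + 2 * s) :
    nearest s i = q * (2 * s) := by
  rw [nearest, Nat.div_eq_of_lt_le h₁ (by rw [Nat.succ_mul]; exact h₂)]

/-- The column stored for row `i`; the last column for the rows below the matrix. -/
def extend (M n : ℕ) (opt : ℕ → ℕ) (i : ℕ) : ℕ := if i ≤ M then opt i else n - 1

notation "rU" => 9
notation "rR" => 10
notation "bRow" => 4
notation "bCol" => 5
notation "bTa" => 6
notation "bTb" => 7
notation "bOpt" => 8

/-- Rows that are never reached keep the time `n`, and columns up to `M`, where the path begins,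
the time `0`. -/
def resetTimes : Program :=
  .storeNat bTa (.reg rT) (.reg rN) ;; .storeNat bTb (.reg rT) 0

def startPath : Program :=
  rI ≔ₙ 0 ;; rJ ≔ₙ .reg rM ;; rR ≔ₙ 0 ;; rU ≔ₙ .fetch bOpt 0 ;; .storeNat bTa 0 0

/-- One step of the path.  Register `rR` holds the remainder of the row modulo `2 * rS`, and
register `rU` the column in which the row is left; the latter changes when the row becomes an odd
multiple of `rS`, where the nearest multiple of `2 * rS` does. -/
def stepPath : Program :=
  .storeNat bRow (.reg rT) (.reg rI) ;; .storeNat bCol (.reg rT) (.reg rJ) ;;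
  .ite (.or (.reg rJ + 1 ≤ₙ .reg rU) (.reg rM ≤ₙ .reg rI))
    (rJ ≔ₙ .reg rJ + 1 ;; .storeNat bTb (.reg rJ) (.reg rT + 1))
    (rI ≔ₙ .reg rI + 1 ;; .storeNat bTa (.reg rI) (.reg rT + 1) ;; rR ≔ₙ .reg rR + 1 ;;
      .ite (.and (.reg rR ≤ₙ .reg rS) (.reg rS ≤ₙ .reg rR))
        (.ite (.reg rI + .reg rS ≤ₙ .reg rM) (rU ≔ₙ .fetch bOpt (.reg rI + .reg rS))
          (rU ≔ₙ .reg rN - 1))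
        (.ite (.reg rS + .reg rS ≤ₙ .reg rR) (rR ≔ₙ 0) .skip))

/-- Store the rows and columns along the path, and the times at which they are reached. -/
def walkPath : Program := forLoop rT rN resetTimes ;; startPath ;; forLoop rT rN stepPath

/-- The arrays `bRow` and `bCol` describe the path, and `bTa p` and `bTb p` are the times at which
it reaches row `p` and column `p`. -/
structure PathStored (n M : ℕ) (U : ℕ → ℕ) (s : Store) : Prop where
  row : ∀ t < n, s.natArr bRow t = pathRow M U t
  col : ∀ t < n, s.natArr bCol t = pathCol M U t
  timeRow : ∀ p < n, ∀ t < n, s.natArr bTa p ≤ t ↔ p ≤ pathRow M U t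
  timeCol : ∀ p < n, ∀ t < n, s.natArr bTb p ≤ t ↔ p ≤ pathCol M U t

theorem exec_walkPath {n M w : ℕ} {s : Store} (hn : s.natReg rN = n) (hM : s.natReg rM = M)
    (hw : s.natReg rS = w) (hw0 : 0 < w) (hMn : M < n) :
    Exec walkPath s (120 * n + 60)
      (PathStored n M fun i => extend M n (s.natArr bOpt) (nearest w i)) := by
  set O := extend M n (s.natArr bOpt) with hO
  set U : ℕ → ℕ := fun i => O (nearest w i) with hU
  have hUv : ∀ i, U i = O (nearest w i) := fun _ => rfl
  have hOv : ∀ i, O i = if i ≤ M then s.natArr bOpt i else n - 1 := fun _ => rfl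
  clear_value U O
  let Inv : ℕ → Store → Prop := fun t s' =>
    s'.natReg rI = pathRow M U t ∧ s'.natReg rJ = pathCol M U t ∧
    (∃ q, pathRow M U t = q * (2 * w) + s'.natReg rR) ∧ s'.natReg rR < 2 * w ∧
    s'.natReg rU = U (pathRow M U t) ∧
    (∀ u < t, s'.natArr bRow u = pathRow M U u ∧ s'.natArr bCol u = pathCol M U u) ∧
    (∀ p ≤ pathRow M U t, ∀ u, s'.natArr bTa p ≤ u ↔ p ≤ pathRow M U u) ∧
    (∀ p < n, pathRow M U t < p → s'.natArr bTa p = n) ∧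
    (∀ p ≤ pathCol M U t, ∀ u, s'.natArr bTb p ≤ u ↔ p ≤ pathCol M U u)
  refine (Exec.seq (Exec.forLoop (x := rT) (y := rN) (p := resetTimes)
    (fun t s' => ∀ p < t, s'.natArr bTa p = n ∧ s'.natArr bTb p = 0) (N := n) (c := 8) hn
    (by decide) (by decide) (by decide) ?_ ?_) fun s₁ hs₁ f₁ =>
    Exec.seq (T := 20) (R := Inv 0) ?_ fun s₂ hs₂ f₂ =>
    (Exec.forLoop (x := rT) (y := rN) (p := stepPath) Inv (N := n) (c := 60) ?_
    (by decide) (by decide) (by decide) ?_ ?_).mono le_rfl ?_).mono ?_ fun _ h => h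
  · simp
  · intro i s' hi hiT hf inv
    refine (Exec.of_wp (p := resetTimes) ?_).mono (by decide) fun _ h => h
    have e1 : s'.natReg rN = n := by rw [hf.natReg _ (by decide), hn]
    simp only [resetTimes, Program.wp, NatExpr.eval, hiT]
    intro u hu
    rcases Nat.lt_succ_iff_lt_or_eq.1 hu with hu | rfl
    · have := inv u hu
      simp [Function.update_of_ne hu.ne, this, hiT]
    · simp [e1, hiT]
  · refine (Exec.of_wp (p := startPath) ?_).mono (by decide) fun _ h => h
    have e1 : s₁.natReg rM = M := by rw [f₁.natReg _ (by decide), hM]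
    have e2 : s₁.natArr bOpt = s.natArr bOpt := f₁.natArr _ (by decide)
    simp only [startPath, Program.wp, NatExpr.eval, Inv]
    have hn0 : nearest w 0 = 0 := by
      have := @nearest_eq w 0 0 (by omega) (by omega)
      simpa using this
    refine ⟨by simp [pathRow, path], by simp [pathCol, path, e1], ⟨0, by simp [pathRow, path]⟩,
      by simpa using hw0, ?_, by simp, ?_, ?_, ?_⟩
    · simp [pathRow, path, e2, hUv, hn0, hOv]
    · intro p hp u
      obtain rfl : p = 0 := by simpa [pathRow, path] using hp
      simp
    · intro p hp h0
      have : p ≠ 0 := by omega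
      simp [Function.update_of_ne this, (hs₁ p hp).1]
    · intro p hp u
      have hpM : p ≤ M := by simpa [pathCol, path] using hp
      have := le_pathCol M U u
      simp only [Store.natArr_storeNat, Store.natArr_setNat]
      simp [(hs₁ p (by omega)).2]
      omega
  · rw [f₂.natReg _ (by decide), f₁.natReg _ (by decide), hn]
  · obtain ⟨h1, h2, h3, h4, h5, h6, h7, h8, h9⟩ := hs₂
    refine ⟨by simpa using h1, by simpa using h2, by simpa using h3, by simpa using h4,
      by simpa using h5, by simp, by simpa using h7, by simpa using h8, by simpa using h9⟩
  · rintro t s' ht htT hf ⟨h1, h2, ⟨q, h3⟩, h4, h5, h6, h7, h8, h9⟩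
    refine (Exec.of_wp (p := stepPath) ?_).mono (by decide) fun _ h => h
    have e1 : s'.natReg rN = n := by
      rw [hf.natReg _ (by decide), f₂.natReg _ (by decide), f₁.natReg _ (by decide), hn]
    have e2 : s'.natReg rM = M := by
      rw [hf.natReg _ (by decide), f₂.natReg _ (by decide), f₁.natReg _ (by decide), hM]
    have e3 : s'.natReg rS = w := by
      rw [hf.natReg _ (by decide), f₂.natReg _ (by decide), f₁.natReg _ (by decide), hw]
    have e4 : s'.natArr bOpt = s.natArr bOpt := by
      rw [hf.natArr _ (by decide), f₂.natArr _ (by decide), f₁.natArr _ (by decide)]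
    have hrows : ∀ u < t + 1, Function.update (s'.natArr bRow) t (pathRow M U t) u =
        pathRow M U u ∧ Function.update (s'.natArr bCol) t (pathCol M U t) u = pathCol M U u := by
      intro u hu
      rcases Nat.lt_succ_iff_lt_or_eq.1 hu with hu | rfl
      · simp [Function.update_of_ne hu.ne, h6 u hu]
      · simp
    simp only [stepPath, Program.wp, Test.Holds, NatExpr.eval]
    constructor
    · intro hb
      simp [e2, h1, h2, h5] at hb
      obtain ⟨g1, g2⟩ := path_stay (M := M) (U := U) (t := t) (by omega)
      refine ⟨by simp [g1, h1], by simp [g2, h2], ⟨q, by simp [g1, h3]⟩, by simpa using h4,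
        by simp [g1, h5], by simpa [h1, h2, htT] using hrows, ?_, ?_, ?_⟩
      · simpa [g1] using h7
      · simpa [g1] using h8
      · intro p hp u
        rw [g2] at hp
        rcases hp.lt_or_eq with hp | rfl
        · have := h9 p (by omega) u
          simp [Function.update_of_ne (show p ≠ pathCol M U t + 1 by omega), h2, this]
        · simp [h2, htT]
          constructor
          · intro hu
            have := pathCol_mono M U (show t + 1 ≤ u from hu)
            omega
          · intro hu
            by_contra hc
            have := pathCol_mono M U (by omega : u ≤ t)
            omega
    · intro hb
      simp [e2, h1, h2, h5] at hb
      obtain ⟨g1, g2⟩ := path_leave (M := M) (U := U) (t := t) (by omega)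
      have hrM := pathRow_le M U (t + 1)
      have k7 : ∀ p ≤ pathRow M U t + 1, ∀ u,
          Function.update (s'.natArr bTa) (pathRow M U t + 1) (t + 1) p ≤ u ↔
            p ≤ pathRow M U u := by
        intro p hp u
        rcases hp.lt_or_eq with hp | rfl
        · rw [Function.update_of_ne (by omega)]
          exact h7 p (by omega) u
        · simp only [Function.update_self]
          constructor
          · intro hu
            have := pathRow_mono M U (show t + 1 ≤ u from hu)
            omega
          · intro hu
            by_contra hc
            have := pathRow_mono M U (by omega : u ≤ t)
            omega
      have k8 : ∀ p < n, pathRow M U t + 1 < p →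
          Function.update (s'.natArr bTa) (pathRow M U t + 1) (t + 1) p = n := by
        intro p hp hp'
        rw [Function.update_of_ne (by omega)]
        exact h8 p hp (by omega)
      have hnear : ∀ r, pathRow M U t = q * (2 * w) + r → r < 2 * w →
          nearest w (pathRow M U t) = if r < w then q * (2 * w) else (q + 1) * (2 * w) := by
        intro r hr hr'
        split_ifs with hrw
        · exact nearest_eq (by omega) (by omega)
        · exact nearest_eq (by rw [Nat.succ_mul]; omega) (by rw [Nat.succ_mul]; omega)
      have hU0 := hnear _ h3 h4
      constructor
      · intro hR
        simp [e3] at hR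
        have hR : s'.natReg rR + 1 = w := by omega
        have hU1 : nearest w (pathRow M U t + 1) = pathRow M U t + 1 + w := by
          rw [nearest_eq (q := q + 1)] <;> rw [Nat.succ_mul] <;> omega
        constructor
        · intro hle
          simp [e2, e3, h1] at hle
          refine ⟨by simp [g1, h1], by simp [g2, h2], ⟨q, by simp [g1, h3]; omega⟩, by simp; omega,
            ?_, by simpa [h1, h2, htT] using hrows, by simpa [h1, g1, htT] using k7,
            by simpa [h1, g1, htT] using k8, by simpa [g2] using h9⟩
          simp [g1, hUv, hU1, hOv, hle, h1, e3, e4]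
        · intro hle
          simp [e2, e3, h1] at hle
          refine ⟨by simp [g1, h1], by simp [g2, h2], ⟨q, by simp [g1, h3]; omega⟩, by simp; omega,
            ?_, by simpa [h1, h2, htT] using hrows, by simpa [h1, g1, htT] using k7,
            by simpa [h1, g1, htT] using k8, by simpa [g2] using h9⟩
          simp [g1, hUv, hU1, hOv, not_le.2 hle, e1, NatExpr.eval]
      · intro hR
        simp [e3] at hR
        constructor
        · intro hR2
          simp [e3] at hR2
          have hU1 : nearest w (pathRow M U t + 1) = nearest w (pathRow M U t) := by
            rw [hU0, if_neg (by omega), nearest_eq (q := q + 1)] <;> rw [Nat.succ_mul] <;> omega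
          refine ⟨by simp [g1, h1], by simp [g2, h2], ⟨q + 1, ?_⟩, by simpa using hw0,
            ?_, by simpa [h1, h2, htT] using hrows, by simpa [h1, g1, htT] using k7,
            by simpa [h1, g1, htT] using k8, by simpa [g2] using h9⟩
          · simp [g1]
            rw [Nat.succ_mul]
            omega
          · simp [g1, h5, hUv, hU1]
        · intro hR2
          simp [e3] at hR2
          have hU1 : nearest w (pathRow M U t + 1) = nearest w (pathRow M U t) := by
            rw [hU0]
            split_ifs with hrw
            · exact nearest_eq (by omega) (by omega)
            · exact nearest_eq (by rw [Nat.succ_mul]; omega) (by rw [Nat.succ_mul]; omega)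
          refine ⟨by simp [g1, h1], by simp [g2, h2], ⟨q, by simp [g1]; omega⟩, by simp; omega,
            ?_, by simpa [h1, h2, htT] using hrows, by simpa [h1, g1, htT] using k7,
            by simpa [h1, g1, htT] using k8, by simpa [g2] using h9⟩
          simp [g1, h5, hUv, hU1]
  · rintro s' ⟨h1, h2, h3, h4, h5, h6, h7, h8, h9⟩
    have hc := pathRow_add_pathCol M U n
    have hr := pathRow_le M U n
    refine ⟨fun t ht => (h6 t ht).1, fun t ht => (h6 t ht).2, fun p hp t ht => ?_,
      fun p hp t ht => h9 p (by omega) t⟩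
    rcases le_or_gt p (pathRow M U n) with h | h
    · exact h7 p h t
    · have := pathRow_mono M U ht.le
      rw [h8 p hp h]
      omega
  · omega

/-! ### The times at which the categories change sides -/

theorem slope_succ (A : Finset ℕ) (m : ℕ) :
    slope A (m + 1) = slope A m + if m ∈ A then 2 else 0 := by
  have h : ∀ q, (if q < m + 1 then (1 : ℝ) else -1) =
      (if q < m then 1 else -1) + if m = q then 2 else 0 := by
    intro q
    split_ifs <;> first | omega | norm_num
  simp only [slope, h, Finset.sum_add_distrib, Finset.sum_ite_eq]

theorem offset_succ (x : ℕ → ℝ) (A : Finset ℕ) (m : ℕ) :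
    offset x A (m + 1) = offset x A m - if m ∈ A then 2 * x m else 0 := by
  have h : ∀ q, (if q < m + 1 then -x q else x q) =
      (if q < m then -x q else x q) - if m = q then 2 * x q else 0 := by
    intro q
    split_ifs <;> first | omega | ring
  simp only [offset, h, Finset.sum_sub_distrib, Finset.sum_ite_eq]

theorem mem_cls {n : ℕ} {κ : ℕ → ℕ} {c q : ℕ} : q ∈ cls n κ c ↔ q < n ∧ κ q = c := by
  simp [cls]

theorem sum_cls_succ {p : ℕ} {κ : ℕ → ℕ} {c : ℕ} (F : ℕ → ℝ) :
    ∑ q ∈ cls (p + 1) κ c, F q = ∑ q ∈ cls p κ c, F q + if κ p = c then F p else 0 := by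
  simp only [cls, Finset.sum_filter, Finset.sum_range_succ]

theorem slope_cls_succ {p : ℕ} {κ : ℕ → ℕ} {c m : ℕ} : slope (cls (p + 1) κ c) m =
    slope (cls p κ c) m + if κ p = c then (if p < m then 1 else -1) else 0 :=
  sum_cls_succ _

theorem offset_cls_succ {x : ℕ → ℝ} {p : ℕ} {κ : ℕ → ℕ} {c m : ℕ} :
    offset x (cls (p + 1) κ c) m =
      offset x (cls p κ c) m + if κ p = c then (if p < m then -x p else x p) else 0 :=
  sum_cls_succ _

notation "rC" => 11
notation "rP" => 12
notation "aSa" => 3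
notation "aOa" => 4
notation "aSb" => 5
notation "aOb" => 6
notation "bLo" => 9
notation "bHi" => 10
notation "bSw" => 11

def clearCategory : Program :=
  .storeReal aSa (.reg rC) 0 ;; .storeReal aOa (.reg rC) 0 ;;
  .storeReal aSb (.reg rC) 0 ;; .storeReal aOb (.reg rC) 0 ;;
  .storeNat bLo (.reg rC) 0 ;; .storeNat bHi (.reg rC) (.reg rN)

/-- Add the contribution of the point `rT` to the affine function with coefficients in the arrays
`A` and `B` that belongs to the category `rC`. -/
def addLine (A B : ℕ) (b : Test) : Program :=
  .ite b
    (.storeReal A (.reg rC) (.fetch A (.reg rC) + 1) ;;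
      .storeReal B (.reg rC) (.fetch B (.reg rC) - .fetch aX (.reg rT)))
    (.storeReal A (.reg rC) (.fetch A (.reg rC) - 1) ;;
      .storeReal B (.reg rC) (.fetch B (.reg rC) + .fetch aX (.reg rT)))

/-- Add the contribution of the point `rT` to both affine functions of its category. -/
def addPoint : Program :=
  rC ≔ₙ .fetch bKap (.reg rT) ;;
  addLine aSa aOa (.reg rT ≤ₙ 0) ;; addLine aSb aOb (.reg rT ≤ₙ .reg rM)

/-- Compute, for each category, the affine functions that agree with its sum of distances to the
right of the points `x 0` and `x M`. -/
def initLines : Program := forLoop rC rK clearCategory ;; forLoop rT rN addPoint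

/-- The affine functions in the arrays for category `c` are the sums of distances of the category
to the right of the points `x i` and `x j`. -/
structure LinesAt (n : ℕ) (x : ℕ → ℝ) (κ : ℕ → ℕ) (s : Store) (c i j : ℕ) : Prop where
  sa : s.realArr aSa c = slope (cls n κ c) (i + 1)
  oa : s.realArr aOa c = offset x (cls n κ c) (i + 1)
  sb : s.realArr aSb c = slope (cls n κ c) (j + 1)
  ob : s.realArr aOb c = offset x (cls n κ c) (j + 1)

theorem LinesAt.congr {n : ℕ} {x : ℕ → ℝ} {κ : ℕ → ℕ} {s s' : Store} {c i j : ℕ}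
    (h : LinesAt n x κ s c i j) (h₁ : s'.realArr aSa c = s.realArr aSa c)
    (h₂ : s'.realArr aOa c = s.realArr aOa c) (h₃ : s'.realArr aSb c = s.realArr aSb c)
    (h₄ : s'.realArr aOb c = s.realArr aOb c) : LinesAt n x κ s' c i j :=
  ⟨h₁.trans h.sa, h₂.trans h.oa, h₃.trans h.sb, h₄.trans h.ob⟩

theorem exec_initLines {n k M : ℕ} {s : Store} (hn : s.natReg rN = n) (hk : s.natReg rK = k)
    (hM : s.natReg rM = M) :
    Exec initLines s (100 * (n + k) + 20) fun s' => ∀ c < k, s'.natArr bLo c = 0 ∧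
      s'.natArr bHi c = n ∧ LinesAt n (s.realArr aX) (s.natArr bKap) s' c 0 M := by
  set x := s.realArr aX with hx
  set κ := s.natArr bKap with hκd
  refine (Exec.seq (Exec.forLoop (x := rC) (y := rK) (p := clearCategory)
    (fun t s' => ∀ c < t, s'.natArr bLo c = 0 ∧ s'.natArr bHi c = n ∧ LinesAt 0 x κ s' c 0 M)
      (N := k) (c := 24) hk (by decide) (by decide) (by decide) ?_ ?_) fun s₁ hs₁ f₁ =>
    (Exec.forLoop (x := rT) (y := rN) (p := addPoint)
      (fun p s' => ∀ c < k, s'.natArr bLo c = 0 ∧ s'.natArr bHi c = n ∧ LinesAt p x κ s' c 0 M)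
      (N := n) (c := 60) ?_
    (by decide) (by decide) (by decide) ?_ ?_)).mono ?_ fun _ h => h
  · simp
  · intro i s' hi hiT hf inv
    refine (Exec.of_wp (p := clearCategory) ?_).mono (by decide) fun _ h => h
    have e1 : s'.natReg rN = n := by rw [hf.natReg _ (by decide), hn]
    simp only [clearCategory, Program.wp, NatExpr.eval, hiT]
    intro u hu
    rcases Nat.lt_succ_iff_lt_or_eq.1 hu with hu | rfl
    · obtain ⟨h1, h2, h3, h4, h5, h6⟩ := inv u hu
      refine ⟨?_, ?_, ?_, ?_, ?_, ?_⟩ <;> simp [Function.update_of_ne hu.ne, *]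
    · refine ⟨by simp [hiT], by simp [hiT, e1], ?_, ?_, ?_, ?_⟩ <;>
        simp [cls, slope, offset, hiT]
  · rw [f₁.natReg _ (by decide), hn]
  · exact fun c hc => ⟨(hs₁ c hc).1, (hs₁ c hc).2.1, (hs₁ c hc).2.2.congr rfl rfl rfl rfl⟩
  · intro p s' hp hpT hf inv
    have e1 : s'.natReg rM = M := by rw [hf.natReg _ (by decide), f₁.natReg _ (by decide), hM]
    have e2 : s'.realArr aX = x := by rw [hf.realArr _ (by decide), f₁.realArr _ (by decide)]
    have e3 : s'.natArr bKap = κ := by rw [hf.natArr _ (by decide), f₁.natArr _ (by decide)]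
    refine (Exec.of_wp (p := addPoint) ?_).mono (by decide) fun _ h => h
    simp only [addPoint, addLine, Program.wp, Test.Holds, NatExpr.eval]
    have key : ∀ c < k, ∀ s'' : Store, s''.natArr bLo c = s'.natArr bLo c →
        s''.natArr bHi c = s'.natArr bHi c →
        s''.realArr aSa c = s'.realArr aSa c + (if κ p = c then (if p < 1 then 1 else -1) else 0) →
        s''.realArr aOa c = s'.realArr aOa c +
          (if κ p = c then (if p < 1 then -x p else x p) else 0) →
        s''.realArr aSb c =
          s'.realArr aSb c + (if κ p = c then (if p < M + 1 then 1 else -1) else 0) →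
        s''.realArr aOb c = s'.realArr aOb c +
          (if κ p = c then (if p < M + 1 then -x p else x p) else 0) →
        s''.natArr bLo c = 0 ∧ s''.natArr bHi c = n ∧ LinesAt (p + 1) x κ s'' c 0 M := by
      intro c hc s'' k1 k2 k3 k4 k5 k6
      obtain ⟨h1, h2, h3, h4, h5, h6⟩ := inv c hc
      refine ⟨k1.trans h1, k2.trans h2, ?_, ?_, ?_, ?_⟩
      · rw [k3, h3, slope_cls_succ]
      · rw [k4, h4, offset_cls_succ]
      · rw [k5, h5, slope_cls_succ]
      · rw [k6, h6, offset_cls_succ]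
    refine ⟨fun hb => ⟨fun hb' => ?_, fun hb' => ?_⟩, fun hb => ⟨fun hb' => ?_, fun hb' => ?_⟩⟩ <;>
    · simp [hpT, e1] at hb hb'
      intro c hc
      by_cases hcp : κ p = c
      · subst hcp
        apply key (κ p) hc <;>
          simp [hpT, e2, e3, hb, hb', RealExpr.eval, NatExpr.eval, sub_eq_add_neg] <;> omega
      · apply key c hc <;>
          simp [hpT, e2, e3, hcp, Function.update_of_ne (Ne.symm hcp), RealExpr.eval, NatExpr.eval]
  · omega

notation "yA" => 3
notation "yB" => 4
notation "ySa" => 5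
notation "yOa" => 6
notation "ySb" => 7
notation "yOb" => 8

/-- The point that the path reaches at time `rT + 1`, and the changes of the slopes on both sides
that it causes in its category. -/
def nextEvent : Program :=
  .ite (.fetch bRow (.reg rT) + 1 ≤ₙ .fetch bRow (.reg rT + 1))
    (rP ≔ₙ .fetch bRow (.reg rT + 1) ;; yA ≔ᵣ 2 ;; yB ≔ᵣ 0)
    (rP ≔ₙ .fetch bCol (.reg rT + 1) ;; yA ≔ᵣ 0 ;; yB ≔ᵣ 2) ;;
  rC ≔ₙ .fetch bKap (.reg rP)

/-- If the category `rC` has not changed sides before, compute its new affine functions.  If they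
show that it is on the left by now, its change of sides took place since its last event, and the old
functions are kept for the search; otherwise the new ones are stored. -/
def processEvent : Program :=
  .ite (.reg rN ≤ₙ .fetch bHi (.reg rC))
    (ySa ≔ᵣ .fetch aSa (.reg rC) + .reg yA ;;
      yOa ≔ᵣ .fetch aOa (.reg rC) - .reg yA * .fetch aX (.reg rP) ;;
      ySb ≔ᵣ .fetch aSb (.reg rC) + .reg yB ;;
      yOb ≔ᵣ .fetch aOb (.reg rC) - .reg yB * .fetch aX (.reg rP) ;;
      .ite (.and (.reg ySa * .fetch aX (.fetch bRow (.reg rT + 1)) + .reg yOa ≤ᵣ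
            .reg ySb * .fetch aX (.fetch bCol (.reg rT + 1)) + .reg yOb) (0 ≤ᵣ .reg ySb))
        (.storeNat bHi (.reg rC) (.reg rT + 1))
        (.storeReal aSa (.reg rC) (.reg ySa) ;; .storeReal aOa (.reg rC) (.reg yOa) ;;
          .storeReal aSb (.reg rC) (.reg ySb) ;; .storeReal aOb (.reg rC) (.reg yOb) ;;
          .storeNat bLo (.reg rC) (.reg rT + 1)))
    .skip

/-- Determine for each category a part of the path on which it changes sides and in whose interior
the path reaches none of its points. -/
def bracketSwitches : Program :=
  rHi ≔ₙ .reg rN - 1 ;; forLoop rT rHi (nextEvent ;; processEvent)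

/-- Between the times `bLo c` and `bHi c` the sums of distances of category `c` are the affine
functions in the arrays, and its change of sides, if it takes place before time `n`, is at a time in
this interval.  The path has been followed up to time `t`. -/
structure Bracket (n : ℕ) (x : ℕ → ℝ) (κ row col : ℕ → ℕ) (s : Store) (c t : ℕ) : Prop where
  lo_le : s.natArr bLo c ≤ s.natArr bHi c
  hi_eq : s.natArr bHi c = n ∨ s.natArr bHi c ≤ t ∧ s.natArr bHi c < n ∧
    Switched n x κ c (row (s.natArr bHi c)) (col (s.natArr bHi c))
  lo_le_time : s.natArr bLo c ≤ t
  before : ∀ u < s.natArr bLo c, ¬ Switched n x κ c (row u) (col u)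
  lines : ∀ u, s.natArr bLo c ≤ u → u < s.natArr bHi c → u ≤ t →
    LinesAt n x κ s c (row u) (col u)

theorem Bracket.congr {n : ℕ} {x : ℕ → ℝ} {κ row col : ℕ → ℕ} {s s' : Store} {c t : ℕ}
    (h : Bracket n x κ row col s c t) (h₁ : s'.realArr aSa c = s.realArr aSa c)
    (h₂ : s'.realArr aOa c = s.realArr aOa c) (h₃ : s'.realArr aSb c = s.realArr aSb c)
    (h₄ : s'.realArr aOb c = s.realArr aOb c) (h₅ : s'.natArr bLo c = s.natArr bLo c)
    (h₆ : s'.natArr bHi c = s.natArr bHi c) : Bracket n x κ row col s' c t := by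
  obtain ⟨a1, a2, a3, a4, a5⟩ := h
  rw [← h₅] at a1 a3 a4 a5
  rw [← h₆] at a1 a2 a5
  exact ⟨a1, a2, a3, a4, fun u k1 k2 k3 => (a5 u k1 k2 k3).congr h₁ h₂ h₃ h₄⟩

/-- The test on the affine functions decides on which side of the path the category is. -/
theorem switched_iff_lines {n : ℕ} {x : ℕ → ℝ} (hx : ∀ u v, u ≤ v → v < n → x u ≤ x v)
    {κ : ℕ → ℕ} {c i j : ℕ} (hi : i < n) (hj : j < n) :
    Switched n x κ c i j ↔
      slope (cls n κ c) (i + 1) * x i + offset x (cls n κ c) (i + 1) ≤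
        slope (cls n κ c) (j + 1) * x j + offset x (cls n κ c) (j + 1) ∧
      0 ≤ slope (cls n κ c) (j + 1) := by
  rw [Switched, absSum_eq_line hx (cls_subset n κ c) hi (Or.inr rfl),
    absSum_eq_line hx (cls_subset n κ c) hj (Or.inr rfl)]

/-- What the programs for one level read: the sorted data and a monotone path. -/
structure Walk (n k M : ℕ) (x : ℕ → ℝ) (κ row col : ℕ → ℕ) (s : Store) : Prop where
  n_eq : s.natReg rN = n
  k_eq : s.natReg rK = k
  M_eq : s.natReg rM = M
  x_eq : s.realArr aX = x
  κ_eq : s.natArr bKap = κ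
  row_eq : ∀ t < n, s.natArr bRow t = row t
  col_eq : ∀ t < n, s.natArr bCol t = col t

/-- A monotone path in unit steps from row `0` and column `M`, with rows up to `M`. -/
structure UnitPath (n M : ℕ) (row col : ℕ → ℕ) : Prop where
  start : row 0 = 0 ∧ col 0 = M
  step : ∀ t, (row (t + 1) = row t ∧ col (t + 1) = col t + 1) ∨
    (row (t + 1) = row t + 1 ∧ col (t + 1) = col t)
  row_le : ∀ t, row t ≤ M
  col_lt : ∀ t < n, col t < n

theorem UnitPath.row_mono {n M : ℕ} {row col : ℕ → ℕ} (h : UnitPath n M row col) : Monotone row :=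
  monotone_nat_of_le_succ fun t => by rcases h.step t with h | h <;> omega

theorem UnitPath.col_mono {n M : ℕ} {row col : ℕ → ℕ} (h : UnitPath n M row col) : Monotone col :=
  monotone_nat_of_le_succ fun t => by rcases h.step t with h | h <;> omega

theorem UnitPath.le_col {n M : ℕ} {row col : ℕ → ℕ} (h : UnitPath n M row col) (t : ℕ) :
    M ≤ col t := h.start.2 ▸ h.col_mono (Nat.zero_le t)

theorem UnitPath.switched_mono {n M : ℕ} {row col : ℕ → ℕ} (h : UnitPath n M row col) {x : ℕ → ℝ}
    (hx : ∀ u v, u ≤ v → v < n → x u ≤ x v) {κ : ℕ → ℕ} {c t t' : ℕ} (htt : t ≤ t') (ht : t' < n)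
    (hs : Switched n x κ c (row t) (col t)) : Switched n x κ c (row t') (col t') :=
  hs.mono hx (h.row_mono htt) ((h.row_le t').trans (h.le_col t)) (h.col_mono htt) (h.col_lt t' ht)

theorem exec_bracketSwitches {n k M : ℕ} {x : ℕ → ℝ} {κ row col : ℕ → ℕ} {s : Store}
    (hw : Walk n k M x κ row col s) (hp : UnitPath n M row col)
    (hx : ∀ u v, u ≤ v → v < n → x u ≤ x v) (hκ : ∀ p < n, κ p < k) (hMn : M < n)
    (h₀ : ∀ c < k, s.natArr bLo c = 0 ∧ s.natArr bHi c = n ∧ LinesAt n x κ s c 0 M) :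
    Exec bracketSwitches s (200 * n + 20) fun s' =>
      ∀ c < k, Bracket n x κ row col s' c (n - 1) := by
  refine (Exec.seq (T := (4 : ℕ)) (R := fun s₁ => s₁ = s.setNat rHi (n - 1)) ?_ fun s₁ hs₁ f₁ =>
    (Exec.forLoop (x := rT) (y := rHi) (p := nextEvent ;; processEvent)
      (fun t s' => ∀ c < k, Bracket n x κ row col s' c t) (N := n - 1) (c := 150) ?_
    (by decide) (by decide) (by decide) ?_ ?_)).mono ?_ fun _ h => h
  · refine Exec.mono (T' := 4) (Exec.of_wp (p := rHi ≔ₙ .reg rN - 1) ?_) (by decide) fun _ h => h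
    simp [Program.wp, NatExpr.eval, hw.n_eq]
  · simp [hs₁]
  · subst hs₁
    intro c hc
    obtain ⟨h1, h2, h3⟩ := h₀ c hc
    refine ⟨by simp [h1], by simp [h2], by simp [h1], by simp [h1], fun u _ _ hu => ?_⟩
    obtain rfl : u = 0 := by omega
    rw [hp.start.1, hp.start.2]
    exact h3.congr rfl rfl rfl rfl
  · intro t s' ht htT hf inv
    have e1 : s'.natReg rN = n := by
      rw [hf.natReg _ (by decide), f₁.natReg _ (by decide), hw.n_eq]
    have e2 : s'.realArr aX = x := by
      rw [hf.realArr _ (by decide), f₁.realArr _ (by decide), hw.x_eq]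
    have e3 : s'.natArr bKap = κ := by
      rw [hf.natArr _ (by decide), f₁.natArr _ (by decide), hw.κ_eq]
    have e4 : ∀ u < n, s'.natArr bRow u = row u := by
      rw [hf.natArr _ (by decide), f₁.natArr _ (by decide)]
      exact hw.row_eq
    have e5 : ∀ u < n, s'.natArr bCol u = col u := by
      rw [hf.natArr _ (by decide), f₁.natArr _ (by decide)]
      exact hw.col_eq
    have htn : t + 1 < n := by omega
    have r1 := (hp.row_le (t + 1)).trans_lt hMn
    have r2 := hp.col_lt (t + 1) htn
    have event : Exec nextEvent s' 30 fun s'' => s''.natReg rT = t ∧ s''.natReg rP < n ∧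
        s''.natReg rC = κ (s''.natReg rP) ∧
        ∀ c, slope (cls n κ c) (row (t + 1) + 1) = slope (cls n κ c) (row t + 1) +
            (if κ (s''.natReg rP) = c then s''.realReg yA else 0) ∧
          offset x (cls n κ c) (row (t + 1) + 1) = offset x (cls n κ c) (row t + 1) -
            (if κ (s''.natReg rP) = c then s''.realReg yA * x (s''.natReg rP) else 0) ∧
          slope (cls n κ c) (col (t + 1) + 1) = slope (cls n κ c) (col t + 1) +
            (if κ (s''.natReg rP) = c then s''.realReg yB else 0) ∧
          offset x (cls n κ c) (col (t + 1) + 1) = offset x (cls n κ c) (col t + 1) -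
            (if κ (s''.natReg rP) = c then s''.realReg yB * x (s''.natReg rP) else 0) := by
      refine (Exec.of_wp (p := nextEvent) ?_).mono (by decide) fun _ h => h
      simp only [nextEvent, Program.wp, Test.Holds, NatExpr.eval,
        htT, e4 t (by omega), e4 (t + 1) htn, e5 (t + 1) htn]
      constructor
      · intro hb
        have hs := (hp.step t).resolve_left (by omega)
        refine ⟨by simp [htT], by simpa using r1, by simp [e3], fun c => ?_⟩
        have hmem : (row t + 1 ∈ cls n κ c) ↔ κ (row t + 1) = c := by
          rw [mem_cls, and_iff_right (by omega)]
        simp [hs.1, hs.2, slope_succ _ (row t + 1), offset_succ _ _ (row t + 1), hmem]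
      · intro hb
        have hs := (hp.step t).resolve_right (by omega)
        refine ⟨by simp [htT], by simpa using r2, by simp [e3], fun c => ?_⟩
        have hmem : (col t + 1 ∈ cls n κ c) ↔ κ (col t + 1) = c := by
          rw [mem_cls, and_iff_right (by omega)]
        simp [hs.1, hs.2, slope_succ _ (col t + 1), offset_succ _ _ (col t + 1), hmem]
    refine (Exec.seq event fun s'' hs'' f'' => Exec.of_wp (p := processEvent) ?_).mono (by decide)
      fun _ h => h
    obtain ⟨k1, k2, k3, k4⟩ := hs''
    have e1' : s''.natReg rN = n := by rw [f''.natReg _ (by decide), e1]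
    have e2' : s''.realArr aX = x := by rw [f''.realArr _ (by decide), e2]
    have e4' : ∀ u < n, s''.natArr bRow u = row u := by
      rw [f''.natArr _ (by decide)]
      exact e4
    have e5' : ∀ u < n, s''.natArr bCol u = col u := by
      rw [f''.natArr _ (by decide)]
      exact e5
    have inv' : ∀ c < k, Bracket n x κ row col s'' c t := fun c hc => (inv c hc).congr
      (by rw [f''.realArr _ (by decide)]) (by rw [f''.realArr _ (by decide)])
      (by rw [f''.realArr _ (by decide)]) (by rw [f''.realArr _ (by decide)])
      (by rw [f''.natArr _ (by decide)]) (by rw [f''.natArr _ (by decide)])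
    set p := s''.natReg rP
    have hcp := hκ p k2
    -- categories that are not affected by the event
    have rest : ∀ c < k, κ p ≠ c ∨ s''.natArr bHi c < n → Bracket n x κ row col s'' c (t + 1) := by
      intro c hc hcase
      obtain ⟨a1, a2, a3, a4, a5⟩ := inv' c hc
      refine ⟨a1, a2.imp_right fun h => ⟨by omega, h.2⟩, by omega, a4, fun u b1 b2 b3 => ?_⟩
      rcases b3.lt_or_eq with b3 | rfl
      · exact a5 u b1 b2 (by omega)
      · have hne : κ p ≠ c := hcase.resolve_right (by omega)
        obtain ⟨c1, c2, c3, c4⟩ := a5 t (by omega) (by omega) le_rfl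
        obtain ⟨d1, d2, d3, d4⟩ := k4 c
        simp only [if_neg hne, add_zero, sub_zero] at d1 d2 d3 d4
        exact ⟨c1.trans d1.symm, c2.trans d2.symm, c3.trans d3.symm, c4.trans d4.symm⟩
    simp only [processEvent, Program.wp, Test.Holds, NatExpr.eval, k3, e1']
    constructor
    · intro hb
      obtain ⟨a1, a2, a3, a4, a5⟩ := inv' (κ p) hcp
      have hhi : s''.natArr bHi (κ p) = n := by omega
      obtain ⟨c1, c2, c3, c4⟩ := a5 t (by omega) (by omega) le_rfl
      obtain ⟨d1, d2, d3, d4⟩ := k4 (κ p)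
      simp only [if_true] at d1 d2 d3 d4
      rw [← c1] at d1
      rw [← c2] at d2
      rw [← c3] at d3
      rw [← c4] at d4
      have hsw := switched_iff_lines hx (κ := κ) (c := κ p) r1 r2
      rw [d1, d2, d3, d4] at hsw
      constructor
      · intro hb'
        simp [RealExpr.eval, NatExpr.eval, k1, k3, e2', e4' _ htn, e5' _ htn, p] at hb'
        have hS := hsw.2 hb'
        intro c hc
        by_cases hcp' : κ p = c
        · subst hcp'
          refine ⟨by simp [k1, k3]; omega, ?_, by simp; omega, by simpa using a4, ?_⟩
          · right
            simpa [k1, k3] using ⟨htn, hS⟩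
          · intro u b1 b2 b3
            simp [k1, k3] at b1 b2
            exact (a5 u b1 (by omega) (by omega)).congr (by simp) (by simp) (by simp) (by simp)
        · refine (rest c hc (Or.inl hcp')).congr ?_ ?_ ?_ ?_ ?_ ?_ <;>
            simp [k3, Function.update_of_ne (Ne.symm hcp')]
      · intro hb'
        simp [RealExpr.eval, NatExpr.eval, k1, k3, e2', e4' _ htn, e5' _ htn, p] at hb'
        have hS : ¬ Switched n x κ (κ p) (row (t + 1)) (col (t + 1)) := by
          rw [hsw]
          simpa using hb'
        intro c hc
        by_cases hcp' : κ p = c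
        · subst hcp'
          refine ⟨by simp [k1, k3]; omega, by simp [hhi], by simp [k1, k3], ?_, ?_⟩
          · intro u hu hsu
            simp [k1, k3] at hu
            exact hS (hp.switched_mono hx (by omega) htn hsu)
          · intro u b1 b2 b3
            simp [k1, k3] at b1 b2
            obtain rfl : u = t + 1 := by omega
            refine ⟨?_, ?_, ?_, ?_⟩
            · rw [d1]; simp [RealExpr.eval, NatExpr.eval, k3]
            · rw [d2]; simp [RealExpr.eval, NatExpr.eval, k3, e2', p]
            · rw [d3]; simp [RealExpr.eval, NatExpr.eval, k3]
            · rw [d4]; simp [RealExpr.eval, NatExpr.eval, k3, e2', p]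
        · refine (rest c hc (Or.inl hcp')).congr ?_ ?_ ?_ ?_ ?_ ?_ <;>
            simp [k3, Function.update_of_ne (Ne.symm hcp')]
    · intro hb c hc
      refine (rest c hc ?_).congr rfl rfl rfl rfl rfl rfl
      by_cases hcp' : κ p = c
      · subst hcp'
        exact Or.inr (by omega)
      · exact Or.inl hcp'
  · omega

/-- Halve the interval from `rI` to `rJ` that contains the time at which category `rC` changes
sides. -/
def halveBracket : Program :=
  rMid ≔ₙ .half (.reg rI + .reg rJ) ;;
  .ite (.and (.fetch aSa (.reg rC) * .fetch aX (.fetch bRow (.reg rMid)) + .fetch aOa (.reg rC) ≤ᵣ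
        .fetch aSb (.reg rC) * .fetch aX (.fetch bCol (.reg rMid)) + .fetch aOb (.reg rC))
      (0 ≤ᵣ .fetch aSb (.reg rC)))
    (rJ ≔ₙ .reg rMid) (rI ≔ₙ .reg rMid + 1)

/-- The time at which category `rC` changes sides is written to `bSw`; it is the number of points if
the category stays on the right. -/
def findSwitch : Program :=
  (rI ≔ₙ .fetch bLo (.reg rC) ;; rJ ≔ₙ .fetch bHi (.reg rC)) ;;
  .loop (.reg rI + 1 ≤ₙ .reg rJ) halveBracket ;; .storeNat bSw (.reg rC) (.reg rI)

/-- Determine for each category the time at which it changes sides, by binary search. -/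
def findSwitches : Program := forLoop rC rK findSwitch

theorem exec_findSwitch {n k M c : ℕ} {x : ℕ → ℝ} {κ row col : ℕ → ℕ} {s : Store}
    (hw : Walk n k M x κ row col s) (hp : UnitPath n M row col)
    (hx : ∀ u v, u ≤ v → v < n → x u ≤ x v) (hMn : M < n) (hC : s.natReg rC = c)
    (hb : Bracket n x κ row col s c (n - 1)) :
    Exec findSwitch s (50 * (Nat.log 2 n + 1) + 30) fun s' =>
      (∀ t < n, s'.natArr bSw c ≤ t ↔ Switched n x κ c (row t) (col t)) ∧
      ∀ c' ≠ c, s'.natArr bSw c' = s.natArr bSw c' := by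
  let Core : ℕ → Store → Prop := fun d s' =>
    s.natArr bLo c ≤ s'.natReg rI ∧ s'.natReg rI ≤ s'.natReg rJ ∧
    s'.natReg rJ ≤ s.natArr bHi c ∧ s'.natReg rJ - s'.natReg rI < 2 ^ d ∧
    (∀ u < s'.natReg rI, ¬ Switched n x κ c (row u) (col u)) ∧
    (s'.natReg rJ = n ∨ s'.natReg rJ < n ∧
      Switched n x κ c (row (s'.natReg rJ)) (col (s'.natReg rJ)))
  let Inv : ℕ → Store → Prop := fun d s' => Frame halveBracket s s' ∧ Core d s'
  have hhi : s.natArr bHi c ≤ n := by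
    rcases hb.hi_eq with h | h <;> omega
  refine (Exec.seq (T := (8 : ℕ)) (R := Inv (Nat.log 2 n + 1)) ?_ fun s₁ hs₁ f₁ =>
    Exec.seq (Exec.loop (Inv := Inv) (c := 40) ?_ (Nat.log 2 n + 1) s₁ hs₁)
      fun s₂ hs₂ f₂ => Exec.of_wp (p := .storeNat bSw (.reg rC) (.reg rI)) ?_).mono ?_ fun _ h => h
  · refine Exec.mono (T' := 8) (Exec.of_wp
      (p := rI ≔ₙ .fetch bLo (.reg rC) ;; rJ ≔ₙ .fetch bHi (.reg rC)) ?_) (by decide) fun _ h => h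
    simp only [Program.wp, NatExpr.eval]
    have hlog := Nat.lt_pow_succ_log_self one_lt_two n
    refine ⟨⟨fun y hy => ?_, fun _ _ => rfl, fun _ _ => rfl, fun _ _ => rfl⟩, ?_⟩
    · have : y ≠ rI ∧ y ≠ rJ := by
        constructor <;>
        · rintro rfl
          exact hy (by decide)
      simp [this]
    · have := hb.lo_le
      simp only [Core]
      simp [hC]
      refine ⟨this, ?_, hb.before, ?_⟩
      · rw [Nat.succ_eq_add_one] at hlog
        omega
      · exact hb.hi_eq.imp_right fun h => h.2
  · rintro d s' ⟨f, h1, h2, h3, h4, h5, h6⟩ hlt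
    simp only [Test.Holds, NatExpr.eval] at hlt
    obtain ⟨d, rfl⟩ : ∃ d', d = d' + 1 := by
      rcases d with _ | d
      · simp at h4
        omega
      · exact ⟨d, rfl⟩
    refine ⟨d, rfl, Exec.mono (Q := fun s'' => Core d s'' ∧ Frame halveBracket s' s'')
      (Exec.framed (Exec.of_wp (p := halveBracket) ?_)) (by decide)
      fun _ h => ⟨f.trans h.2, h.1⟩⟩
    have e0 : s'.natReg rC = c := by rw [f.natReg _ (by decide), hC]
    have e2 : s'.realArr aX = x := by rw [f.realArr _ (by decide), hw.x_eq]
    have e4 : ∀ u < n, s'.natArr bRow u = row u := by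
      rw [f.natArr _ (by decide)]
      exact hw.row_eq
    have e5 : ∀ u < n, s'.natArr bCol u = col u := by
      rw [f.natArr _ (by decide)]
      exact hw.col_eq
    have e6 : s'.realArr = s.realArr := funext fun A => f.realArr A (by
      simp [halveBracket, Program.realArrs])
    simp only [halveBracket, Program.wp, Test.Holds, NatExpr.eval]
    obtain ⟨m, hm⟩ : ∃ m, m = (s'.natReg rI + s'.natReg rJ) / 2 := ⟨_, rfl⟩
    have hmn : m < n := by omega
    have hl := hb.lines m (by omega) (by omega) (by omega)
    have hsw := switched_iff_lines hx (κ := κ) (c := c) ((hp.row_le m).trans_lt hMn)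
      (hp.col_lt m hmn)
    rw [← hl.sa, ← hl.oa, ← hl.sb, ← hl.ob] at hsw
    rw [pow_succ] at h4
    rw [← hm]
    constructor
    · intro hS
      simp [RealExpr.eval, NatExpr.eval, e0, e2, e4 m hmn, e5 m hmn, e6] at hS
      rw [← hsw] at hS
      simp only [Core]
      simp
      exact ⟨h1, by omega, by omega, by omega, h5, Or.inr ⟨hmn, hS⟩⟩
    · intro hS
      simp [RealExpr.eval, NatExpr.eval, e0, e2, e4 m hmn, e5 m hmn, e6] at hS
      have hS' : ¬ Switched n x κ c (row m) (col m) := fun h =>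
        absurd (hsw.1 h).2 (not_le.2 (hS (hsw.1 h).1))
      simp only [Core]
      simp
      refine ⟨by omega, by omega, by omega, by omega, fun u hu hSu => ?_, h6⟩
      exact hS' (hp.switched_mono hx (by omega) hmn hSu)
  · obtain ⟨⟨d, f, h1, h2, h3, h4, h5, h6⟩, hlt⟩ := hs₂
    simp only [Test.Holds, NatExpr.eval, not_le] at hlt
    have e0 : s₂.natReg rC = c := by rw [f.natReg _ (by decide), hC]
    have heq : s₂.natReg rI = s₂.natReg rJ := by
      have : s₂.natReg rJ < s₂.natReg rI + 1 := hlt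
      omega
    simp only [Program.wp, NatExpr.eval]
    constructor
    · intro t ht
      simp [e0]
      constructor
      · intro h
        rcases h6 with h6 | h6
        · omega
        · exact hp.switched_mono hx (by omega) ht h6.2
      · intro h
        by_contra hc
        exact h5 t (by omega) h
    · intro c' hc'
      simp [e0, Function.update_of_ne hc']
      rw [f.natArr _ (by decide)]
  · have h1 : (Test.natLe (.reg rI + 1) (.reg rJ)).cost = 5 := rfl
    have h2 : (Program.storeNat bSw (.reg rC) (.reg rI)).bound = 3 := rfl
    rw [h1, h2]
    omega

theorem Walk.congr {n k M : ℕ} {x : ℕ → ℝ} {κ row col : ℕ → ℕ} {s s' : Store} {p : Program}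
    (hw : Walk n k M x κ row col s) (f : Frame p s s') (h₀ : rN ∉ p.natRegs) (h₁ : rK ∉ p.natRegs)
    (h₂ : rM ∉ p.natRegs) (h₃ : aX ∉ p.realArrs) (h₄ : bKap ∉ p.natArrs) (h₅ : bRow ∉ p.natArrs)
    (h₆ : bCol ∉ p.natArrs) : Walk n k M x κ row col s' where
  n_eq := (f.natReg _ h₀).trans hw.n_eq
  k_eq := (f.natReg _ h₁).trans hw.k_eq
  M_eq := (f.natReg _ h₂).trans hw.M_eq
  x_eq := (f.realArr _ h₃).trans hw.x_eq
  κ_eq := (f.natArr _ h₄).trans hw.κ_eq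
  row_eq t ht := (congrFun (f.natArr _ h₅) t).trans (hw.row_eq t ht)
  col_eq t ht := (congrFun (f.natArr _ h₆) t).trans (hw.col_eq t ht)

theorem exec_findSwitches {n k M : ℕ} {x : ℕ → ℝ} {κ row col : ℕ → ℕ} {s : Store}
    (hw : Walk n k M x κ row col s) (hp : UnitPath n M row col)
    (hx : ∀ u v, u ≤ v → v < n → x u ≤ x v) (hMn : M < n)
    (hb : ∀ c < k, Bracket n x κ row col s c (n - 1)) :
    Exec findSwitches s (k * (50 * (Nat.log 2 n + 1) + 40) + 8) fun s' =>
      ∀ c < k, ∀ t < n, s'.natArr bSw c ≤ t ↔ Switched n x κ c (row t) (col t) := by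
  refine (Exec.forLoop (x := rC) (y := rK) (p := findSwitch)
      (fun c s' => ∀ c' < c, ∀ t < n, s'.natArr bSw c' ≤ t ↔ Switched n x κ c' (row t) (col t))
      (N := k) (c := 50 * (Nat.log 2 n + 1) + 30) hw.k_eq
    (by decide) (by decide) (by decide) ?_ ?_).mono ?_ fun _ h => h
  · simp
  · intro c s' hc hcC hf inv
    have hw' : Walk n k M x κ row col s' := hw.congr hf (by decide) (by decide) (by decide)
      (by decide) (by decide) (by decide) (by decide)
    refine (exec_findSwitch hw' hp hx hMn hcC ?_).mono le_rfl ?_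
    · refine (hb c hc).congr ?_ ?_ ?_ ?_ ?_ ?_
      · rw [hf.realArr _ (by decide)]
      · rw [hf.realArr _ (by decide)]
      · rw [hf.realArr _ (by decide)]
      · rw [hf.realArr _ (by decide)]
      · rw [hf.natArr _ (by decide)]
      · rw [hf.natArr _ (by decide)]
    · rintro s'' ⟨h1, h2⟩ c' hc' t ht
      rcases Nat.lt_succ_iff_lt_or_eq.1 hc' with hc' | rfl
      · have := h2 c' hc'.ne
        simp [this, inv c' hc' t ht]
      · simpa using h1 t ht
  · exact le_rfl

/-! ### Evaluation of the objective function along a path -/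

notation "aDp" => 7
notation "aDa" => 8
notation "aDb" => 9
notation "aBest" => 10

/-- The affine function of `α` and `β` whose coefficients are the sums of the entries up to `t` of
the difference arrays. -/
noncomputable def diffSum (s : Store) (t : ℕ) (α β : ℝ) : ℝ :=
  ∑ u ∈ Finset.range (t + 1),
    (s.realArr aDp u + s.realArr aDa u * α + s.realArr aDb u * β)

theorem diffSum_congr {s s' : Store} (h₁ : s'.realArr aDp = s.realArr aDp)
    (h₂ : s'.realArr aDa = s.realArr aDa) (h₃ : s'.realArr aDb = s.realArr aDb) (t : ℕ)
    (α β : ℝ) : diffSum s' t α β = diffSum s t α β := by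
  simp only [diffSum, h₁, h₂, h₃]

/-- In the function of the time that is stored as its differences, from time `e` on
add `p * y + a * α + b * β`, where `y` is the value of the register `yA`. -/
def addFrom (e : NatExpr) (p a b : ℚ) : Program :=
  rP ≔ₙ e ;;
  .storeReal aDp (.reg rP) (.fetch aDp (.reg rP) + .const p * .reg yA) ;;
  .storeReal aDa (.reg rP) (.fetch aDa (.reg rP) + .const a) ;;
  .storeReal aDb (.reg rP) (.fetch aDb (.reg rP) + .const b)

theorem exec_addFrom (s : Store) (e : NatExpr) (p a b : ℚ) :
    Exec (addFrom e p a b) s (e.cost + 21) fun s' => ∀ t α β,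
      diffSum s' t α β = diffSum s t α β +
        if e.eval s ≤ t then p * s.realReg yA + a * α + b * β else 0 := by
  have hb : (addFrom e p a b).bound = e.cost + 21 := rfl
  refine (Exec.of_wp (p := addFrom e p a b) ?_).mono hb.le fun _ h => h
  simp only [addFrom, Program.wp, NatExpr.eval]
  intro t α β
  have h1 : (if e.eval s ≤ t then p * s.realReg yA + a * α + b * β else 0) =
      ∑ u ∈ Finset.range (t + 1), if u = e.eval s then p * s.realReg yA + a * α + b * β else 0 := by
    rw [Finset.sum_ite_eq']
    simp only [Finset.mem_range, Nat.lt_succ_iff]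
  rw [h1, diffSum, diffSum, ← Finset.sum_add_distrib]
  refine Finset.sum_congr rfl fun u _ => ?_
  by_cases hu : u = e.eval s
  · simp [RealExpr.eval, NatExpr.eval, hu]
    ring
  · simp [RealExpr.eval, NatExpr.eval, hu]

def clearDiff : Program :=
  .storeReal aDp (.reg rT) 0 ;; .storeReal aDa (.reg rT) 0 ;; .storeReal aDb (.reg rT) 0

/-- Add the contribution of the point `rT`, as a function of the time, to the difference arrays.
First the point is to the right of the right candidate; it gets to the left of it when the path
reaches its column.  When its category changes sides it is moved to the right of the left
candidate, and it gets to the left of this one when the path reaches its row. -/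
def addContribution : Program :=
  (yA ≔ᵣ .fetch aX (.reg rT) ;; rC ≔ₙ .fetch bKap (.reg rT) ;; rI ≔ₙ .fetch bSw (.reg rC)) ;;
  addFrom 0 1 0 (-1) ;;
  addFrom (.fetch bTb (.reg rT) - (.fetch bTb (.reg rT) - .reg rI)) (-2) 0 2 ;;
  addFrom (.reg rI) 2 (-1) (-1) ;;
  addFrom (.fetch bTa (.reg rT) + (.reg rI - .fetch bTa (.reg rT))) (-2) 2 0

/-- Cells up to `n` are in use, since a change may be registered at time `n`, to no effect. -/
def fillDiffs : Program :=
  rHi ≔ₙ .reg rN + 1 ;; forLoop rT rHi clearDiff ;; forLoop rT rN addContribution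

/-- The contribution of point `q` at time `t` if the category of `q` is on the left from time `sw`
on. -/
noncomputable def contribution (x : ℕ → ℝ) (row col : ℕ → ℕ) (sw q t : ℕ) (α β : ℝ) : ℝ :=
  if sw ≤ t then (if q ≤ row t then α - x q else x q - α)
  else if q ≤ col t then β - x q else x q - β

theorem exec_addContribution {n t' : ℕ} {row col : ℕ → ℕ} {s : Store} (hT : s.natReg rT = t')
    (hr : ∀ t < n, s.natArr bTa t' ≤ t ↔ t' ≤ row t)
    (hc : ∀ t < n, s.natArr bTb t' ≤ t ↔ t' ≤ col t) :
    Exec addContribution s 140 fun s' => ∀ t < n, ∀ α β,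
      diffSum s' t α β = diffSum s t α β +
        contribution (s.realArr aX) row col (s.natArr bSw (s.natArr bKap t')) t' t α β := by
  have start : Exec (yA ≔ᵣ .fetch aX (.reg rT) ;; rC ≔ₙ .fetch bKap (.reg rT) ;;
      rI ≔ₙ .fetch bSw (.reg rC)) s 9 fun s' => s'.realReg yA = s.realArr aX t' ∧
      s'.natReg rI = s.natArr bSw (s.natArr bKap t') := by
    refine (Exec.of_wp ?_).mono (by decide) fun _ h => h
    simp [Program.wp, NatExpr.eval, RealExpr.eval, hT]
  refine (Exec.seq start fun s₁ hs₁ f₁ => Exec.seq (exec_addFrom s₁ _ _ _ _) fun s₂ hs₂ f₂ =>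
    Exec.seq (exec_addFrom s₂ _ _ _ _) fun s₃ hs₃ f₃ => Exec.seq (exec_addFrom s₃ _ _ _ _)
    fun s₄ hs₄ f₄ => (exec_addFrom s₄ _ _ _ _).mono le_rfl fun s₅ hs₅ => ?_).mono (by decide)
    fun _ h => h
  intro t ht α β
  have y1 := hs₁.1
  have y2 : s₂.realReg yA = s.realArr aX t' := by rw [f₂.realReg _ (by simp [addFrom,
    Program.realRegs]), y1]
  have y3 : s₃.realReg yA = s.realArr aX t' := by rw [f₃.realReg _ (by simp [addFrom,
    Program.realRegs]), y2]
  have y4 : s₄.realReg yA = s.realArr aX t' := by rw [f₄.realReg _ (by simp [addFrom,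
    Program.realRegs]), y3]
  have i2 : s₂.natReg rI = s.natArr bSw (s.natArr bKap t') := by
    rw [f₂.natReg _ (by simp [addFrom, Program.natRegs]), hs₁.2]
  have i3 : s₃.natReg rI = s.natArr bSw (s.natArr bKap t') := by
    rw [f₃.natReg _ (by simp [addFrom, Program.natRegs]), i2]
  have i4 : s₄.natReg rI = s.natArr bSw (s.natArr bKap t') := by
    rw [f₄.natReg _ (by simp [addFrom, Program.natRegs]), i3]
  have t2 : s₂.natReg rT = t' := by
    rw [f₂.natReg _ (by simp [addFrom, Program.natRegs]), f₁.natReg _ (by decide), hT]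
  have t4 : s₄.natReg rT = t' := by
    rw [f₄.natReg _ (by simp [addFrom, Program.natRegs]),
      f₃.natReg _ (by simp [addFrom, Program.natRegs]), t2]
  have b2 : s₂.natArr bTb = s.natArr bTb := by
    rw [f₂.natArr _ (by simp [addFrom, Program.natArrs]), f₁.natArr _ (by decide)]
  have b4 : s₄.natArr bTa = s.natArr bTa := by
    rw [f₄.natArr _ (by simp [addFrom, Program.natArrs]),
      f₃.natArr _ (by simp [addFrom, Program.natArrs]),
      f₂.natArr _ (by simp [addFrom, Program.natArrs]), f₁.natArr _ (by decide)]
  rw [hs₅, hs₄, hs₃, hs₂, y1, y2, y3, y4, diffSum_congr (f₁.realArr _ (by decide))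
    (f₁.realArr _ (by decide)) (f₁.realArr _ (by decide))]
  simp only [NatExpr.eval, NatExpr.eval_sub, i2, i3, i4, t2,
    t4, b2, b4, contribution]
  have h1 := hr t ht
  have h2 := hc t ht
  generalize s.natArr bSw (s.natArr bKap t') = sw at *
  generalize s.natArr bTa t' = ta at *
  generalize s.natArr bTb t' = tb at *
  simp only [← h1, ← h2, Nat.zero_le, if_true]
  have m1 : tb - (tb - sw) ≤ t ↔ tb ≤ t ∨ sw ≤ t := by omega
  have m2 : ta + (sw - ta) ≤ t ↔ ta ≤ t ∧ sw ≤ t := by omega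
  simp only [m1, m2]
  by_cases k1 : sw ≤ t <;> by_cases k2 : ta ≤ t <;> by_cases k3 : tb ≤ t <;>
    simp [k1, k2, k3] <;> ring

theorem exec_fillDiffs {n k M : ℕ} {x : ℕ → ℝ} {κ row col : ℕ → ℕ} {s : Store}
    (hw : Walk n k M x κ row col s)
    (hr : ∀ p < n, ∀ t < n, s.natArr bTa p ≤ t ↔ p ≤ row t)
    (hc : ∀ p < n, ∀ t < n, s.natArr bTb p ≤ t ↔ p ≤ col t) :
    Exec fillDiffs s (200 * n + 100) fun s' => ∀ t < n, ∀ α β, diffSum s' t α β =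
      ∑ q ∈ Finset.range n, contribution x row col (s.natArr bSw (κ q)) q t α β := by
  refine (Exec.seq (T := 4) (R := fun s₁ => s₁ = s.setNat rHi (n + 1)) ?_ fun s₁ hs₁ f₁ =>
    Exec.seq (Exec.forLoop (x := rT) (y := rHi) (p := clearDiff)
      (fun t s' => ∀ u < t, s'.realArr aDp u = 0 ∧ s'.realArr aDa u = 0 ∧ s'.realArr aDb u = 0)
      (N := n + 1) (c := 20) ?_ (by decide) (by decide) (by decide) ?_ ?_) fun s₂ hs₂ f₂ =>
    (Exec.forLoop (x := rT) (y := rN) (p := addContribution)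
      (fun p s' => ∀ t < n, ∀ α β, diffSum s' t α β =
        ∑ q ∈ Finset.range p, contribution x row col (s.natArr bSw (κ q)) q t α β)
      (N := n) (c := 140) ?_ (by decide) (by decide) (by decide) ?_ ?_)).mono ?_ fun _ h => h
  · refine Exec.mono (T' := 4) (Exec.of_wp (p := rHi ≔ₙ .reg rN + 1) ?_) (by decide) fun _ h => h
    simp [Program.wp, NatExpr.eval, hw.n_eq]
  · simp [hs₁]
  · simp
  · intro i s' hi hiT hf inv
    refine (Exec.of_wp (p := clearDiff) ?_).mono (by decide) fun _ h => h
    simp only [clearDiff, Program.wp, NatExpr.eval, hiT]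
    intro u hu
    rcases Nat.lt_succ_iff_lt_or_eq.1 hu with hu | rfl
    · have := inv u hu
      simp [Function.update_of_ne hu.ne, this, hiT]
    · simp [hiT]
  · rw [f₂.natReg _ (by decide), f₁.natReg _ (by decide), hw.n_eq]
  · intro t ht α β
    simp only [Finset.range_zero, Finset.sum_empty, diffSum, Store.realArr_setNat]
    refine Finset.sum_eq_zero fun u hu => ?_
    obtain ⟨h1, h2, h3⟩ := hs₂ u (by have := Finset.mem_range.1 hu; omega)
    rw [h1, h2, h3]
    ring
  · intro p s' hp hpT hf inv
    have e1 : s'.realArr aX = x := by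
      rw [hf.realArr _ (by decide), f₂.realArr _ (by decide), f₁.realArr _ (by decide), hw.x_eq]
    have e2 : s'.natArr bKap = κ := by
      rw [hf.natArr _ (by decide), f₂.natArr _ (by decide), f₁.natArr _ (by decide), hw.κ_eq]
    have e3 : s'.natArr bSw = s.natArr bSw := by
      rw [hf.natArr _ (by decide), f₂.natArr _ (by decide), f₁.natArr _ (by decide)]
    have e4 : s'.natArr bTa = s.natArr bTa := by
      rw [hf.natArr _ (by decide), f₂.natArr _ (by decide), f₁.natArr _ (by decide)]
    have e5 : s'.natArr bTb = s.natArr bTb := by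
      rw [hf.natArr _ (by decide), f₂.natArr _ (by decide), f₁.natArr _ (by decide)]
    refine (exec_addContribution (row := row) (col := col) hpT (by rw [e4]; exact hr p hp)
      (by rw [e5]; exact hc p hp)).mono le_rfl fun s'' hs'' t ht α β => ?_
    change diffSum s'' t α β = _
    rw [hs'' t ht, inv t ht, Finset.sum_range_succ, e1, e2,
      e3]
  · omega

/-- The contributions of all the points add up to the objective function. -/
theorem sum_contribution {n k M : ℕ} {x : ℕ → ℝ} {κ row col sw : ℕ → ℕ}
    (hp : UnitPath n M row col) (hx : ∀ u v, u ≤ v → v < n → x u ≤ x v)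
    (hκ : ∀ p < n, κ p < k) (hMn : M < n) {t : ℕ} (ht : t < n)
    (hsw : ∀ c < k, sw c ≤ t ↔ Switched n x κ c (row t) (col t)) :
    ∑ q ∈ Finset.range n, contribution x row col (sw (κ q)) q t (x (row t)) (x (col t)) =
      splitCost n k x κ (row t) (col t) := by
  rw [← Finset.sum_fiberwise_of_maps_to (t := Finset.range k) (g := κ)
      (fun q hq => Finset.mem_range.2 (hκ q (Finset.mem_range.1 hq))), splitCost, objective]
  refine Finset.sum_congr rfl fun c hc => ?_
  have hc := Finset.mem_range.1 hc
  have hcol := hp.col_lt t ht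
  have hrow : row t < n := (hp.row_le t).trans_lt hMn
  have h1 : ∀ q ∈ cls n κ c,
      contribution x row col (sw (κ q)) q t (x (row t)) (x (col t)) =
        contribution x row col (sw c) q t (x (row t)) (x (col t)) := by
    intro q hq
    rw [(mem_cls.1 hq).2]
  have h2 : ∀ i < n, absSum x (cls n κ c) (x i) =
      ∑ q ∈ cls n κ c, if q ≤ i then x i - x q else x q - x i := by
    intro i hi
    rw [absSum_eq_line hx (cls_subset n κ c) hi (Or.inr rfl), slope_mul_add_offset]
    simp only [Nat.lt_succ_iff]
  refine (Finset.sum_congr rfl h1).trans ?_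
  by_cases hS : sw c ≤ t
  · rw [min_eq_left ((hsw c hc).1 hS).1, h2 _ hrow]
    simp only [contribution, if_pos hS]
  · rw [min_eq_right (le_of_not_switched hx (fun h => hS ((hsw c hc).2 h))
      ((hp.row_le t).trans (hp.le_col t)) hcol), h2 _ hcol]
    simp only [contribution, if_neg hS]

def startEval : Program := yA ≔ᵣ 0 ;; yB ≔ᵣ 0 ;; ySb ≔ᵣ 0

/-- Evaluate the objective function at time `rT`, and update the minimum of the row, which is set
when the path enters the row. -/
def evalStep : Program :=
  yA ≔ᵣ .reg yA + .fetch aDp (.reg rT) ;; yB ≔ᵣ .reg yB + .fetch aDa (.reg rT) ;;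
  ySb ≔ᵣ .reg ySb + .fetch aDb (.reg rT) ;;
  rI ≔ₙ .fetch bRow (.reg rT) ;; rJ ≔ₙ .fetch bCol (.reg rT) ;;
  yOa ≔ᵣ .reg yA + .reg yB * .fetch aX (.reg rI) + .reg ySb * .fetch aX (.reg rJ) ;;
  .ite (.or (.reg rT ≤ₙ .fetch bTa (.reg rI)) (.not (.fetch aBest (.reg rI) ≤ᵣ .reg yOa)))
    (.storeReal aBest (.reg rI) (.reg yOa) ;; .storeNat bOpt (.reg rI) (.reg rJ)) .skip

/-- Evaluate the objective function along the path, by summation of the differences. -/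
def evalPath : Program := startEval ;; forLoop rT rN evalStep

/-- For each row that the path visits before time `t`, the best one of the columns visited and the
value there have been stored. -/
def RowsDone (G : ℕ → ℕ → ℝ) (row col : ℕ → ℕ) (t : ℕ) (s : Store) : Prop :=
  ∀ u < t, (∃ v < t, row v = row u ∧ s.natArr bOpt (row u) = col v) ∧
    s.realArr aBest (row u) = G (row u) (s.natArr bOpt (row u)) ∧
    s.realArr aBest (row u) ≤ G (row u) (col u)

theorem exec_evalPath {n k M : ℕ} {x : ℕ → ℝ} {κ row col : ℕ → ℕ} {s : Store}
    (hw : Walk n k M x κ row col s) (hp : UnitPath n M row col) (hMn : M < n)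
    (hr : ∀ p < n, ∀ t < n, s.natArr bTa p ≤ t ↔ p ≤ row t)
    (hd : ∀ t < n, diffSum s t (x (row t)) (x (col t)) = splitCost n k x κ (row t) (col t)) :
    Exec evalPath s (100 * n + 30) (RowsDone (splitCost n k x κ) row col n) := by
  refine (Exec.seq (T := 10) (R := fun s₁ => s₁.realReg yA = 0 ∧ s₁.realReg yB = 0 ∧
      s₁.realReg ySb = 0) ?_ fun s₁ hs₁ f₁ =>
    (Exec.forLoop (x := rT) (y := rN) (p := evalStep)
      (fun t s' => s'.realReg yA = ∑ u ∈ Finset.range t, s.realArr aDp u ∧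
        s'.realReg yB = ∑ u ∈ Finset.range t, s.realArr aDa u ∧
        s'.realReg ySb = ∑ u ∈ Finset.range t, s.realArr aDb u ∧
        RowsDone (splitCost n k x κ) row col t s')
      (N := n) (c := 60) ?_ (by decide) (by decide) (by decide) ?_ ?_).mono le_rfl
        fun s' hs' => hs'.2.2.2).mono ?_ fun _ h => h
  · refine Exec.mono (T' := 10) (Exec.of_wp (p := startEval) ?_) (by decide) fun _ h => h
    simp [startEval, Program.wp]
  · rw [f₁.natReg _ (by decide), hw.n_eq]
  · refine ⟨by simpa using hs₁.1, by simpa using hs₁.2.1, by simpa using hs₁.2.2, ?_⟩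
    intro u hu
    omega
  · rintro t s' ht htT hf ⟨i1, i2, i3, i4⟩
    have hw' : Walk n k M x κ row col s' := (hw.congr f₁ (by decide) (by decide) (by decide)
      (by decide) (by decide) (by decide) (by decide)).congr hf (by decide) (by decide) (by decide)
      (by decide) (by decide) (by decide) (by decide)
    have e1 : s'.realArr aDp = s.realArr aDp := by
      rw [hf.realArr _ (by decide), f₁.realArr _ (by decide)]
    have e2 : s'.realArr aDa = s.realArr aDa := by
      rw [hf.realArr _ (by decide), f₁.realArr _ (by decide)]
    have e3 : s'.realArr aDb = s.realArr aDb := by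
      rw [hf.realArr _ (by decide), f₁.realArr _ (by decide)]
    have e4 : s'.natArr bTa = s.natArr bTa := by
      rw [hf.natArr _ (by decide), f₁.natArr _ (by decide)]
    have hrow : row t < n := (hp.row_le t).trans_lt hMn
    have hval := hd t ht
    simp only [diffSum, Finset.sum_add_distrib, ← Finset.sum_mul] at hval
    refine (Exec.of_wp (p := evalStep) ?_).mono (by decide) fun _ h => h
    simp only [evalStep, Program.wp, Test.Holds, NatExpr.eval]
    constructor
    · intro hb
      simp [htT, RealExpr.eval, NatExpr.eval, hw'.x_eq, hw'.row_eq t ht, hw'.col_eq t ht, i1, i2,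
        i3, e1, e2, e3, e4, ← Finset.sum_range_succ, hval] at hb
      refine ⟨?_, ?_, ?_, ?_⟩
      · simp [htT, RealExpr.eval, NatExpr.eval, i1, e1, Finset.sum_range_succ]
      · simp [htT, RealExpr.eval, NatExpr.eval, i2, e2, Finset.sum_range_succ]
      · simp [htT, RealExpr.eval, NatExpr.eval, i3, e3, Finset.sum_range_succ]
      · intro u hu
        simp [htT, RealExpr.eval, NatExpr.eval, hw'.x_eq, hw'.row_eq t ht, hw'.col_eq t ht, i1, i2,
          i3, e1, e2, e3, ← Finset.sum_range_succ, hval]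
        by_cases hut : row u = row t
        · rw [hut, Function.update_self, Function.update_self]
          refine ⟨⟨t, by omega, rfl, rfl⟩, rfl, ?_⟩
          rcases Nat.lt_succ_iff_lt_or_eq.1 hu with hu | rfl
          · rcases hb with hb | hb
            · have := (hr (row t) hrow u (by omega)).2 hut.ge
              omega
            · have := (i4 u hu).2.2
              rw [hut] at this
              exact (hb.trans_le this).le
          · exact le_rfl
        · rw [Function.update_of_ne hut, Function.update_of_ne hut]
          have hu' : u < t := by
            rcases Nat.lt_succ_iff_lt_or_eq.1 hu with hu | rfl
            · exact hu
            · exact absurd rfl hut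
          obtain ⟨⟨v, hv, hv1, hv2⟩, h2, h3⟩ := i4 u hu'
          exact ⟨⟨v, by omega, hv1, hv2⟩, h2, h3⟩
    · intro hb
      simp [htT, RealExpr.eval, NatExpr.eval, hw'.x_eq, hw'.row_eq t ht, hw'.col_eq t ht, i1, i2,
        i3, e1, e2, e3, e4, ← Finset.sum_range_succ, hval] at hb
      refine ⟨?_, ?_, ?_, ?_⟩
      · simp [htT, RealExpr.eval, NatExpr.eval, i1, e1, Finset.sum_range_succ]
      · simp [htT, RealExpr.eval, NatExpr.eval, i2, e2, Finset.sum_range_succ]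
      · simp [htT, RealExpr.eval, NatExpr.eval, i3, e3, Finset.sum_range_succ]
      · intro u hu
        simp
        rcases Nat.lt_succ_iff_lt_or_eq.1 hu with hu | rfl
        · obtain ⟨⟨v, hv, hv1, hv2⟩, h2, h3⟩ := i4 u hu
          exact ⟨⟨v, by omega, hv1, hv2⟩, h2, h3⟩
        · -- the row has been entered before, so its entries are already in use
          have hta : s.natArr bTa (row u) ≤ u - 1 := by omega
          have hrow' := (hr (row u) hrow (u - 1) (by omega)).1 hta
          have := hp.row_mono (Nat.sub_le u 1)
          have heq : row (u - 1) = row u := le_antisymm this hrow'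
          obtain ⟨⟨v, hv, hv1, hv2⟩, h2, h3⟩ := i4 (u - 1) (by omega)
          rw [heq] at hv1 hv2 h2
          exact ⟨⟨v, by omega, hv1, hv2⟩, h2, hb.2⟩
  · omega

/-! ### One level of the search for the row minima -/

/-- Find the minima of the rows that are multiples of `rS`, given those of the rows that are
multiples of `2 * rS`, with a path that leaves each row at the minimum of the nearest row that is
known. -/
def level : Program :=
  walkPath ;; initLines ;; bracketSwitches ;; findSwitches ;; fillDiffs ;; evalPath

/-- For each row, the best column between the one in which the path enters the row and the one in
which it leaves the row. -/
def RowsSolved (M n : ℕ) (G : ℕ → ℕ → ℝ) (U opt : ℕ → ℕ) (best : ℕ → ℝ) : Prop :=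
  ∀ i ≤ M, entry M U i ≤ opt i ∧ (opt i ≤ if i < M then U i else n - 1) ∧
    best i = G i (opt i) ∧
    ∀ j, entry M U i ≤ j → (j ≤ if i < M then U i else n - 1) → G i (opt i) ≤ G i j

theorem exec_level {n k M w : ℕ} {x : ℕ → ℝ} {κ : ℕ → ℕ} {s : Store} (hn : s.natReg rN = n)
    (hk : s.natReg rK = k) (hM : s.natReg rM = M) (hw : s.natReg rS = w) (hw0 : 0 < w)
    (hMn : M < n) (hxe : s.realArr aX = x) (hκe : s.natArr bKap = κ)
    (hx : ∀ u v, u ≤ v → v < n → x u ≤ x v) (hκ : ∀ p < n, κ p < k) {U : ℕ → ℕ}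
    (hUe : U = fun i => extend M n (s.natArr bOpt) (nearest w i)) (hU : Monotone U)
    (hMU : M ≤ U 0) (hUn : ∀ i, U i < n) :
    Exec level s (1000 * (n + k * (Nat.log 2 n + 1))) fun s' =>
      RowsSolved M n (splitCost n k x κ) U (s'.natArr bOpt) (s'.realArr aBest) := by
  have hp : UnitPath n M (pathRow M U) (pathCol M U) :=
    ⟨⟨rfl, rfl⟩, fun t => (path_step M U t).imp_right fun h => ⟨h.1, h.2.1⟩, pathRow_le M U,
      fun t ht => pathCol_lt hU hMU hUn ht⟩
  refine (Exec.seq (exec_walkPath hn hM hw hw0 hMn) (T' := 600 * n + 140 * k +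
    50 * (k * (Nat.log 2 n + 1)) + 178) fun s₁ hs₁ f₁ => ?_).mono ?_ fun _ h => h
  · rw [← hUe] at hs₁
    have w₁ : Walk n k M x κ (pathRow M U) (pathCol M U) s₁ :=
      ⟨by rw [f₁.natReg _ (by decide), hn], by rw [f₁.natReg _ (by decide), hk],
        by rw [f₁.natReg _ (by decide), hM], by rw [f₁.realArr _ (by decide), hxe],
        by rw [f₁.natArr _ (by decide), hκe], hs₁.row, hs₁.col⟩
    refine (Exec.seq (exec_initLines w₁.n_eq w₁.k_eq w₁.M_eq) (T' := 500 * n + 40 * k +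
      50 * (k * (Nat.log 2 n + 1)) + 158) fun s₂ hs₂ f₂ => ?_).mono (by omega) fun _ h => h
    have w₂ := w₁.congr f₂ (by decide) (by decide) (by decide) (by decide) (by decide) (by decide)
      (by decide)
    rw [w₁.x_eq, w₁.κ_eq] at hs₂
    refine (Exec.seq (exec_bracketSwitches w₂ hp hx hκ hMn hs₂) (T' := 300 * n + 40 * k +
      50 * (k * (Nat.log 2 n + 1)) + 138) fun s₃ hs₃ f₃ => ?_).mono (by omega) fun _ h => h
    have w₃ := w₂.congr f₃ (by decide) (by decide) (by decide) (by decide) (by decide) (by decide)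
      (by decide)
    refine (Exec.seq (exec_findSwitches w₃ hp hx hMn hs₃) (T' := 300 * n + 130)
      fun s₄ hs₄ f₄ => ?_).mono (by rw [Nat.mul_add, Nat.mul_left_comm]; omega) fun _ h => h
    have w₄ := w₃.congr f₄ (by decide) (by decide) (by decide) (by decide) (by decide) (by decide)
      (by decide)
    have hta : s₄.natArr bTa = s₁.natArr bTa := by
      rw [f₄.natArr _ (by decide), f₃.natArr _ (by decide), f₂.natArr _ (by decide)]
    have htb : s₄.natArr bTb = s₁.natArr bTb := by
      rw [f₄.natArr _ (by decide), f₃.natArr _ (by decide), f₂.natArr _ (by decide)]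
    refine (Exec.seq (exec_fillDiffs w₄ (hta ▸ hs₁.timeRow) (htb ▸ hs₁.timeCol))
      (T' := 100 * n + 30) fun s₅ hs₅ f₅ => ?_).mono (by omega) fun _ h => h
    have w₅ := w₄.congr f₅ (by decide) (by decide) (by decide) (by decide) (by decide) (by decide)
      (by decide)
    have hta' : s₅.natArr bTa = s₁.natArr bTa := by rw [f₅.natArr _ (by decide), hta]
    refine (exec_evalPath w₅ hp hMn (hta' ▸ hs₁.timeRow) fun t ht => ?_).mono le_rfl
      fun s' hs' i hi => ?_
    · rw [hs₅ t ht]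
      exact sum_contribution hp hx hκ hMn ht fun c hc => hs₄ c hc t ht
    · have hvisit : ∀ j, entry M U i ≤ j → (j ≤ if i < M then U i else n - 1) →
          ∃ t < n, pathRow M U t = i ∧ pathCol M U t = j := by
        intro j hj1 hj2
        have hb : i < M → j ≤ U i := fun h => by rwa [if_pos h] at hj2
        have hjn : j < n := by
          have := hUn i
          split_ifs at hj2 <;> omega
        have hMj : M ≤ j := by
          refine le_trans ?_ hj1
          rw [entry]
          split_ifs
          · exact le_rfl
          · exact hMU.trans (hU (Nat.zero_le _))
        have hrow := path_visits hU hMU i hi j hj1 hb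
        have hsum := pathRow_add_pathCol M U (i + j - M)
        exact ⟨i + j - M, by omega, hrow, by omega⟩
      have hne : entry M U i ≤ if i < M then U i else n - 1 := by
        have h1 : entry M U i ≤ U i := by
          rw [entry]
          split_ifs with h
          · rw [h]
            exact hMU
          · exact hU (Nat.sub_le _ _)
        have := hUn i
        split_ifs <;> omega
      obtain ⟨t, ht, ht1, -⟩ := hvisit _ le_rfl hne
      obtain ⟨⟨v, hv, hv1, hv2⟩, h2, -⟩ := hs' t ht
      rw [ht1] at hv1 hv2 h2
      have hbd := path_bounds hU hMU v
      have hcl := pathCol_lt hU hMU hUn hv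
      rw [hv1] at hbd
      refine ⟨by rw [hv2]; exact hbd.1, ?_, h2, fun j hj1 hj2 => ?_⟩
      · rw [hv2]
        split_ifs with h
        · exact hbd.2 h
        · omega
      · obtain ⟨u, hu, hu1, hu2⟩ := hvisit j hj1 hj2
        have h3 := (hs' u hu).2.2
        rw [hu1, hu2, h2] at h3
        exact h3
  · have : k ≤ k * (Nat.log 2 n + 1) := Nat.le_mul_of_pos_right k (Nat.succ_pos _)
    omega

/-- The minima of the rows that are multiples of `w` are known. -/
structure RowsKnown (M n w : ℕ) (G : ℕ → ℕ → ℝ) (opt : ℕ → ℕ) (best : ℕ → ℝ) : Prop where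
  bounds : ∀ q, q * w ≤ M → M ≤ opt (q * w) ∧ opt (q * w) < n
  isMin : ∀ q, q * w ≤ M → IsRowMin M n G (q * w) (opt (q * w))
  best_eq : ∀ q, q * w ≤ M → best (q * w) = G (q * w) (opt (q * w))
  mono : ∀ q q', q ≤ q' → q' * w ≤ M → opt (q * w) ≤ opt (q' * w)

theorem le_nearest (w q : ℕ) (hw : 0 < w) : q * w ≤ nearest w (q * w) := by
  rcases Nat.even_or_odd' q with ⟨r, rfl | rfl⟩
  · have e : 2 * r * w = r * (2 * w) := by ring
    rw [e, nearest_eq (q := r) (by omega) (by omega)]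
  · have e : (2 * r + 1) * w = r * (2 * w) + w := by ring
    have e' : (r + 1) * (2 * w) = r * (2 * w) + 2 * w := Nat.succ_mul _ _
    rw [e, nearest_eq (q := r + 1)] <;> omega

theorem nearest_pred_le (w q : ℕ) (hw : 0 < w) (hq : 0 < q) : nearest w (q * w - 1) ≤ q * w := by
  have hpos : 0 < q * w := Nat.mul_pos hq hw
  rcases Nat.even_or_odd' q with ⟨r, rfl | rfl⟩
  · have e : 2 * r * w = r * (2 * w) := by ring
    rw [e] at hpos ⊢
    rw [nearest_eq (q := r) (by omega) (by omega)]
  · have e : (2 * r + 1) * w = r * (2 * w) + w := by ring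
    rw [e] at hpos ⊢
    rw [nearest_eq (q := r) (by omega) (by omega)]
    omega

section Refinement

variable {M n w : ℕ} {G : ℕ → ℕ → ℝ} {opt : ℕ → ℕ} {best : ℕ → ℝ}

theorem RowsKnown.extend_mono (h : RowsKnown M n (2 * w) G opt best) {q q' : ℕ} (hq : q ≤ q') :
    extend M n opt (q * (2 * w)) ≤ extend M n opt (q' * (2 * w)) := by
  have hle : q * (2 * w) ≤ q' * (2 * w) := Nat.mul_le_mul_right _ hq
  simp only [extend]
  split_ifs with h1 h2 h2
  · exact h.mono q q' hq h2
  · have := (h.bounds q h1).2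
    omega
  · omega
  · exact le_rfl

theorem RowsKnown.monotone (h : RowsKnown M n (2 * w) G opt best) :
    Monotone fun i => extend M n opt (nearest w i) := fun _ _ hij =>
  h.extend_mono (Nat.div_le_div_right (Nat.add_le_add_right hij w))

theorem RowsKnown.le_extend (h : RowsKnown M n (2 * w) G opt best) (hw : 0 < w) :
    M ≤ extend M n opt (nearest w 0) := by
  have e : nearest w 0 = 0 * (2 * w) := nearest_eq (by omega) (by omega)
  rw [e, extend, if_pos (by omega)]
  exact (h.bounds 0 (by omega)).1

theorem RowsKnown.extend_lt (h : RowsKnown M n (2 * w) G opt best) (hn : 0 < n) (i : ℕ) :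
    extend M n opt (nearest w i) < n := by
  rw [extend]
  split_ifs with h1
  · exact (h.bounds _ h1).2
  · omega

/-- After a level, the minima of twice as many rows are known. -/
theorem RowsKnown.refine {opt' : ℕ → ℕ} {best' : ℕ → ℝ} (h : RowsKnown M n (2 * w) G opt best)
    (hG : IsMonge M n G) (hMn : M < n) (hw : 0 < w)
    (hs : RowsSolved M n G (fun i => extend M n opt (nearest w i)) opt' best') :
    RowsKnown M n w G opt' best' := by
  set U : ℕ → ℕ := fun i => extend M n opt (nearest w i) with hUd
  have hU : Monotone U := h.monotone
  have hMU : ∀ i, M ≤ U i := fun i => (h.le_extend hw).trans (hU (Nat.zero_le i))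
  have hUn : ∀ i, U i < n := h.extend_lt (by omega)
  have hME : ∀ i, M ≤ entry M U i := by
    intro i
    rw [entry]
    split_ifs
    · exact le_rfl
    · exact hMU _
  have hb : ∀ i ≤ M, opt' i < n := by
    intro i hi
    have := (hs i hi).2.1
    have := hUn i
    split_ifs at * <;> omega
  refine ⟨fun q hq => ⟨(hME _).trans (hs _ hq).1, hb _ hq⟩, fun q hq => ?_,
    fun q hq => (hs _ hq).2.2.1, fun q q' hqq hq' => ?_⟩
  · obtain ⟨h1, h2, h3, h4⟩ := hs _ hq
    refine hG.isRowMin hq (hME _) (h1.trans h2) ?_ ?_ ?_ h4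
    · have := hUn (q * w)
      split_ifs <;> omega
    · rcases Nat.eq_zero_or_pos q with rfl | hq0
      · left
        simp [entry]
      · right
        have hpos : q * w ≠ 0 := (Nat.mul_pos hq0 hw).ne'
        have hle := nearest_pred_le w q hw hq0
        refine ⟨_, hle, ?_⟩
        rw [entry, if_neg hpos, hUd]
        simp only [extend]
        rw [if_pos (hle.trans hq)]
        exact h.isMin _ (hle.trans hq)
    · split_ifs with hlt
      · by_cases hc : nearest w (q * w) ≤ M
        · right
          refine ⟨_, le_nearest w q hw, hc, ?_⟩
          rw [hUd]
          simp only [extend]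
          rw [if_pos hc]
          exact h.isMin _ hc
        · left
          rw [hUd]
          simp only [extend]
          rw [if_neg hc]
          omega
      · left
        omega
  · rcases hqq.lt_or_eq with hlt | rfl
    · have h1 : q * w < q' * w := Nat.mul_lt_mul_of_pos_right hlt hw
      have h2 := (hs _ (h1.le.trans hq')).2.1
      have h3 := (hs _ hq').1
      rw [if_pos (by omega)] at h2
      rw [entry, if_neg (by omega)] at h3
      exact h2.trans ((hU (by omega)).trans h3)
    · exact le_rfl

/-- Before the first level the stride exceeds the number of rows, and row `0` is searched
completely. -/
theorem extend_first (hw : M < w) (h₀ : opt 0 = n - 1) (i : ℕ) :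
    extend M n opt (nearest w i) = n - 1 := by
  rw [extend]
  split_ifs with h
  · have : nearest w i = 0 := by
      rw [nearest] at h ⊢
      rcases Nat.eq_zero_or_pos ((i + w) / (2 * w)) with h1 | h1
      · rw [h1, Nat.zero_mul]
      · have : 1 * (2 * w) ≤ (i + w) / (2 * w) * (2 * w) := Nat.mul_le_mul_right _ h1
        omega
    rw [this, h₀]
  · rfl

/-- The first level, whose path consists of row `0` and the last column, finds the minimum of row
`0`. -/
theorem RowsKnown.first {U : ℕ → ℕ} (hU : ∀ i, U i = n - 1) (hMn : M < n) (hw : M < w)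
    (hs : RowsSolved M n G U opt best) : RowsKnown M n w G opt best := by
  have hq0 : ∀ q, q * w ≤ M → q = 0 := by
    intro q hq
    by_contra h
    have : 1 * w ≤ q * w := Nat.mul_le_mul_right _ (Nat.pos_of_ne_zero h)
    omega
  obtain ⟨h1, h2, h3, h4⟩ := hs 0 (Nat.zero_le _)
  simp only [hU, ite_self, entry, if_true] at h1 h2 h4
  refine ⟨fun q hq => ?_, fun q hq => ?_, fun q hq => ?_, fun q q' hqq hq' => ?_⟩
  · rw [hq0 q hq, Nat.zero_mul]
    exact ⟨h1, by omega⟩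
  · rw [hq0 q hq, Nat.zero_mul]
    exact fun j h5 h6 => h4 j h5 (by omega)
  · rw [hq0 q hq, Nat.zero_mul]
    exact h3
  · obtain rfl := hq0 q' hq'
    obtain rfl : q = 0 := by omega
    exact le_rfl

end Refinement

/-! ### The minimum of the matrix -/

def startSearch : Program := rM ≔ₙ .half (.reg rN) ;; rS ≔ₙ 1

/-- Find a power of two that exceeds `rM`, and prepare the search of row `0`. -/
def findStride : Program :=
  startSearch ;; .loop (.reg rS ≤ₙ .reg rM) (rS ≔ₙ .reg rS + .reg rS) ;;
  .storeNat bOpt 0 (.reg rN - 1)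

theorem exec_findStride {n : ℕ} {s : Store} (hn : s.natReg rN = n) (hn0 : 0 < n) :
    Exec findStride s (20 * (Nat.log 2 n + 1) + 40) fun s' => s'.natReg rM = n / 2 ∧
      s'.natArr bOpt 0 = n - 1 ∧ ∃ e, s'.natReg rS = 2 ^ e ∧ n / 2 < 2 ^ e ∧ e ≤ Nat.log 2 n := by
  let Inv : ℕ → Store → Prop := fun d s' => s'.natReg rN = n ∧ s'.natReg rM = n / 2 ∧
    (∃ e, s'.natReg rS = 2 ^ e ∧ 2 ^ e ≤ n) ∧ n / 2 < s'.natReg rS * 2 ^ d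
  refine (Exec.seq (T := 10) (R := Inv (Nat.log 2 n + 1)) ?_ fun s₁ hs₁ f₁ =>
    Exec.seq (Exec.loop (Inv := Inv) (c := 8) ?_ (Nat.log 2 n + 1) s₁ hs₁)
      fun s₂ hs₂ f₂ => Exec.mono (T' := 8) (Exec.of_wp (p := .storeNat bOpt 0 (.reg rN - 1)) ?_)
        (by decide) fun _ h => h).mono ?_ fun _ h => h
  · refine Exec.mono (T' := 10) (Exec.of_wp (p := startSearch) ?_) (by decide) fun _ h => h
    have hlog := Nat.lt_pow_succ_log_self one_lt_two n
    simp only [startSearch, Program.wp, NatExpr.eval, Inv]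
    refine ⟨by simp [hn], by simp [hn], ⟨0, by simp, by simp; omega⟩, ?_⟩
    rw [Nat.succ_eq_add_one] at hlog
    simp
    omega
  · rintro d s' ⟨h0, h1, ⟨e, h2, h3⟩, h4⟩ hb
    simp only [Test.Holds, NatExpr.eval, h1] at hb
    obtain ⟨d, rfl⟩ : ∃ d', d = d' + 1 := by
      rcases d with _ | d
      · simp at h4
        omega
      · exact ⟨d, rfl⟩
    refine ⟨d, rfl, Exec.mono (Exec.of_wp (p := rS ≔ₙ .reg rS + .reg rS) ?_) (by decide)
      fun _ h => h⟩
    simp only [Program.wp, NatExpr.eval, Inv]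
    rw [pow_succ] at h4
    refine ⟨by simp [h0], by simp [h1], ⟨e + 1, ?_, ?_⟩, ?_⟩
    · simp [h2, pow_succ]
      ring
    · rw [pow_succ]
      omega
    · simp
      nlinarith
  · obtain ⟨⟨d, h0, h1, ⟨e, h2, h3⟩, h4⟩, hb⟩ := hs₂
    simp only [Test.Holds, NatExpr.eval, h1, not_le] at hb
    simp only [Program.wp, NatExpr.eval]
    refine ⟨by simp [h1], by simp [h0, NatExpr.eval], e, by simp [h2], by omega, ?_⟩
    exact Nat.le_log_of_pow_le one_lt_two h3
  · have h1 : (Test.natLe (.reg rS) (.reg rM)).cost = 3 := rfl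
    rw [h1]
    omega

/-- Find the minima of all the rows, halving the distance of the known rows at each level. -/
def findRowMins : Program :=
  level ;; .loop (2 ≤ₙ .reg rS) (rS ≔ₙ .half (.reg rS) ;; level)

theorem exec_findRowMins {n k e : ℕ} {x : ℕ → ℝ} {κ : ℕ → ℕ} {s : Store} (hn : s.natReg rN = n)
    (hk : s.natReg rK = k) (hM : s.natReg rM = n / 2) (hn0 : 0 < n) (hxe : s.realArr aX = x)
    (hκe : s.natArr bKap = κ) (hx : ∀ u v, u ≤ v → v < n → x u ≤ x v) (hκ : ∀ p < n, κ p < k)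
    (h₀ : s.natArr bOpt 0 = n - 1) (hS : s.natReg rS = 2 ^ e) (hMS : n / 2 < 2 ^ e)
    (he : e ≤ Nat.log 2 n) :
    Exec findRowMins s (1020 * ((n + k * (Nat.log 2 n + 1)) * (Nat.log 2 n + 1))) fun s' =>
      RowsKnown (n / 2) n 1 (splitCost n k x κ) (s'.natArr bOpt) (s'.realArr aBest) := by
  have hMn : n / 2 < n := Nat.div_lt_self hn0 one_lt_two
  have hG := isMonge_splitCost (M := n / 2) hx k κ
  set L := Nat.log 2 n + 1 with hL
  let step : Program := rS ≔ₙ .half (.reg rS) ;; level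
  let Inv : ℕ → Store → Prop := fun d s' => Frame step s s' ∧ s'.natReg rS = 2 ^ d ∧
    RowsKnown (n / 2) n (2 ^ d) (splitCost n k x κ) (s'.natArr bOpt) (s'.realArr aBest)
  -- the first level, and then `e` levels with stride `2 ^ (e - 1), …, 1`
  refine (Exec.seq (T := 1000 * (n + k * L)) (R := Inv e) ?_ fun s₁ hs₁ f₁ =>
    Exec.mono (Exec.loop (Inv := Inv) (c := 1000 * (n + k * L) + 6) ?_ e s₁ hs₁) le_rfl ?_).mono ?_
      fun _ h => h
  · have hU := extend_first (opt := s.natArr bOpt) hMS h₀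
    have hp : 0 < 2 ^ e := by positivity
    refine (exec_level hn hk hM hS hp hMn hxe hκe hx hκ rfl (fun i j _ => ?_) ?_ fun i => ?_).framed
      |>.mono le_rfl fun s' h => ⟨?_, ?_, ?_⟩
    · simp only [hU, le_rfl]
    · simp only [hU]
      omega
    · simp only [hU]
      omega
    · exact h.2.seqRight
    · rw [h.2.natReg _ (by decide), hS]
    · exact RowsKnown.first hU hMn hMS h.1
  · rintro d s' ⟨hf, h1, h2⟩ hb
    have hb' : 2 ≤ s'.natReg rS := hb
    rw [h1] at hb'
    obtain ⟨d, rfl⟩ : ∃ d', d = d' + 1 := by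
      rcases d with _ | d
      · simp at hb'
      · exact ⟨d, rfl⟩
    refine ⟨d, rfl, ?_⟩
    have hp : 0 < 2 ^ d := by positivity
    rw [pow_succ, mul_comm] at h1 h2
    refine (Exec.framed (p := step) (T := 1000 * (n + k * L) + 6)
      (Q := fun s'' => s''.natReg rS = 2 ^ d ∧ RowsKnown (n / 2) n (2 ^ d) (splitCost n k x κ)
        (s''.natArr bOpt) (s''.realArr aBest)) ?_).mono le_rfl
        fun s'' h => ⟨hf.trans h.2, h.1⟩
    refine (Exec.seq (T := 6) (R := fun s₂ => s₂.natReg rS = 2 ^ d)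
      (Exec.mono (Exec.of_wp (p := rS ≔ₙ .half (.reg rS)) ?_) (by decide) fun _ h => h)
      fun s₂ hs₂ f₂ => ?_).mono (Nat.add_comm _ _).le fun _ h => h
    · simp [Program.wp, NatExpr.eval, h1]
    · have e1 : s₂.natArr bOpt = s'.natArr bOpt := f₂.natArr _ (by decide)
      refine (exec_level (by rw [f₂.natReg _ (by decide), hf.natReg _ (by decide), hn])
        (by rw [f₂.natReg _ (by decide), hf.natReg _ (by decide), hk])
        (by rw [f₂.natReg _ (by decide), hf.natReg _ (by decide), hM]) hs₂ hp hMn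
        (by rw [f₂.realArr _ (by decide), hf.realArr _ (by decide), hxe])
        (by rw [f₂.natArr _ (by decide), hf.natArr _ (by decide), hκe]) hx hκ (e1 ▸ rfl)
        h2.monotone (h2.le_extend hp) (h2.extend_lt hn0)).framed.mono le_rfl fun s'' h => ⟨?_, ?_⟩
      · rw [h.2.natReg _ (by decide), hs₂]
      · exact h2.refine hG hMn hp h.1
  · rintro s' ⟨⟨d, -, h1, h2⟩, hb⟩
    have hb' : ¬ 2 ≤ s'.natReg rS := hb
    rw [h1] at hb'
    obtain rfl : d = 0 := by
      by_contra h
      exact hb' (Nat.le_self_pow h 2)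
    simpa using h2
  · have h1 : (Test.natLe 2 (.reg rS)).cost = 3 := rfl
    have h3 : L ≤ (n + k * L) * L := Nat.le_mul_of_pos_left _ (by omega)
    have h4 : (e + 1) * (n + k * L) ≤ (n + k * L) * L := by
      rw [mul_comm]
      exact Nat.mul_le_mul_left _ (by omega)
    rw [h1]
    nlinarith

def startPick : Program := rI ≔ₙ 0 ;; rHi ≔ₙ .reg rM + 1

def pickStep : Program :=
  .ite (.fetch aBest (.reg rT) ≤ᵣ .fetch aBest (.reg rI)) (rI ≔ₙ .reg rT) .skip

def loadPair : Program := 0 ≔ᵣ .fetch aX (.reg rI) ;; 1 ≔ᵣ .fetch aX (.fetch bOpt (.reg rI))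

/-- Choose the row with the least minimum, and load the pair of candidates. -/
def pickRow : Program := startPick ;; forLoop rT rHi pickStep ;; loadPair

theorem exec_pickRow {n M : ℕ} {G : ℕ → ℕ → ℝ} {s : Store} (hM : s.natReg rM = M)
    (h : RowsKnown M n 1 G (s.natArr bOpt) (s.realArr aBest)) :
    Exec pickRow s (30 * M + 80) fun s' => ∃ i j, i ≤ M ∧ M ≤ j ∧ j < n ∧
      s'.realReg 0 = s.realArr aX i ∧ s'.realReg 1 = s.realArr aX j ∧
      ∀ i' ≤ M, ∀ j', M ≤ j' → j' < n → G i j ≤ G i' j' := by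
  refine (Exec.seq (T := (6 : ℕ)) (R := fun s₁ => s₁.natReg rI = 0 ∧ s₁.natReg rHi = M + 1) ?_
    fun s₁ hs₁ f₁ => Exec.seq (Exec.forLoop (x := rT) (y := rHi) (p := pickStep)
      (fun t s' => s'.natReg rI ≤ M ∧ ∀ i < t, s.realArr aBest (s'.natReg rI) ≤ s.realArr aBest i)
      (N := M + 1) (c := 20) hs₁.2 (by decide) (by decide) (by decide) ?_ ?_) fun s₂ hs₂ f₂ =>
        Exec.of_wp (p := loadPair) ?_).mono ?_ fun _ h => h
  · refine Exec.mono (T' := 6) (Exec.of_wp (p := startPick) ?_) (by decide) fun _ h => h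
    simp [startPick, Program.wp, NatExpr.eval, hM]
  · simp [hs₁.1]
  · rintro t s' ht htT hf ⟨h1, h2⟩
    have e1 : s'.realArr aBest = s.realArr aBest := by
      rw [hf.realArr _ (by decide), f₁.realArr _ (by decide)]
    refine (Exec.of_wp (p := pickStep) ?_).mono (by decide) fun _ h => h
    simp only [pickStep, Program.wp, Test.Holds, RealExpr.eval, NatExpr.eval, e1, htT]
    constructor
    · intro hb
      simp
      refine ⟨by omega, fun i hi => ?_⟩
      rcases hi.lt_or_eq with hi | rfl
      · exact hb.trans (h2 i hi)
      · exact le_rfl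
    · intro hb
      simp
      refine ⟨h1, fun i hi => ?_⟩
      rcases hi.lt_or_eq with hi | rfl
      · exact h2 i hi
      · exact (not_le.1 hb).le
  · obtain ⟨h1, h2⟩ := hs₂
    have e1 : s₂.realArr aX = s.realArr aX := by
      rw [f₂.realArr _ (by decide), f₁.realArr _ (by decide)]
    have e2 : s₂.natArr bOpt = s.natArr bOpt := by
      rw [f₂.natArr _ (by decide), f₁.natArr _ (by decide)]
    have h3 := h.bounds (s₂.natReg rI) (by omega)
    have h4 := h.best_eq
    have h5 := h.isMin
    simp only [mul_one] at h3 h4 h5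
    simp only [loadPair, Program.wp, RealExpr.eval, NatExpr.eval, e1]
    refine ⟨_, _, h1, h3.1, h3.2, by simp, by simp [e2, e1], fun i' hi' j' hj1 hj2 => ?_⟩
    rw [← h4 _ h1]
    refine (h2 i' (by omega)).trans ?_
    rw [h4 _ hi']
    exact h5 i' hi' j' hj1 hj2
  · have h1 : loadPair.bound = 7 := rfl
    omega

/-! ### The output -/

notation "aFa" => 11
notation "aFb" => 12

def clearSums : Program := .storeReal aFa (.reg rC) 0 ;; .storeReal aFb (.reg rC) 0

/-- Add the distance of point `rT` from the value of register `y` to the sum for its category. -/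
def addDist (A y : ℕ) : Program :=
  .ite (.reg y ≤ᵣ .fetch aX (.reg rT))
    (.storeReal A (.reg rC) (.fetch A (.reg rC) + (.fetch aX (.reg rT) - .reg y)))
    (.storeReal A (.reg rC) (.fetch A (.reg rC) + (.reg y - .fetch aX (.reg rT))))

def addDists : Program := rC ≔ₙ .fetch bKap (.reg rT) ;; addDist aFa 0 ;; addDist aFb 1

/-- Compute the distance sums of all the categories for both candidates. -/
def sumDists : Program := forLoop rC rK clearSums ;; forLoop rT rN addDists

theorem exec_sumDists {n k : ℕ} {x : ℕ → ℝ} {κ : ℕ → ℕ} {s : Store} (hn : s.natReg rN = n)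
    (hk : s.natReg rK = k) (hxe : s.realArr aX = x) (hκe : s.natArr bKap = κ) :
    Exec sumDists s (100 * (n + k) + 20) fun s' => ∀ c < k,
      s'.realArr aFa c = absSum x (cls n κ c) (s.realReg 0) ∧
      s'.realArr aFb c = absSum x (cls n κ c) (s.realReg 1) := by
  refine (Exec.seq (Exec.forLoop (x := rC) (y := rK) (p := clearSums)
    (fun t s' => ∀ c < t, s'.realArr aFa c = 0 ∧ s'.realArr aFb c = 0)
      (N := k) (c := 24) hk (by decide) (by decide) (by decide) ?_ ?_) fun s₁ hs₁ f₁ =>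
    (Exec.forLoop (x := rT) (y := rN) (p := addDists)
      (fun p s' => ∀ c < k, s'.realArr aFa c = absSum x (cls p κ c) (s.realReg 0) ∧
        s'.realArr aFb c = absSum x (cls p κ c) (s.realReg 1))
      (N := n) (c := 60) ?_
    (by decide) (by decide) (by decide) ?_ ?_)).mono ?_ fun _ h => h
  · simp
  · intro i s' hi hiT hf inv
    refine (Exec.of_wp (p := clearSums) ?_).mono (by decide) fun _ h => h
    simp only [clearSums, Program.wp, NatExpr.eval, hiT]
    intro u hu
    rcases Nat.lt_succ_iff_lt_or_eq.1 hu with hu | rfl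
    · have := inv u hu
      simp [Function.update_of_ne hu.ne, this, hiT]
    · simp [hiT]
  · rw [f₁.natReg _ (by decide), hn]
  · simpa [cls, absSum] using hs₁
  · intro p s' hp hpT hf inv
    have e1 : s'.realReg 0 = s.realReg 0 := by
      rw [hf.realReg _ (by decide), f₁.realReg _ (by decide)]
    have e1' : s'.realReg 1 = s.realReg 1 := by
      rw [hf.realReg _ (by decide), f₁.realReg _ (by decide)]
    have e2 : s'.realArr aX = x := by rw [hf.realArr _ (by decide), f₁.realArr _ (by decide), hxe]
    have e3 : s'.natArr bKap = κ := by rw [hf.natArr _ (by decide), f₁.natArr _ (by decide), hκe]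
    refine (Exec.of_wp (p := addDists) ?_).mono (by decide) fun _ h => h
    simp only [addDists, addDist, Program.wp, Test.Holds, NatExpr.eval]
    have key : ∀ c < k, ∀ s'' : Store,
        s''.realArr aFa c = s'.realArr aFa c + (if κ p = c then |x p - s.realReg 0| else 0) →
        s''.realArr aFb c = s'.realArr aFb c + (if κ p = c then |x p - s.realReg 1| else 0) →
        s''.realArr aFa c = absSum x (cls (p + 1) κ c) (s.realReg 0) ∧
        s''.realArr aFb c = absSum x (cls (p + 1) κ c) (s.realReg 1) := by
      intro c hc s'' k1 k2
      rw [k1, k2, (inv c hc).1, (inv c hc).2]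
      exact ⟨(sum_cls_succ _).symm, (sum_cls_succ _).symm⟩
    refine ⟨fun hb => ⟨fun hb' => ?_, fun hb' => ?_⟩, fun hb => ⟨fun hb' => ?_, fun hb' => ?_⟩⟩ <;>
    · simp [hpT, e1, e1', e2, RealExpr.eval, NatExpr.eval] at hb hb'
      intro c hc
      by_cases hcp : κ p = c
      · subst hcp
        apply key (κ p) hc <;>
          simp [hpT, e1, e1', e2, e3, RealExpr.eval, NatExpr.eval] <;>
          first
            | exact (abs_of_nonneg (by linarith)).symm
            | (rw [abs_sub_comm]; exact (abs_of_nonneg (by linarith)).symm)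
      · apply key c hc <;>
          simp [hpT, e2, e3, hcp, Function.update_of_ne (Ne.symm hcp), RealExpr.eval, NatExpr.eval]
  · omega

def startSplit : Program := 2 ≔ᵣ 0 ;; rI ≔ₙ 0

/-- Assign category `rC` to the candidate that is better for it. -/
def assignCategory : Program :=
  .ite (.fetch aFa (.reg rC) ≤ᵣ .fetch aFb (.reg rC))
    (2 ≔ᵣ .reg 2 + .fetch aFa (.reg rC) ;; .storeNat bOut (.reg rC) 1 ;; rI ≔ₙ .reg rI + 1)
    (2 ≔ᵣ .reg 2 + .fetch aFb (.reg rC) ;; .storeNat bOut (.reg rC) 0)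

/-- If all the categories have been assigned to the same candidate, move category `0` to the other
side of the split. -/
def repairSplit : Program :=
  .ite (.reg rI ≤ₙ 0) (.storeNat bOut 0 1) (.ite (.reg rK ≤ₙ .reg rI) (.storeNat bOut 0 0) .skip)

/-- Write the optimal value and the split. -/
def writeSplit : Program := startSplit ;; forLoop rC rK assignCategory ;; repairSplit

/-- The value written is the error of the split written, for one of the two candidates on each side.
If a repair was needed, it is the same candidate on both sides. -/
theorem exec_writeSplit {k : ℕ} {s : Store} (hk : s.natReg rK = k) (hk0 : 0 < k) :
    Exec writeSplit s (50 * k + 60) fun s' =>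
      s'.realReg 2 = ∑ c ∈ Finset.range k, min (s.realArr aFa c) (s.realArr aFb c) ∧
      (∃ A B : ℕ → ℝ, (A = s.realArr aFa ∨ A = s.realArr aFb) ∧
        (B = s.realArr aFa ∨ B = s.realArr aFb) ∧
        s'.realReg 2 = ∑ c ∈ Finset.range k, if s'.natArr bOut c = 1 then A c else B c) ∧
      (2 ≤ k → (∃ c < k, s'.natArr bOut c = 1) ∧ ∃ c < k, s'.natArr bOut c ≠ 1) := by
  set fa := s.realArr aFa with hfa
  set fb := s.realArr aFb with hfb
  refine (Exec.seq (T := (6 : ℕ)) (R := fun s₁ => s₁.realReg 2 = 0 ∧ s₁.natReg rI = 0) ?_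
    fun s₁ hs₁ f₁ => Exec.seq (Exec.forLoop (x := rC) (y := rK) (p := assignCategory)
      (fun t s' => s'.realReg 2 = ∑ c ∈ Finset.range t, min (fa c) (fb c) ∧
        s'.natReg rI = Finset.card {c ∈ Finset.range t | fa c ≤ fb c} ∧
        ∀ c < t, s'.natArr bOut c = if fa c ≤ fb c then 1 else 0)
      (N := k) (c := 30) ?_ (by decide) (by decide) (by decide) ?_ ?_) fun s₂ hs₂ f₂ =>
        Exec.mono (T' := 20) (Exec.of_wp (p := repairSplit) ?_) (by decide)
          fun _ h => h).mono ?_ fun _ h => h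
  · refine Exec.mono (T' := 6) (Exec.of_wp (p := startSplit) ?_) (by decide) fun _ h => h
    simp [startSplit, Program.wp]
  · rw [f₁.natReg _ (by decide), hk]
  · simp [hs₁.1, hs₁.2]
  · rintro t s' ht htT hf ⟨h1, h2, h3⟩
    have e1 : s'.realArr aFa = fa := by rw [hf.realArr _ (by decide), f₁.realArr _ (by decide)]
    have e2 : s'.realArr aFb = fb := by rw [hf.realArr _ (by decide), f₁.realArr _ (by decide)]
    refine (Exec.of_wp (p := assignCategory) ?_).mono (by decide) fun _ h => h
    simp only [assignCategory, Program.wp, Test.Holds, RealExpr.eval, NatExpr.eval, e1, e2, htT]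
    constructor
    · intro hb
      refine ⟨?_, ?_, fun c hc => ?_⟩
      · simp [htT, h1, Finset.sum_range_succ, min_eq_left hb]
      · simp [h2, Finset.range_add_one, Finset.filter_insert, hb]
      · rcases Nat.lt_succ_iff_lt_or_eq.1 hc with hc | rfl
        · simp [htT, Function.update_of_ne hc.ne, h3 c hc]
        · simp [htT, hb]
    · intro hb
      refine ⟨?_, ?_, fun c hc => ?_⟩
      · simp [htT, h1, Finset.sum_range_succ,
          min_eq_right (not_le.1 hb).le]
      · simp [h2, Finset.range_add_one, Finset.filter_insert, hb]
      · rcases Nat.lt_succ_iff_lt_or_eq.1 hc with hc | rfl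
        · simp [htT, Function.update_of_ne hc.ne, h3 c hc]
        · simp [htT, hb]
  · obtain ⟨h1, h2, h3⟩ := hs₂
    have e1 : s₂.natReg rK = k := by rw [f₂.natReg _ (by decide), f₁.natReg _ (by decide), hk]
    simp only [repairSplit, Program.wp, Test.Holds, NatExpr.eval, e1]
    refine ⟨fun hb => ?_, fun hb => ⟨fun hb' => ?_, fun hb' => ?_⟩⟩
    · -- all the categories prefer the second candidate
      have hall : ∀ c < k, ¬ fa c ≤ fb c := by
        have h0 : Finset.card {c ∈ Finset.range k | fa c ≤ fb c} = 0 := by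
          have : s₂.natReg rI ≤ 0 := hb
          omega
        rw [Finset.card_eq_zero, Finset.filter_eq_empty_iff] at h0
        exact fun c hc => h0 (Finset.mem_range.2 hc)
      refine ⟨by simpa using h1, ⟨fb, fb, Or.inr rfl, Or.inr rfl, ?_⟩, fun hk2 =>
        ⟨⟨0, hk0, by simp⟩, 1, by omega, ?_⟩⟩
      · refine h1.trans (Finset.sum_congr rfl fun c hc => ?_)
        exact (min_eq_right (not_le.1 (hall c (Finset.mem_range.1 hc))).le).trans (ite_self _).symm
      · simp [h3 1 (by omega), hall 1 (by omega)]
    · have hall : ∀ c < k, fa c ≤ fb c := by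
        have h0 : Finset.card {c ∈ Finset.range k | fa c ≤ fb c} =
            Finset.card (Finset.range k) := by
          refine le_antisymm (Finset.card_filter_le _ _) ?_
          rw [Finset.card_range, ← h2]
          exact hb'
        rw [Finset.card_filter_eq_iff] at h0
        exact fun c hc => h0 c (Finset.mem_range.2 hc)
      refine ⟨by simpa using h1, ⟨fa, fa, Or.inl rfl, Or.inl rfl, ?_⟩, fun hk2 =>
        ⟨⟨1, by omega, ?_⟩, 0, hk0, by simp⟩⟩
      · refine h1.trans (Finset.sum_congr rfl fun c hc => ?_)
        exact (min_eq_left (hall c (Finset.mem_range.1 hc))).trans (ite_self _).symm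
      · simp [h3 1 (by omega), hall 1 (by omega)]
    · have hb0 : 0 < Finset.card {c ∈ Finset.range k | fa c ≤ fb c} := by
        have : ¬ s₂.natReg rI ≤ 0 := hb
        omega
      have hbk : 0 < Finset.card {c ∈ Finset.range k | ¬ fa c ≤ fb c} := by
        have := Finset.card_filter_add_card_filter_not (s := Finset.range k) (fun c => fa c ≤ fb c)
        rw [Finset.card_range] at this
        have : ¬ k ≤ s₂.natReg rI := hb'
        omega
      obtain ⟨c₁, hc₁⟩ := Finset.card_pos.1 hb0
      obtain ⟨c₂, hc₂⟩ := Finset.card_pos.1 hbk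
      rw [Finset.mem_filter, Finset.mem_range] at hc₁ hc₂
      refine ⟨h1, ⟨fa, fb, Or.inl rfl, Or.inr rfl, ?_⟩, fun _ =>
        ⟨⟨c₁, hc₁.1, by simp [h3 c₁ hc₁.1, hc₁.2]⟩, c₂, hc₂.1, by simp [h3 c₂ hc₂.1, hc₂.2]⟩⟩
      refine h1.trans (Finset.sum_congr rfl fun c hc => ?_)
      rw [h3 c (Finset.mem_range.1 hc)]
      by_cases h4 : fa c ≤ fb c
      · simp [h4]
      · simp [h4, (not_le.1 h4).le]
  · omega

/-! ### Splits of the categories -/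

section Splits

open CategoricalData

variable {n k : ℕ} (D : CategoricalData n k)

theorem sum_mem_eq_sum_cost (S : Finset (Fin k)) (a : ℝ) :
    ∑ i with D.category i ∈ S, |D.value i - a| = ∑ c ∈ S, D.cost c a := by
  rw [← Finset.sum_fiberwise_of_maps_to (g := D.category) (t := S)
    fun i hi => (Finset.mem_filter.1 hi).2]
  refine Finset.sum_congr rfl fun c hc => ?_
  rw [cost, Finset.filter_filter]
  refine Finset.sum_congr (Finset.filter_congr fun i _ => ?_) fun _ _ => rfl
  exact ⟨fun h => h.2, fun h => ⟨h ▸ hc, h⟩⟩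

theorem mae_le (S : Finset (Fin k)) (a : ℝ) : D.mae S ≤ ∑ c ∈ S, D.cost c a := by
  rw [← sum_mem_eq_sum_cost]
  exact ciInf_le ⟨0, by rintro _ ⟨a, rfl⟩; exact Finset.sum_nonneg fun _ _ => abs_nonneg _⟩ a

theorem medianCost_le (S : Finset (Fin k)) (a b : ℝ) :
    D.medianCost a b ≤ ∑ c ∈ S, D.cost c a + ∑ c ∈ Sᶜ, D.cost c b := by
  rw [medianCost, ← Finset.sum_add_sum_compl S]
  exact add_le_add (Finset.sum_le_sum fun _ _ => min_le_left _ _)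
    (Finset.sum_le_sum fun _ _ => min_le_right _ _)

variable {D}

/-- Every split of the categories, with arbitrary points for its two parts, is a candidate for the
median split problem. -/
theorem le_splitError {a b : ℝ} (h : D.IsMedianSplit a b) (S : Finset (Fin k)) :
    D.medianCost a b ≤ D.splitError S := by
  refine le_ciInf_add_ciInf fun a' b' => ?_
  rw [sum_mem_eq_sum_cost, sum_mem_eq_sum_cost]
  exact (h a' b').trans (medianCost_le D S a' b')

/-- A split into two nonempty parts whose error is at most the value of an optimal solution of the
median split problem is optimal, and the two values agree. -/
theorem isOptimalSplit_of_splitError_le {a b : ℝ} (h : D.IsMedianSplit a b) {S : Finset (Fin k)}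
    (hS : S.Nonempty) (hS' : Sᶜ.Nonempty) (hle : D.splitError S ≤ D.medianCost a b) :
    D.IsOptimalSplit S ∧ D.medianCost a b = D.splitError S :=
  ⟨⟨hS, hS', fun T _ _ => hle.trans (le_splitError h T)⟩, (le_splitError h S).antisymm hle⟩

/-- The arrays `x` and `κ` hold the values and the categories of the data points, in any order. -/
def Represents (D : CategoricalData n k) (x : ℕ → ℝ) (κ : ℕ → ℕ) : Prop :=
  ∀ F : ℝ → ℕ → ℝ, ∑ u ∈ Finset.range n, F (x u) (κ u) = ∑ i, F (D.value i) (D.category i)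

theorem represents_of_sameData {x : ℕ → ℝ} {κ : ℕ → ℕ}
    (h : SameData n (D.inputStore.realArr aVal) (D.inputStore.natArr bCat) x κ) :
    Represents D x κ := by
  intro F
  rw [h F, Finset.sum_range]
  simp [inputStore]

variable {x : ℕ → ℝ} {κ : ℕ → ℕ}

/-- Tested with the indicator function of the labels that are not categories. -/
theorem Represents.category_lt (h : Represents D x κ) : ∀ u < n, κ u < k := by
  have h0 := h fun _ c => if c < k then 0 else 1
  simp only [Fin.is_lt, if_true, Finset.sum_const_zero] at h0
  rw [Finset.sum_eq_zero_iff_of_nonneg fun _ _ => by split_ifs <;> norm_num] at h0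
  intro u hu
  by_contra hc
  simpa [hc] using h0 u (Finset.mem_range.2 hu)

theorem Represents.cost_eq (h : Represents D x κ) (c : Fin k) (y : ℝ) :
    D.cost c y = absSum x (cls n κ c) y := by
  rw [cost, absSum, cls, Finset.sum_filter, Finset.sum_filter]
  have := h fun v d => if d = c then |v - y| else 0
  simpa only [Fin.val_inj] using this.symm

theorem Represents.medianCost_eq (h : Represents D x κ) (a b : ℝ) :
    D.medianCost a b = objective n k x κ a b := by
  rw [medianCost, objective, Finset.sum_range]
  exact Finset.sum_congr rfl fun c _ => by rw [h.cost_eq, h.cost_eq]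

end Splits

/-! ### The program -/

/-- Solve the problem for at least one data point. -/
def solve : Program :=
  sortData ;; findStride ;; findRowMins ;; pickRow ;; sumDists ;; writeSplit

/-- The output of the program is correct. -/
def IsSolution {n k : ℕ} (D : CategoricalData n k) (s : Store) : Prop :=
  D.IsMedianSplit (s.realReg 0) (s.realReg 1) ∧
    s.realReg 2 = D.medianCost (s.realReg 0) (s.realReg 1) ∧
    (2 ≤ k →
      D.IsOptimalSplit (CategoricalData.outputSplit k s) ∧
      s.realReg 2 = D.splitError (CategoricalData.outputSplit k s))

theorem exec_solve {n k : ℕ} (D : CategoricalData n k) (hn : 0 < n) :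
    Exec solve D.inputStore (2100 * ((n + k * (Nat.log 2 n + 1)) * (Nat.log 2 n + 1)))
      (IsSolution D) := by
  have hk : 0 < k := (Nat.zero_le _).trans_lt (D.category ⟨0, hn⟩).2
  have hN : D.inputStore.natReg rN = n := rfl
  have hK : D.inputStore.natReg rK = k := rfl
  refine (Exec.seq (exec_sortData hN) fun s₁ hs₁ f₁ =>
    Exec.seq (exec_findStride (by rw [f₁.natReg _ (by decide), hN]) hn) fun s₂ hs₂ f₂ =>
    Exec.seq (T := 1020 * ((n + k * (Nat.log 2 n + 1)) * (Nat.log 2 n + 1)))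
      (R := fun s₃ => RowsKnown (n / 2) n 1 (splitCost n k (s₁.realArr aX) (s₁.natArr bKap))
        (s₃.natArr bOpt) (s₃.realArr aBest)) ?_ fun s₃ hs₃ f₃ =>
    Exec.seq (exec_pickRow (by rw [f₃.natReg _ (by decide), hs₂.1]) hs₃) fun s₄ hs₄ f₄ =>
    Exec.seq (exec_sumDists (n := n) (k := k) (x := s₁.realArr aX) (κ := s₁.natArr bKap)
      (by rw [f₄.natReg _ (by decide), f₃.natReg _ (by decide), f₂.natReg _ (by decide),
        f₁.natReg _ (by decide), hN])
      (by rw [f₄.natReg _ (by decide), f₃.natReg _ (by decide), f₂.natReg _ (by decide),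
        f₁.natReg _ (by decide), hK])
      (by rw [f₄.realArr _ (by decide), f₃.realArr _ (by decide), f₂.realArr _ (by decide)])
      (by rw [f₄.natArr _ (by decide), f₃.natArr _ (by decide), f₂.natArr _ (by decide)]))
      fun s₅ hs₅ f₅ =>
    (exec_writeSplit (by rw [f₅.natReg _ (by decide), f₄.natReg _ (by decide),
        f₃.natReg _ (by decide), f₂.natReg _ (by decide), f₁.natReg _ (by decide), hK])
      hk).framed.mono le_rfl fun s' hs' => ?_).mono ?_ fun _ h => h
  · obtain ⟨hM, h₀, e, hS, hMS, he⟩ := hs₂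
    exact exec_findRowMins (by rw [f₂.natReg _ (by decide), f₁.natReg _ (by decide), hN])
      (by rw [f₂.natReg _ (by decide), f₁.natReg _ (by decide), hK]) hM hn
      (f₂.realArr _ (by decide)) (f₂.natArr _ (by decide)) hs₁.1
      (represents_of_sameData hs₁.2).category_lt h₀ hS hMS he
  · have hD := represents_of_sameData hs₁.2
    set x := s₁.realArr aX with hx
    set κ := s₁.natArr bKap with hκ
    have e3 : s₃.realArr aX = x := by rw [f₃.realArr _ (by decide), f₂.realArr _ (by decide)]
    obtain ⟨i, j, hi, hj, hjn, h0, h1, hmin⟩ := hs₄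
    obtain ⟨⟨h2, ⟨A, B, hA, hB, h3⟩, h4⟩, f₆⟩ := hs'
    have e0 : s'.realReg 0 = s₄.realReg 0 := by
      rw [f₆.realReg _ (by decide), f₅.realReg _ (by decide)]
    have e1 : s'.realReg 1 = s₄.realReg 1 := by
      rw [f₆.realReg _ (by decide), f₅.realReg _ (by decide)]
    have hmed : D.IsMedianSplit (s'.realReg 0) (s'.realReg 1) := by
      intro a' b'
      obtain ⟨i', j', hi', hj', hjn', hle⟩ := exists_splitCost_le hs₁.1 hD.category_lt hn a' b'
      rw [hD.medianCost_eq, hD.medianCost_eq, e0, e1, h0, h1, e3]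
      exact (hmin i' hi' j' hj' hjn').trans hle
    have hcost : s'.realReg 2 = D.medianCost (s'.realReg 0) (s'.realReg 1) := by
      rw [h2, hD.medianCost_eq, e0, e1]
      refine Finset.sum_congr rfl fun c hc => ?_
      rw [(hs₅ c (Finset.mem_range.1 hc)).1, (hs₅ c (Finset.mem_range.1 hc)).2]
    refine ⟨hmed, hcost, fun hk2 => ?_⟩
    obtain ⟨⟨c₁, hc₁, h5⟩, c₂, hc₂, h6⟩ := h4 hk2
    have hat : ∀ A : ℕ → ℝ, A = s₅.realArr aFa ∨ A = s₅.realArr aFb →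
        ∃ a, ∀ c : Fin k, A c = D.cost c a := by
      rintro A (rfl | rfl)
      · exact ⟨_, fun c => by rw [(hs₅ c c.2).1, hD.cost_eq]⟩
      · exact ⟨_, fun c => by rw [(hs₅ c c.2).2, hD.cost_eq]⟩
    obtain ⟨a, ha⟩ := hat A hA
    obtain ⟨b, hb⟩ := hat B hB
    rw [hcost]
    refine isOptimalSplit_of_splitError_le hmed ⟨⟨c₁, hc₁⟩, ?_⟩ ⟨⟨c₂, hc₂⟩, ?_⟩ ?_
    · simpa [CategoricalData.outputSplit] using h5
    · simpa [CategoricalData.outputSplit] using h6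
    · refine (add_le_add (mae_le D _ a) (mae_le D _ b)).trans_eq ?_
      rw [← hcost, h3, Finset.sum_range, Finset.sum_ite, CategoricalData.outputSplit,
        Finset.compl_filter]
      simp only [ha, hb]
  · set L := Nat.log 2 n + 1
    set X := (n + k * L) * L
    have hL : 1 ≤ L := Nat.le_add_left _ _
    have h1 : n * L ≤ X := Nat.mul_le_mul_right _ (Nat.le_add_right _ _)
    have h2 : n ≤ n * L := Nat.le_mul_of_pos_right _ hL
    have h3 : L ≤ n * L := Nat.le_mul_of_pos_left _ hn
    have h4 : n + k ≤ X := (Nat.add_le_add_left (Nat.le_mul_of_pos_right _ hL) n).trans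
      (Nat.le_mul_of_pos_right _ hL)
    have h5 : (n + 1) * L = n * L + L := Nat.succ_mul _ _
    rw [h5]
    omega

/-- The program; there is nothing to do if there are no data points. -/
def medianSplit : Program := .ite (1 ≤ₙ .reg rN) solve .skip

theorem exec_medianSplit {n k : ℕ} (D : CategoricalData n k) :
    Exec medianSplit D.inputStore (2104 * ((n + k * (Nat.log 2 n + 1)) * (Nat.log 2 n + 1)) + 5)
      (IsSolution D) := by
  refine (Exec.ite (b := 1 ≤ₙ .reg rN) (s := D.inputStore)
    (T := 2100 * ((n + k * (Nat.log 2 n + 1)) * (Nat.log 2 n + 1)) + 1)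
    (fun hb => (exec_solve D hb).mono (Nat.le_succ _) fun _ h => h) fun hb => ?_).mono ?_
      fun _ h => h
  · have hn : ¬ 1 ≤ n := hb
    obtain rfl : n = 0 := by omega
    obtain rfl : k = 0 := by
      by_contra hk
      obtain ⟨i, -⟩ := D.category_surjective ⟨0, Nat.pos_of_ne_zero hk⟩
      exact i.elim0
    refine (Exec.of_wp (p := .skip) (Q := IsSolution D) ?_).mono (Nat.le_add_left _ _) fun _ h => h
    refine ⟨fun a b => ?_, ?_, fun h => ?_⟩
    · simp [CategoricalData.medianCost]
    · simp [CategoricalData.medianCost, CategoricalData.inputStore]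
    · omega
  · have h1 : (Test.natLe 1 (.reg rN)).cost = 3 := rfl
    rw [h1]
    omega

/-- The number `k` of categories is harmless: either `k ≤ √n`, or `log n` is at most `2 log k`. -/
theorem mul_log_le (n k : ℕ) (hn : 0 < n) : k * Real.log n ≤ 2 * (n + k * Real.log k) := by
  have hk0 : 0 ≤ k * Real.log k := mul_nonneg k.cast_nonneg (Real.log_natCast_nonneg k)
  have hn' : (0 : ℝ) < n := Nat.cast_pos.2 hn
  rcases le_or_gt (k ^ 2) n with h | h
  · have h1 : (k : ℝ) ≤ √n := Real.le_sqrt_of_sq_le (by exact_mod_cast h)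
    have h2 : Real.log n ≤ 2 * √n := by
      have := Real.log_le_self (Real.sqrt_nonneg n)
      rw [Real.log_sqrt hn'.le] at this
      linarith
    have h3 : k * Real.log n ≤ √n * (2 * √n) :=
      mul_le_mul h1 h2 (Real.log_natCast_nonneg n) (Real.sqrt_nonneg _)
    have h4 := Real.mul_self_sqrt hn'.le
    linarith
  · have h1 : Real.log n ≤ 2 * Real.log k := by
      have : Real.log n ≤ Real.log ((k : ℝ) ^ 2) := Real.log_le_log hn' (by exact_mod_cast h.le)
      rwa [Real.log_pow, Nat.cast_ofNat] at this
    have h2 := mul_le_mul_of_nonneg_left h1 (k.cast_nonneg (α := ℝ))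
    linarith

theorem log_two_add_one_le {n : ℕ} (hn : 2 ≤ n) : ((Nat.log 2 n + 1 : ℕ) : ℝ) ≤ 3 * Real.log n := by
  have h1 : (2 : ℝ) ^ Nat.log 2 n ≤ n := by exact_mod_cast Nat.pow_log_le_self 2 (by omega)
  have h2 := Real.log_le_log (by positivity) h1
  rw [Real.log_pow] at h2
  have h3 : Real.log 2 ≤ Real.log n := Real.log_le_log two_pos (by exact_mod_cast hn)
  have h4 := Real.log_two_gt_d9
  have h5 : (0 : ℝ) ≤ Nat.log 2 n := Nat.cast_nonneg _
  push_cast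
  nlinarith

theorem steps_le {n k : ℕ} (hn : 2 ≤ n) :
    ((2104 * ((n + k * (Nat.log 2 n + 1)) * (Nat.log 2 n + 1)) + 5 : ℕ) : ℝ) ≤
      45000 * ((n + k * Real.log k) * Real.log n) := by
  have hL := log_two_add_one_le hn
  have hk := mul_log_le n k (by omega)
  have hk0 : 0 ≤ k * Real.log k := mul_nonneg k.cast_nonneg (Real.log_natCast_nonneg k)
  have hn2 : (2 : ℝ) ≤ n := by exact_mod_cast hn
  have hl : 1 / 2 ≤ Real.log n := by
    have h3 : Real.log 2 ≤ Real.log n := Real.log_le_log two_pos hn2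
    have h4 := Real.log_two_gt_d9
    linarith
  set L : ℕ := Nat.log 2 n + 1
  set l := Real.log n
  have h1 : (n + k * L : ℝ) ≤ 7 * (n + k * Real.log k) := by
    have := mul_le_mul_of_nonneg_left hL (k.cast_nonneg (α := ℝ))
    linarith
  have h2 : (n + k * L : ℝ) * L ≤ 7 * (n + k * Real.log k) * (3 * l) :=
    mul_le_mul h1 hL (Nat.cast_nonneg _) (by positivity)
  have h3 : 2 * (1 / 2) ≤ (n + k * Real.log k) * l :=
    mul_le_mul (by linarith) hl (by norm_num) (by positivity)
  push_cast
  nlinarith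

end RealRAM

theorem mainTheorem1 :
    ∃ (P : RealRAM.Program) (C : ℝ), ∀ (n k : ℕ) (D : CategoricalData n k),
      ∃ (t : ℕ) (s : RealRAM.Store),
        RealRAM.Runs P D.inputStore t s ∧
        (2 ≤ n → (t : ℝ) ≤ C * ((n + k * Real.log k) * Real.log n)) ∧
        D.IsMedianSplit (s.realReg 0) (s.realReg 1) ∧
        s.realReg 2 = D.medianCost (s.realReg 0) (s.realReg 1) ∧
        (2 ≤ k →
          D.IsOptimalSplit (CategoricalData.outputSplit k s) ∧
          s.realReg 2 = D.splitError (CategoricalData.outputSplit k s)) := by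
  refine ⟨RealRAM.medianSplit, 45000, fun n k D => ?_⟩
  obtain ⟨t, s, hr, ht, hs⟩ := RealRAM.exec_medianSplit D
  exact ⟨t, s, hr, fun hn => (Nat.cast_le.2 ht).trans (RealRAM.steps_le hn), hs⟩
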